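/- Let $n\ge 1$ and let $\Lambda(n)=\mathbb{Q}[d_1^{\pm1},\dots,d_n^{\pm1}]$. A univalent diagram on $\{1,\dots,n\}$ is a finite graph, possibly with loops and multiple edges and possibly empty, all of whose vertices have valency one or three, with a cyclic orientation of the edges at each trivalent vertex, with a label in $\{1,\dots,n\}$ on each univalent vertex, and with at least one univalent vertex on each connected component; diagrams are considered up to homeomorphisms preserving labels and orientations. A leg is an edge ending in a univalent vertex; it is labeled by the label of that vertex. In planar pictures the orientations are counterclockwise. Let $\mathcal{D}(n)$ be the $\Lambda(n)$-module generated by the univalent diagrams on $\{1,\dots,n\}$ modulo the following relations. - (AS): reversing the orientation of one trivalent vertex multiplies a diagram by $-1$. - (IHX): if $x,y$ are the two halves of an edge joining two distinct trivalent vertices with cyclically ordered half-edges $(x,a,b)$ and $(y,c,d)$, then the diagram plus the two diagrams in which these vertices are replaced by $(x,b,c),(y,a,d)$ and by $(x,c,a),(y,b,d)$, respectively, is $0$. - (IntV): a diagram with a trivalent vertex all three of whose edges lead to trivalent vertices is $0$. - (CL1B): if a connected component of a diagram is the tree with three trivalent vertices on a horizontal line, all three with an upper leg labeled $i$, the left one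 also with a lower leg labeled $j$ and the right one also with a lower leg labeled $k$, then the diagram equals $d_i^2$ times the diagram in which this component is replaced by the tree with one trivalent vertex and legs labeled $i,j,k$ in this cyclic order. - (CL2B): if a diagram is obtained from a diagram $D$ by attaching two legs labeled $i$ and $j$, on the same side, to an edge joining two distinct trivalent vertices of $D$, then it equals $d_id_jD$. Disjoint union makes $\mathcal{D}(n)$ a commutative $\Lambda(n)$-algebra whose unit is the empty diagram. Let $G(n)$ be the finite set consisting of the following diagrams: - the struts (single edges) with ends labeled $a,b$, for $1\le a\le b\le n$; - the trees with one trivalent vertex and legs labeled $1,c,d$ in this cyclic order, for $2\le c<d\le n$; - the trees with two trivalent vertices on a horizontal line, the left one with an upper leg labeled $1$ and a lower leg labeled $e$, the right one with an upper leg labeled $1$ and a lower leg labeled $f$, for $2\le e\le f\le n$; - the wheel consisting of a circle with two outward legs, both labeled $1$. Then the commutative $\Lambda(n)$-algebra $\mathcal{D}(n)$ is freely generated by $G(n)$: the homomorphism of $\Lambda(n)$-algebras from the polynomial ring over $\Lambda(n)$ in variables indexed by $G(n)$ to $\mathcal{D}(n)$ that sends each variable to the class of the corresponding diagram is an isomorphism.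 -/

import Mathlib

/-- `b` is reached from `a` by repeatedly applying `opp` and `next`. -/
abbrev HalfEdgeReach {H : Type} (opp next : H → H) (a b : H) : Prop :=
  Relation.ReflTransGen (fun a b => b = opp a ∨ b = next a) a b

/-- A univalent diagram on a set `M`, presented through its half-edges.

* `opp h` is the other half of the edge that contains `h` (edges are not oriented, loops and
  multiple edges are allowed);
* the orbits of `next` are the vertices: an orbit with one element is a univalent vertex, an orbit
  with three elements is a trivalent vertex, and `next` is its cyclic orientation
  (counterclockwise in pictures);
* `label` assigns an element of `M` to each univalent vertex and nothing to the half-edges at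
  trivalent vertices;
* each connected component has at least one univalent vertex. -/
structure UniDiagram (M : Type) where
  H : Type
  finite_H : Finite H
  opp : H → H
  next : H → H
  label : H → Option M
  opp_opp : ∀ h, opp (opp h) = h
  opp_ne : ∀ h, opp h ≠ h
  next_next_next : ∀ h, next (next (next h)) = h
  isSome_label_iff : ∀ h, (label h).isSome ↔ next h = h
  exists_univalent : ∀ h, ∃ u, HalfEdgeReach opp next h u ∧ next u = u

namespace UniDiagram

variable {M : Type}

/-- Homeomorphism of diagrams: a bijection of the half-edges that respects the edges, the oriented
vertices and the labels. -/
def Iso (D E : UniDiagram M) : Prop :=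
  ∃ e : D.H ≃ E.H, (∀ h, e (D.opp h) = E.opp (e h)) ∧ (∀ h, e (D.next h) = E.next (e h)) ∧
    ∀ h, D.label h = E.label (e h)

theorem iso_equivalence : Equivalence (Iso (M := M)) where
  refl D := ⟨Equiv.refl _, by simp⟩
  symm := by
    rintro D E ⟨e, h1, h2, h3⟩
    refine ⟨e.symm, fun h => ?_, fun h => ?_, fun h => ?_⟩
    · rw [Equiv.symm_apply_eq, h1, Equiv.apply_symm_apply]
    · rw [Equiv.symm_apply_eq, h2, Equiv.apply_symm_apply]
    · rw [h3, Equiv.apply_symm_apply]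
  trans := by
    rintro D E F ⟨e, h1, h2, h3⟩ ⟨f, k1, k2, k3⟩
    exact ⟨e.trans f, by simp [h1, k1], by simp [h2, k2], by simp [h3, k3]⟩

instance setoid (M : Type) : Setoid (UniDiagram M) := ⟨Iso, iso_equivalence⟩

/-- The empty diagram. -/
def empty (M : Type) : UniDiagram M where
  H := Empty
  finite_H := inferInstance
  opp := id
  next := id
  label := fun h => h.elim
  opp_opp := fun h => h.elim
  opp_ne := fun h => h.elim
  next_next_next := fun h => h.elim
  isSome_label_iff := fun h => h.elim
  exists_univalent := fun h => h.elim

/-- The disjoint union of two diagrams. -/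
def union (D E : UniDiagram M) : UniDiagram M where
  H := D.H ⊕ E.H
  finite_H := by
    have := D.finite_H
    have := E.finite_H
    infer_instance
  opp := Sum.map D.opp E.opp
  next := Sum.map D.next E.next
  label := Sum.elim D.label E.label
  opp_opp := by
    rintro (h | h)
    exacts [congrArg Sum.inl (D.opp_opp h), congrArg Sum.inr (E.opp_opp h)]
  opp_ne := by rintro (h | h) <;> simp [D.opp_ne, E.opp_ne]
  next_next_next := by
    rintro (h | h)
    exacts [congrArg Sum.inl (D.next_next_next h), congrArg Sum.inr (E.next_next_next h)]
  isSome_label_iff := by rintro (h | h) <;> simp [D.isSome_label_iff, E.isSome_label_iff]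
  exists_univalent := by
    rintro (h | h)
    · obtain ⟨u, hu, hu'⟩ := D.exists_univalent h
      refine ⟨Sum.inl u, hu.lift Sum.inl ?_, by simp [hu']⟩
      rintro a b (rfl | rfl)
      exacts [Or.inl rfl, Or.inr rfl]
    · obtain ⟨u, hu, hu'⟩ := E.exists_univalent h
      refine ⟨Sum.inr u, hu.lift Sum.inr ?_, by simp [hu']⟩
      rintro a b (rfl | rfl)
      exacts [Or.inl rfl, Or.inr rfl]

theorem union_congr {D D' E E' : UniDiagram M} (h : Iso D D') (k : Iso E E') :
    Iso (union D E) (union D' E') := by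
  obtain ⟨e, h1, h2, h3⟩ := h
  obtain ⟨f, k1, k2, k3⟩ := k
  refine ⟨Equiv.sumCongr e f, ?_, ?_, ?_⟩
  · rintro (a | a)
    · exact congrArg Sum.inl (h1 a)
    · exact congrArg Sum.inr (k1 a)
  · rintro (a | a)
    · exact congrArg Sum.inl (h2 a)
    · exact congrArg Sum.inr (k2 a)
  · rintro (a | a)
    · exact h3 a
    · exact k3 a

theorem union_comm (D E : UniDiagram M) : Iso (union D E) (union E D) :=
  ⟨Equiv.sumComm _ _, by rintro (a | a) <;> rfl, by rintro (a | a) <;> rfl,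
    by rintro (a | a) <;> rfl⟩

theorem union_assoc (D E F : UniDiagram M) :
    Iso (union (union D E) F) (union D (union E F)) :=
  ⟨Equiv.sumAssoc _ _ _, by rintro ((a | a) | a) <;> rfl, by rintro ((a | a) | a) <;> rfl,
    by rintro ((a | a) | a) <;> rfl⟩

theorem empty_union (D : UniDiagram M) : Iso (union (empty M) D) D :=
  ⟨Equiv.emptySum Empty D.H, by rintro (a | a); exacts [a.elim, rfl],
    by rintro (a | a); exacts [a.elim, rfl], by rintro (a | a); exacts [a.elim, rfl]⟩

/-! ### Changing the vertices of a diagram -/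

/-- Rename by `π` the half-edges in the cyclic orders at the vertices: a vertex `(a, b, c)` becomes
`(π a, π b, π c)`, the edges stay as they are. -/
def twistNext (D : UniDiagram M) (π : Equiv.Perm D.H) (h : D.H) : D.H := π (D.next (π.symm h))

theorem reach_opp {H : Type} {opp next : H → H} {a b c : H} (h : HalfEdgeReach opp next a b)
    (e : opp b = c) : HalfEdgeReach opp next a c := h.tail (Or.inl e.symm)

theorem reach_next {H : Type} {opp next : H → H} {a b c : H} (h : HalfEdgeReach opp next a b)
    (e : next b = c) : HalfEdgeReach opp next a c := h.tail (Or.inr e.symm)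

theorem reach_symm {H : Type} {opp next : H → H} (ho : ∀ h, opp (opp h) = h)
    (hn : ∀ h, next (next (next h)) = h) {a b : H}
    (h : HalfEdgeReach opp next a b) : HalfEdgeReach opp next b a := by
  induction h with
  | refl => exact .refl
  | tail _ h2 ih =>
    refine Relation.ReflTransGen.trans ?_ ih
    rcases h2 with rfl | rfl
    · exact reach_opp .refl (ho _)
    · exact reach_next (reach_next .refl rfl) (hn _)

theorem twistNext_three (D : UniDiagram M) (π : Equiv.Perm D.H) (h : D.H) :
    D.twistNext π (D.twistNext π (D.twistNext π h)) = h := by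
  simp [twistNext, D.next_next_next]

/-- The diagram with the vertices changed by `π`, for a permutation `π` that moves only half-edges
at trivalent vertices and only inside the components of the result. -/
def twist (D : UniDiagram M) (π : Equiv.Perm D.H) (hl : ∀ h, D.label (π h) = D.label h)
    (hc : ∀ h, HalfEdgeReach D.opp (D.twistNext π) h (π h)) :
    UniDiagram M where
  H := D.H
  finite_H := D.finite_H
  opp := D.opp
  next := D.twistNext π
  label := D.label
  opp_opp := D.opp_opp
  opp_ne := D.opp_ne
  next_next_next := D.twistNext_three π
  isSome_label_iff h := by
    have h1 := D.isSome_label_iff (π.symm h)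
    have h2 := hl (π.symm h)
    rw [Equiv.apply_symm_apply] at h2
    rw [h2, h1, twistNext, ← Equiv.eq_symm_apply]
  exists_univalent h := by
    obtain ⟨u, hu, hu'⟩ := D.exists_univalent h
    refine ⟨π u, ?_, by simp [twistNext, hu']⟩
    refine Relation.ReflTransGen.trans ?_ (hc u)
    have hs : ∀ a b, (b = D.opp a ∨ b = D.next a) →
        HalfEdgeReach D.opp (D.twistNext π) a b := by
      rintro a b (rfl | rfl)
      · exact .single (Or.inl rfl)
      · refine (hc a).trans (Relation.ReflTransGen.trans (.single (Or.inr rfl)) ?_)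
        have h3 := reach_symm D.opp_opp (D.twistNext_three π) (hc (D.next a))
        have h4 : D.twistNext π (π a) = π (D.next a) := by simp [twistNext]
        rw [h4]
        exact h3
    clear hu'
    induction hu with
    | refl => exact .refl
    | tail _ h2 ih => exact ih.trans (hs _ _ h2)

theorem label_eq_none_iff (D : UniDiagram M) (h : D.H) : D.label h = none ↔ D.next h ≠ h := by
  rw [← not_iff_not, not_not, ← D.isSome_label_iff h, Option.isSome_iff_ne_none]

theorem next_ne (D : UniDiagram M) {h : D.H} (hh : D.next h ≠ h) :
    D.next (D.next h) ≠ D.next h := by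
  intro k
  have h3 := D.next_next_next h
  rw [k, k] at h3
  exact hh h3

theorem next_next_ne (D : UniDiagram M) {h : D.H} (hh : D.next h ≠ h) :
    D.next (D.next h) ≠ h := by
  intro k
  have h3 := D.next_next_next h
  rw [k] at h3
  exact hh h3

theorem next_injective (D : UniDiagram M) : Function.Injective D.next := by
  intro a b h
  rw [← D.next_next_next a, h, D.next_next_next]

/-- The permutation that exchanges the two half-edges following `h` at its vertex. -/
noncomputable def flipPerm (D : UniDiagram M) (h : D.H) : Equiv.Perm D.H :=
  open Classical in Equiv.swap (D.next h) (D.next (D.next h))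

/-- Reverse the cyclic orientation of the trivalent vertex at the half-edge `h`. -/
noncomputable def flip (D : UniDiagram M) (h : D.H) (hh : D.next h ≠ h) : UniDiagram M :=
  D.twist (D.flipPerm h)
    (by
      classical
      have h1 := (D.label_eq_none_iff _).2 (D.next_ne hh)
      have h2 := (D.label_eq_none_iff _).2 (D.next_ne (D.next_ne hh))
      intro k
      rw [flipPerm, Equiv.swap_apply_def]
      split_ifs with hk hk
      · rw [hk, h1, h2]
      · rw [hk, h1, h2]
      · rfl)
    (by
      classical
      have n1 := hh
      have n2 := D.next_ne hh
      have n3 := D.next_next_ne hh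
      have e1 : D.twistNext (D.flipPerm h) (D.next (D.next h)) = D.next h := by
        simp [twistNext, flipPerm]
      have e2 : D.twistNext (D.flipPerm h) (D.next h) = h := by
        simp [twistNext, flipPerm, D.next_next_next,
          Equiv.swap_apply_of_ne_of_ne n1.symm n3.symm]
      have e3 : D.twistNext (D.flipPerm h) h = D.next (D.next h) := by
        simp [twistNext, flipPerm, Equiv.swap_apply_of_ne_of_ne n1.symm n3.symm]
      intro k
      by_cases k1 : k = D.next h
      · subst k1
        have : D.flipPerm h (D.next h) = D.next (D.next h) := by simp [flipPerm]
        rw [this]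
        exact reach_next (reach_next .refl e2) e3
      · by_cases k2 : k = D.next (D.next h)
        · subst k2
          have : D.flipPerm h (D.next (D.next h)) = D.next h := by simp [flipPerm]
          rw [this]
          exact .single (Or.inr e1.symm)
        · have : D.flipPerm h k = k := by
            simp [flipPerm, Equiv.swap_apply_of_ne_of_ne k1 k2]
          rw [this])

/-- The half-edge `x` lies on an edge between two different trivalent vertices. -/
def IsInner (D : UniDiagram M) (x : D.H) : Prop :=
  D.next x ≠ x ∧ D.next (D.opp x) ≠ D.opp x ∧
    D.opp x ≠ D.next x ∧ D.opp x ≠ D.next (D.next x)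

/-- For an inner edge between vertices `(x, a, b)` and `(y, c, d)`, the cyclic permutation
`a ↦ b ↦ c ↦ a`. -/
noncomputable def cyclePerm (D : UniDiagram M) (x : D.H) : Equiv.Perm D.H :=
  open Classical in
  Equiv.swap (D.next x) (D.next (D.next x)) *
    Equiv.swap (D.next (D.next x)) (D.next (D.opp x))

theorem IsInner.facts {D : UniDiagram M} {x : D.H} (hx : D.IsInner x) :
    [x, D.next x, D.next (D.next x), D.opp x, D.next (D.opp x),
      D.next (D.next (D.opp x))].Nodup := by
  obtain ⟨h1, h2, h3, h4⟩ := hx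
  have a1 := D.next_ne h1
  have a2 := D.next_next_ne h1
  have b1 := D.next_ne h2
  have b2 := D.next_next_ne h2
  have c := D.opp_ne x
  have i1 : D.next (D.opp x) ≠ x := fun h => h4 ((D.next_next_next _).symm.trans (by rw [h]))
  have i2 : D.next (D.opp x) ≠ D.next x := fun h => c (D.next_injective h)
  have i3 : D.next (D.opp x) ≠ D.next (D.next x) := fun h => h3 (D.next_injective h)
  have j1 : D.next (D.next (D.opp x)) ≠ x := fun h => h3 ((D.next_next_next _).symm.trans (by rw [h]))
  have j2 : D.next (D.next (D.opp x)) ≠ D.next x := fun h => i1 (D.next_injective h)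
  have j3 : D.next (D.next (D.opp x)) ≠ D.next (D.next x) := fun h => i2 (D.next_injective h)
  simp only [List.nodup_cons, List.mem_cons, List.not_mem_nil, or_false, not_or,
    List.nodup_nil, not_false_eq_true, and_true]
  exact ⟨⟨h1.symm, a2.symm, c.symm, i1.symm, j1.symm⟩, ⟨a1.symm, h3.symm, i2.symm, j2.symm⟩,
    ⟨h4.symm, i3.symm, j3.symm⟩, ⟨h2.symm, b2.symm⟩, b1.symm⟩

theorem cyclePerm_spec (D : UniDiagram M) {x : D.H} (hx : D.IsInner x) :
    D.cyclePerm x (D.next x) = D.next (D.next x) ∧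
    D.cyclePerm x (D.next (D.next x)) = D.next (D.opp x) ∧
    D.cyclePerm x (D.next (D.opp x)) = D.next x ∧
    ∀ k, k ≠ D.next x → k ≠ D.next (D.next x) → k ≠ D.next (D.opp x) →
      D.cyclePerm x k = k := by
  have hf := hx.facts
  simp only [List.nodup_cons, List.mem_cons, List.not_mem_nil, or_false, not_or,
    List.nodup_nil, not_false_eq_true, and_true] at hf
  refine ⟨?_, ?_, ?_, fun k k1 k2 k3 => ?_⟩ <;>
    simp only [cyclePerm, Equiv.Perm.mul_apply, Equiv.swap_apply_def] <;> grind

theorem label_cyclePerm (D : UniDiagram M) {x : D.H} (hx : D.IsInner x) (k : D.H) :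
    D.label (D.cyclePerm x k) = D.label k := by
  obtain ⟨s1, s2, s3, s4⟩ := D.cyclePerm_spec hx
  have l1 := (D.label_eq_none_iff _).2 (D.next_ne hx.1)
  have l2 := (D.label_eq_none_iff _).2 (D.next_ne (D.next_ne hx.1))
  have l3 := (D.label_eq_none_iff _).2 (D.next_ne hx.2.1)
  by_cases k1 : k = D.next x
  · rw [k1, s1, l1, l2]
  by_cases k2 : k = D.next (D.next x)
  · rw [k2, s2, l2, l3]
  by_cases k3 : k = D.next (D.opp x)
  · rw [k3, s3, l1, l3]
  rw [s4 k k1 k2 k3]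

/-- For an inner edge between vertices `(x, a, b)` and `(y, c, d)`, the diagram with these vertices
replaced by `(x, b, c)` and `(y, a, d)`. -/
noncomputable def rot₁ (D : UniDiagram M) (x : D.H) (hx : D.IsInner x) : UniDiagram M :=
  D.twist (D.cyclePerm x) (D.label_cyclePerm hx)
    (by
      obtain ⟨s1, s2, s3, s4⟩ := D.cyclePerm_spec hx
      have hf := hx.facts
      simp only [List.nodup_cons, List.mem_cons, List.not_mem_nil, or_false, not_or,
        List.nodup_nil, not_false_eq_true, and_true] at hf
      have sx := s4 x (by grind) (by grind) (by grind)
      have sy := s4 (D.opp x) (by grind) (by grind) (by grind)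
      have sd := s4 (D.next (D.next (D.opp x))) (by grind) (by grind) (by grind)
      have t : ∀ k, D.twistNext (D.cyclePerm x) (D.cyclePerm x k) = D.cyclePerm x (D.next k) := by
        intro k
        simp [twistNext]
      have tx := t x
      have ta := t (D.next x)
      have tb := t (D.next (D.next x))
      have ty := t (D.opp x)
      have tc := t (D.next (D.opp x))
      have td := t (D.next (D.next (D.opp x)))
      rw [D.next_next_next] at tb td
      rw [sx, s1] at tx
      rw [s1, s2] at ta
      rw [s2, sx] at tb
      rw [sy, s3] at ty
      rw [s3, sd] at tc
      rw [sd, sy] at td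
      have hyx := D.opp_opp x
      intro k
      by_cases k1 : k = D.next x
      · rw [k1, s1]
        exact reach_next (reach_opp (reach_next (reach_next .refl tc) td) hyx) tx
      by_cases k2 : k = D.next (D.next x)
      · rw [k2, s2]
        exact .single (Or.inr ta.symm)
      by_cases k3 : k = D.next (D.opp x)
      · rw [k3, s3]
        exact reach_next (reach_opp (reach_next .refl tb) rfl) ty
      rw [s4 k k1 k2 k3])

/-- For an inner edge between vertices `(x, a, b)` and `(y, c, d)`, the diagram with these vertices
replaced by `(x, c, a)` and `(y, b, d)`. -/
noncomputable def rot₂ (D : UniDiagram M) (x : D.H) (hx : D.IsInner x) : UniDiagram M :=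
  D.twist (D.cyclePerm x).symm
    (fun k => by
      have h := D.label_cyclePerm hx ((D.cyclePerm x).symm k)
      rw [Equiv.apply_symm_apply] at h
      exact h.symm)
    (by
      obtain ⟨s1, s2, s3, s4⟩ := D.cyclePerm_spec hx
      have hf := hx.facts
      simp only [List.nodup_cons, List.mem_cons, List.not_mem_nil, or_false, not_or,
        List.nodup_nil, not_false_eq_true, and_true] at hf
      have sx := s4 x (by grind) (by grind) (by grind)
      have sy := s4 (D.opp x) (by grind) (by grind) (by grind)
      have sd := s4 (D.next (D.next (D.opp x))) (by grind) (by grind) (by grind)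
      rw [eq_comm, ← Equiv.symm_apply_eq] at s1 s2 s3 sx sy sd
      have t : ∀ k, D.twistNext (D.cyclePerm x).symm ((D.cyclePerm x).symm k)
          = (D.cyclePerm x).symm (D.next k) := by
        intro k
        simp [twistNext]
      have tx := t x
      have ta := t (D.next x)
      have tb := t (D.next (D.next x))
      have ty := t (D.opp x)
      have tc := t (D.next (D.opp x))
      have td := t (D.next (D.next (D.opp x)))
      rw [D.next_next_next] at tb td
      rw [sx, s3] at tx
      rw [s3, s1] at ta
      rw [s1, sx] at tb
      rw [sy, s2] at ty
      rw [s2, sd] at tc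
      rw [sd, sy] at td
      have hyx := D.opp_opp x
      intro k
      by_cases k1 : k = D.next x
      · rw [k1, s3]
        exact reach_next (reach_next .refl tb) tx
      by_cases k2 : k = D.next (D.next x)
      · rw [k2, s1]
        exact reach_next (reach_next (reach_opp (reach_next (reach_next .refl tc) td) hyx) tx) ta
      by_cases k3 : k = D.next (D.opp x)
      · rw [k3, s2]
        exact reach_next (reach_opp (reach_next (reach_next .refl ta) tb) rfl) ty
      have : (D.cyclePerm x).symm k = k := by
        rw [Equiv.symm_apply_eq, s4 k k1 k2 k3]
      rw [this])

/-! ### Attaching a leg to an edge -/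

/-- The four half-edges that arise when a leg is attached to an edge: the three half-edges `back`,
`fwd`, `stem` at the new trivalent vertex and the univalent end `leaf` of the leg. -/
inductive LegPart : Type
  | back
  | fwd
  | stem
  | leaf

theorem LegPart.finite : Finite LegPart := by
  refine Finite.of_surjective
    (fun k : Fin 4 => ![LegPart.back, LegPart.fwd, LegPart.stem, LegPart.leaf] k) ?_
  rintro (_ | _ | _ | _)
  · exact ⟨0, rfl⟩
  · exact ⟨1, rfl⟩
  · exact ⟨2, rfl⟩
  · exact ⟨3, rfl⟩

/-- Pairing of the half-edges after a new vertex has been put on the edge of `x`. -/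
noncomputable def legOpp (D : UniDiagram M) (x : D.H) : D.H ⊕ LegPart → D.H ⊕ LegPart
  | Sum.inl h =>
    open Classical in
    if h = x then Sum.inr LegPart.back
    else if h = D.opp x then Sum.inr LegPart.fwd
    else Sum.inl (D.opp h)
  | Sum.inr LegPart.back => Sum.inl x
  | Sum.inr LegPart.fwd => Sum.inl (D.opp x)
  | Sum.inr LegPart.stem => Sum.inr LegPart.leaf
  | Sum.inr LegPart.leaf => Sum.inr LegPart.stem

/-- Cyclic orientations after a leg has been attached; the new vertex is oriented as
`(fwd, stem, back)`: seen in the direction from `x` to `opp x`, the leg is on the left. -/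
def legNext (D : UniDiagram M) : D.H ⊕ LegPart → D.H ⊕ LegPart
  | Sum.inl h => Sum.inl (D.next h)
  | Sum.inr LegPart.fwd => Sum.inr LegPart.stem
  | Sum.inr LegPart.stem => Sum.inr LegPart.back
  | Sum.inr LegPart.back => Sum.inr LegPart.fwd
  | Sum.inr LegPart.leaf => Sum.inr LegPart.leaf

/-- Labels after a leg labeled `i` has been attached. -/
def legLabel (D : UniDiagram M) (i : M) : D.H ⊕ LegPart → Option M
  | Sum.inl h => D.label h
  | Sum.inr LegPart.leaf => some i
  | Sum.inr _ => none

/-- Attach a leg labeled `i` to the edge that contains the half-edge `x`, on the left side in the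
direction from `x` to `opp x`. -/
noncomputable def addLeg (D : UniDiagram M) (x : D.H) (i : M) : UniDiagram M where
  H := D.H ⊕ LegPart
  finite_H := by
    have := D.finite_H
    have := LegPart.finite
    infer_instance
  opp := D.legOpp x
  next := D.legNext
  label := D.legLabel i
  opp_opp := by
    have hx := D.opp_ne x
    rintro (h | _ | _ | _ | _)
    · by_cases h1 : h = x
      · simp [legOpp, h1]
      · by_cases h2 : h = D.opp x
        · simp [legOpp, h2, hx]
        · have h3 : D.opp h ≠ x := fun e => h2 (by rw [← e, D.opp_opp])
          have h4 : D.opp h ≠ D.opp x := fun e => h1 (by rw [← D.opp_opp h, e, D.opp_opp])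
          simp [legOpp, h1, h2, h3, h4, D.opp_opp]
    · simp [legOpp]
    · simp [legOpp, hx]
    · simp [legOpp]
    · simp [legOpp]
  opp_ne := by
    rintro (h | _ | _ | _ | _)
    · simp only [legOpp]
      split_ifs <;> simp [D.opp_ne]
    all_goals simp [legOpp]
  next_next_next := by rintro (h | _ | _ | _ | _) <;> simp [legNext, D.next_next_next]
  isSome_label_iff := by
    rintro (h | _ | _ | _ | _) <;> simp [legNext, legLabel, D.isSome_label_iff]
  exists_univalent := by
    have hs : HalfEdgeReach (D.legOpp x) D.legNext
        (Sum.inr LegPart.stem) (Sum.inr LegPart.leaf) := .single (Or.inl rfl)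
    have hf : HalfEdgeReach (D.legOpp x) D.legNext
        (Sum.inr LegPart.fwd) (Sum.inr LegPart.leaf) := .head (Or.inr rfl) hs
    rintro (h | _ | _ | _ | _)
    · obtain ⟨u, hu, hu'⟩ := D.exists_univalent h
      refine ⟨Sum.inl u, ?_, by simp [legNext, hu']⟩
      clear hu'
      induction hu with
      | refl => exact .refl
      | @tail b c _ h2 ih =>
        refine ih.trans ?_
        rcases h2 with rfl | rfl
        · by_cases h1 : b = x
          · subst h1
            refine .head (b := Sum.inr LegPart.back) (Or.inl (by simp [legOpp])) ?_
            refine .head (b := Sum.inr LegPart.fwd) (Or.inr rfl) ?_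
            exact .single (Or.inl rfl)
          · by_cases h2 : b = D.opp x
            · subst h2
              rw [D.opp_opp]
              refine .head (b := Sum.inr LegPart.fwd) (Or.inl (by simp [legOpp, D.opp_ne])) ?_
              refine .head (b := Sum.inr LegPart.stem) (Or.inr rfl) ?_
              refine .head (b := Sum.inr LegPart.back) (Or.inr rfl) ?_
              exact .single (Or.inl rfl)
            · exact .single (Or.inl (by simp [legOpp, h1, h2]))
        · exact .single (Or.inr rfl)
    · exact ⟨_, .head (Or.inr rfl) hf, rfl⟩
    · exact ⟨_, hf, rfl⟩
    · exact ⟨_, hs, rfl⟩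
    · exact ⟨_, .refl, rfl⟩

/-- Attach two legs labeled `i` and `j`, on the same side, to the edge that contains `x`; in the
direction from `x` to `opp x` the leg `i` comes first. -/
noncomputable def addTwoLegs (D : UniDiagram M) (x : D.H) (i j : M) : UniDiagram M :=
  (D.addLeg x i).addLeg (Sum.inr LegPart.fwd) j

/-- Attach three legs on the same side of an edge. -/
noncomputable def addThreeLegs (D : UniDiagram M) (x : D.H) (i j k : M) : UniDiagram M :=
  (D.addTwoLegs x i j).addLeg (Sum.inr LegPart.fwd) k

/-! ### Some diagrams -/

/-- The strut: a single edge with two univalent vertices, labeled `a` and `b`. -/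
def strut (a b : M) : UniDiagram M where
  H := Bool
  finite_H := inferInstance
  opp := not
  next := id
  label := fun h => some (cond h b a)
  opp_opp := by simp
  opp_ne := by simp
  next_next_next := fun _ => rfl
  isSome_label_iff := by simp
  exists_univalent := fun h => ⟨h, .refl, rfl⟩

/-- The tree with one trivalent vertex and legs labeled `i`, `j`, `k` in this cyclic order. -/
noncomputable def tripod (i j k : M) : UniDiagram M :=
  (strut j k).addLeg (show Bool from false) i

/-- The tree with two trivalent vertices, one with legs `i` (up) and `k` (down), the other, to its
right, with legs `j` (up) and `l` (down). -/
noncomputable def hTree (i j k l : M) : UniDiagram M :=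
  (strut k l).addTwoLegs (show Bool from false) i j

/-- The comb with three trivalent vertices in a row, with legs `i` (up) and `k` (down) at the left
vertex, `m` (up) at the middle vertex, `j` (up) and `l` (down) at the right vertex. -/
noncomputable def comb (i m j k l : M) : UniDiagram M :=
  (strut k l).addThreeLegs (show Bool from false) i m j

/-- A loop with one leg labeled `i`; the edge of `fwd` and `back` is the loop. -/
def lollipop (i : M) : UniDiagram M where
  H := LegPart
  finite_H := LegPart.finite
  opp
    | LegPart.back => LegPart.fwd
    | LegPart.fwd => LegPart.back
    | LegPart.stem => LegPart.leaf
    | LegPart.leaf => LegPart.stem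
  next
    | LegPart.fwd => LegPart.stem
    | LegPart.stem => LegPart.back
    | LegPart.back => LegPart.fwd
    | LegPart.leaf => LegPart.leaf
  label
    | LegPart.leaf => some i
    | _ => none
  opp_opp := by rintro (_ | _ | _ | _) <;> rfl
  opp_ne := by rintro (_ | _ | _ | _) <;> simp
  next_next_next := by rintro (_ | _ | _ | _) <;> rfl
  isSome_label_iff := by rintro (_ | _ | _ | _) <;> simp
  exists_univalent := by
    rintro (_ | _ | _ | _)
    · exact ⟨LegPart.leaf, .head (b := LegPart.fwd) (Or.inr rfl)
        (.head (b := LegPart.stem) (Or.inr rfl) (.single (Or.inl rfl))), rfl⟩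
    · exact ⟨LegPart.leaf, .head (b := LegPart.stem) (Or.inr rfl) (.single (Or.inl rfl)), rfl⟩
    · exact ⟨LegPart.leaf, .single (Or.inl rfl), rfl⟩
    · exact ⟨LegPart.leaf, .refl, rfl⟩

/-- The wheel `i – ○ – j`: a circle with two legs labeled `i` and `j`, both pointing outward. -/
noncomputable def wheel (i j : M) : UniDiagram M :=
  (lollipop i).addLeg LegPart.fwd j

end UniDiagram

/-- Univalent diagrams on `M` up to homeomorphism. -/
def DiagramClass (M : Type) : Type 1 := Quotient (UniDiagram.setoid M)

/-- The class of a diagram. -/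
def UniDiagram.cls {M : Type} (D : UniDiagram M) : DiagramClass M :=
  Quotient.mk (UniDiagram.setoid M) D

/-- Diagrams form a commutative monoid under disjoint union, with the empty diagram as unit. -/
instance DiagramClass.commMonoid (M : Type) : CommMonoid (DiagramClass M) where
  mul := Quotient.map₂ UniDiagram.union
    (fun _ _ h _ _ k => UniDiagram.union_congr h k)
  one := (UniDiagram.empty M).cls
  mul_assoc := by
    rintro ⟨D⟩ ⟨E⟩ ⟨F⟩
    exact Quotient.sound (UniDiagram.union_assoc D E F)
  mul_comm := by
    rintro ⟨D⟩ ⟨E⟩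
    exact Quotient.sound (UniDiagram.union_comm D E)
  one_mul := by
    rintro ⟨D⟩
    exact Quotient.sound (UniDiagram.empty_union D)
  mul_one := by
    rintro ⟨D⟩
    exact Quotient.sound
      (UniDiagram.iso_equivalence.trans (UniDiagram.union_comm D _) (UniDiagram.empty_union D))

/-- The ring `Λ(n) = ℚ[d₁^{±1}, …, dₙ^{±1}]` of Laurent polynomials, as the group algebra of
`ℤⁿ`. -/
abbrev LaurentRing (n : ℕ) : Type := AddMonoidAlgebra ℚ (Fin n → ℤ)

/-- The variable `dᵢ`. -/
noncomputable def dVar {n : ℕ} (i : Fin n) : LaurentRing n :=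
  AddMonoidAlgebra.single (Pi.single i 1) 1

/-- The free `Λ(n)`-module on the univalent diagrams on `{1, …, n}`, with the multiplication given
by disjoint union. The label `k` of the mathematical notation is the element `k - 1` of `Fin n`. -/
abbrev FreeDiagramAlgebra (n : ℕ) : Type 1 := MonoidAlgebra (LaurentRing n) (DiagramClass (Fin n))

/-- A diagram as a basis element of the free module. -/
noncomputable def UniDiagram.toFree {n : ℕ} (D : UniDiagram (Fin n)) : FreeDiagramAlgebra n :=
  MonoidAlgebra.of (LaurentRing n) (DiagramClass (Fin n)) D.cls

/-- The relations between univalent diagrams, each written as an element that becomes zero. -/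
inductive DiagramRel (n : ℕ) : FreeDiagramAlgebra n → Prop
  /-- (AS): reversing the orientation of a trivalent vertex changes the sign. -/
  | as (D : UniDiagram (Fin n)) (h : D.H) (hh : D.next h ≠ h) :
      DiagramRel n (D.toFree + (D.flip h hh).toFree)
  /-- (IHX) at an edge `{x, y}` between vertices `(x, a, b)` and `(y, c, d)`: the sum over the
  cyclic permutations of `a, b, c` vanishes. -/
  | ihx (D : UniDiagram (Fin n)) (x : D.H) (hx : D.IsInner x) :
      DiagramRel n (D.toFree + (D.rot₁ x hx).toFree + (D.rot₂ x hx).toFree)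
  /-- (IntV): a diagram vanishes if all three edges at some trivalent vertex lead to trivalent
  vertices. -/
  | intV (D : UniDiagram (Fin n)) (h : D.H) (hh : D.next h ≠ h)
      (h0 : D.next (D.opp h) ≠ D.opp h)
      (h1 : D.next (D.opp (D.next h)) ≠ D.opp (D.next h))
      (h2 : D.next (D.opp (D.next (D.next h))) ≠ D.opp (D.next (D.next h))) :
      DiagramRel n D.toFree
  /-- (CL1B): a connected component that is the comb with upper legs `i, i, i` and lower legs
  `j, k` is `dᵢ²` times the tripod with legs `i, j, k`; `E` is the rest of the diagram. -/
  | cl1b (i j k : Fin n) (E : UniDiagram (Fin n)) :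
      DiagramRel n (((UniDiagram.comb i i i j k).union E).toFree
        - dVar i ^ 2 • ((UniDiagram.tripod i j k).union E).toFree)
  /-- (CL2B): two neighboring legs `i`, `j` on the same side of an edge between two trivalent
  vertices can be replaced by the factor `dᵢ dⱼ`. -/
  | cl2b (D : UniDiagram (Fin n)) (x : D.H) (hx : D.IsInner x) (i j : Fin n) :
      DiagramRel n ((D.addTwoLegs x i j).toFree - (dVar i * dVar j) • D.toFree)

/-- The commutative `Λ(n)`-algebra `𝒟(n)`. Since disjoint unions of diagrams in a relation with a
further diagram are again related, the ideal generated by the relations is their linear span. -/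
abbrev DiagramAlgebra (n : ℕ) : Type 1 :=
  FreeDiagramAlgebra n ⧸ Ideal.span {r : FreeDiagramAlgebra n | DiagramRel n r}

/-- The element of `𝒟(n)` represented by a diagram. -/
noncomputable def diagramElt {n : ℕ} (c : DiagramClass (Fin n)) : DiagramAlgebra n :=
  Ideal.Quotient.mk _ (MonoidAlgebra.of (LaurentRing n) (DiagramClass (Fin n)) c)

/-- The set `G(n)` of diagrams; the label `1` is the element `0` of `Fin n`. -/
def generatorSet (n : ℕ) [NeZero n] : Set (DiagramClass (Fin n)) :=
  {c | ∃ a b : Fin n, a ≤ b ∧ c = (UniDiagram.strut a b).cls} ∪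
  {c | ∃ a b : Fin n, 0 < a ∧ a < b ∧ c = (UniDiagram.tripod 0 a b).cls} ∪
  {c | ∃ a b : Fin n, 0 < a ∧ a ≤ b ∧ c = (UniDiagram.hTree 0 0 a b).cls} ∪
  {(UniDiagram.wheel 0 0).cls}

/-!
The theorem says that the generators span and that there is no relation between them. Both halves
work with a `WeightSystem`, a multiplicative function on diagrams that respects the relations. The
class of a diagram in `𝒟(n)` is the universal one, and weight systems with values in `Λ(n)` are the
same as homomorphisms of algebras `𝒟(n) → Λ(n)` (`WeightSystem.lift`).

**Generation.** By (IntV) only diagrams all of whose trivalent vertices have a leg matter. A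
component of such a diagram is a strut, a path or a cycle of trivalent vertices. If the path or the
cycle is long, it contains an edge with two neighboring legs between different vertices, and (CL2B)
makes the diagram smaller (`UniDiagram.exists_addTwoLegs`); the side on which a leg is attached
only affects the sign. What remains are trees with at most three trivalent vertices and wheels with
at most three legs (`WeightSystem.val_mem`). To bring the labels into the form of `G(n)`, note that
(CL2B), applied to an edge with two further legs, shows that up to a unit the label of a leg on an
inner edge does not matter (`UniDiagram.addLeg_mem_iff`). With (IHX) this reduces the two legs at
the end of a tree to the case in which one of them has the label `1` (`UniDiagram.fork_mem`). The
tripods are equivalent to the combs by (CL1B). The wheels with one or three legs vanish, because a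
reflection reverses an odd number of vertices; all wheels with two legs are the same up to a unit.

**Independence.** A metric Lie algebra gives a weight system by a state sum: the half-edges are
colored by a basis, a trivalent vertex has the structure constants as weight, and a leg labeled `i`
has a vector `vᵢ`. Then (AS) and (IHX) hold. The Lie algebras here are extensions of an abelian
metric Lie algebra by one derivation `κ` with `κ ^ 3 = κ` and by a central element dual to it
(`ColorSystem`). As brackets have no component at the derivation, brackets of brackets are central
and orthogonal to brackets, which gives (IntV); if the component of `vᵢ` at the derivation is `dᵢ`,
then (CL1B) and (CL2B) follow from `κ ^ 3 = κ`. The remaining components of `vᵢ` are free, and so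
they can be chosen such that the struts, the tripods and the trees with two trivalent vertices in
`G(n)` have arbitrary values (`exists_parameters`). The value of the wheel is the trace of `κ ^ 2`
times `d₁ ^ 2`, for which there are infinitely many possibilities. A polynomial in the kernel of
the homomorphism of the theorem vanishes at all these points, hence it is zero.
-/

/-! ### Weight systems -/

/-- A multiplicative weight system: a function on diagrams with values in a `Λ(n)`-algebra that
respects the defining relations of `𝒟(n)`, disjoint unions and the empty diagram. It is enough to
ask for (CL1B) without a further component, because weights are multiplicative. -/
structure WeightSystem (n : ℕ) (A : Type*) [CommRing A] [Algebra (LaurentRing n) A] where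
  val : UniDiagram (Fin n) → A
  iso : ∀ {D E : UniDiagram (Fin n)}, D.Iso E → val D = val E
  union : ∀ D E : UniDiagram (Fin n), val (D.union E) = val D * val E
  empty : val (UniDiagram.empty (Fin n)) = 1
  flip : ∀ (D : UniDiagram (Fin n)) (h : D.H) (hh : D.next h ≠ h), val (D.flip h hh) = -val D
  ihx : ∀ (D : UniDiagram (Fin n)) (x : D.H) (hx : D.IsInner x),
    val D + val (D.rot₁ x hx) + val (D.rot₂ x hx) = 0
  intV : ∀ (D : UniDiagram (Fin n)) (h : D.H), D.next h ≠ h → D.next (D.opp h) ≠ D.opp h →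
    D.next (D.opp (D.next h)) ≠ D.opp (D.next h) →
    D.next (D.opp (D.next (D.next h))) ≠ D.opp (D.next (D.next h)) → val D = 0
  comb : ∀ i j k : Fin n, val (UniDiagram.comb i i i j k) =
    dVar i ^ 2 • val (UniDiagram.tripod i j k)
  addTwoLegs : ∀ (D : UniDiagram (Fin n)) (x : D.H), D.IsInner x → ∀ i j : Fin n,
    val (D.addTwoLegs x i j) = (dVar i * dVar j) • val D

namespace DiagramAlgebra

variable {n : ℕ}

theorem diagramElt_cls (D : UniDiagram (Fin n)) :
    diagramElt D.cls = Ideal.Quotient.mk _ D.toFree := rfl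

theorem toFree_union (D E : UniDiagram (Fin n)) : (D.union E).toFree = D.toFree * E.toFree :=
  map_mul (MonoidAlgebra.of (LaurentRing n) (DiagramClass (Fin n))) D.cls E.cls

theorem toFree_empty : (UniDiagram.empty (Fin n)).toFree = 1 :=
  map_one (MonoidAlgebra.of (LaurentRing n) (DiagramClass (Fin n)))

theorem mk_eq_zero_of_rel {r : FreeDiagramAlgebra n} (h : DiagramRel n r) :
    Ideal.Quotient.mk (Ideal.span {r : FreeDiagramAlgebra n | DiagramRel n r}) r = 0 :=
  Ideal.Quotient.eq_zero_iff_mem.2 (Ideal.subset_span h)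

theorem mk_smul (c : LaurentRing n) (r : FreeDiagramAlgebra n) :
    Ideal.Quotient.mk (Ideal.span {r : FreeDiagramAlgebra n | DiagramRel n r}) (c • r) =
      c • Ideal.Quotient.mk (Ideal.span {r : FreeDiagramAlgebra n | DiagramRel n r}) r :=
  map_smul (Ideal.Quotient.mkₐ (LaurentRing n)
    (Ideal.span {r : FreeDiagramAlgebra n | DiagramRel n r})) c r

variable (n) in
/-- The weight system that sends a diagram to its class in `𝒟(n)`. -/
noncomputable def universalWeight : WeightSystem n (DiagramAlgebra n) where
  val D := diagramElt D.cls
  iso h := congrArg diagramElt (Quotient.sound h)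
  union D E := by
    rw [diagramElt_cls, diagramElt_cls, diagramElt_cls, toFree_union, map_mul]
  empty := by
    rw [diagramElt_cls, toFree_empty, map_one]
  flip D h hh := by
    have := mk_eq_zero_of_rel (DiagramRel.as D h hh)
    rw [map_add] at this
    exact (neg_eq_of_add_eq_zero_right this).symm
  ihx D x hx := by
    have := mk_eq_zero_of_rel (DiagramRel.ihx D x hx)
    rwa [map_add, map_add] at this
  intV D h hh h0 h1 h2 := mk_eq_zero_of_rel (DiagramRel.intV D h hh h0 h1 h2)
  comb i j k := by
    have := mk_eq_zero_of_rel (DiagramRel.cl1b i j k (UniDiagram.empty (Fin n)))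
    rwa [map_sub, mk_smul, sub_eq_zero, toFree_union, toFree_union, toFree_empty, mul_one,
      mul_one] at this
  addTwoLegs D x hx i j := by
    have := mk_eq_zero_of_rel (DiagramRel.cl2b D x hx i j)
    rwa [map_sub, mk_smul, sub_eq_zero] at this

theorem isUnit_dVar (i : Fin n) : IsUnit (dVar i : LaurentRing n) := by
  refine IsUnit.of_mul_eq_one (AddMonoidAlgebra.single (-Pi.single i 1) 1) ?_
  rw [dVar, AddMonoidAlgebra.single_mul_single]
  simp [AddMonoidAlgebra.one_def]

end DiagramAlgebra

/-! ### Homeomorphisms up to orientation -/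

namespace UniDiagram

section SignedIso

variable {M : Type} {n : ℕ} {A : Type*} [CommRing A] [Algebra (LaurentRing n) A]

theorem flip_next (D : UniDiagram M) (h : D.H) (hh : D.next h ≠ h) :
    (D.flip h hh).next h = D.next (D.next h) ∧
    (D.flip h hh).next (D.next h) = h ∧
    (D.flip h hh).next (D.next (D.next h)) = D.next h ∧
    ∀ k, k ≠ h → k ≠ D.next h → k ≠ D.next (D.next h) → (D.flip h hh).next k = D.next k := by
  classical
  have n1 := hh
  have n2 := D.next_ne hh
  have n3 := D.next_next_ne hh
  refine ⟨?_, ?_, ?_, fun k k1 k2 k3 => ?_⟩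
  · simp [flip, twist, twistNext, flipPerm, Equiv.swap_apply_of_ne_of_ne n1.symm n3.symm]
  · simp [flip, twist, twistNext, flipPerm, D.next_next_next,
      Equiv.swap_apply_of_ne_of_ne n1.symm n3.symm]
  · simp [flip, twist, twistNext, flipPerm]
  · have e1 : D.next k ≠ D.next h := fun e => k1 (D.next_injective e)
    have e2 : D.next k ≠ D.next (D.next h) := fun e => k2 (D.next_injective e)
    simp [flip, twist, twistNext, flipPerm, Equiv.swap_apply_of_ne_of_ne k2 k3,
      Equiv.swap_apply_of_ne_of_ne e1 e2]

/-- The diagram with one reversed vertex, up to a bijection of half-edges: this form keeps the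
half-edges of the two diagrams apart. -/
theorem exists_flip (w : WeightSystem n A) (E : UniDiagram (Fin n)) (h : E.H) (hh : E.next h ≠ h) :
    ∃ (F : UniDiagram (Fin n)) (f : E.H ≃ F.H), w.val F = -w.val E ∧
      (∀ k, f (E.opp k) = F.opp (f k)) ∧ (∀ k, E.label k = F.label (f k)) ∧
      F.next (f h) = f (E.next (E.next h)) ∧ F.next (f (E.next h)) = f h ∧
      F.next (f (E.next (E.next h))) = f (E.next h) ∧
      ∀ k, k ≠ h → k ≠ E.next h → k ≠ E.next (E.next h) → F.next (f k) = f (E.next k) :=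
  ⟨E.flip h hh, Equiv.refl _, w.flip E h hh, fun _ => rfl, fun _ => rfl, E.flip_next h hh⟩

/-- A homeomorphism of diagrams up to the orientations of vertices: `e` respects the edges and
labels, it preserves the orientation at the vertex of `h` if `ε h = 1` and reverses the orientation
if `ε h = -1`. -/
structure SignedIso (D E : UniDiagram M) (e : D.H ≃ E.H) (ε : D.H → ℤˣ) : Prop where
  opp : ∀ h, e (D.opp h) = E.opp (e h)
  label : ∀ h, D.label h = E.label (e h)
  pos : ∀ h, ε h = 1 → e (D.next h) = E.next (e h)
  neg : ∀ h, ε h = -1 → D.next h ≠ h ∧ e (D.next h) = E.next (E.next (e h))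

/-- Three half-edges belong to each reversed vertex, and `(-1) ^ 3 = -1`: hence the sign may be
computed as a product over half-edges. -/
theorem SignedIso.val_eq (w : WeightSystem n A) {D : UniDiagram (Fin n)} [Fintype D.H] :
    ∀ {E : UniDiagram (Fin n)} {e : D.H ≃ E.H} {ε : D.H → ℤˣ},
    SignedIso D E e ε → w.val D = ((∏ h, ε h : ℤˣ) : ℤ) • w.val E := by
  classical
  suffices H : ∀ m : ℕ, ∀ {E : UniDiagram (Fin n)} {e : D.H ≃ E.H} {ε : D.H → ℤˣ},
      (Finset.univ.filter (fun h => ε h = -1)).card = m →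
      SignedIso D E e ε → w.val D = ((∏ h, ε h : ℤˣ) : ℤ) • w.val E by
    intro E e ε h
    exact H _ rfl h
  intro m
  induction m using Nat.strong_induction_on with
  | _ m ih =>
  intro E e ε hm hs
  by_cases hε : ∀ h, ε h = 1
  · simp only [hε, Finset.prod_const_one, Units.val_one, one_smul]
    exact w.iso ⟨e, hs.opp, fun h => hs.pos h (hε h), hs.label⟩
  push Not at hε
  obtain ⟨h, hh⟩ := hε
  replace hh : ε h = -1 := (Int.units_eq_one_or (ε h)).resolve_left hh
  obtain ⟨t, hn⟩ := hs.neg h hh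
  have t2 := D.next_ne t
  have t3 := D.next_next_ne t
  have n3 := D.next_next_next h
  have m3 := E.next_next_next
  have hh1 : ε (D.next h) = -1 := by
    refine (Int.units_eq_one_or _).resolve_left fun c => ?_
    have := hs.pos _ c
    rw [hn, m3] at this
    exact t3 (e.injective this)
  have hn1 := (hs.neg _ hh1).2
  rw [hn, m3] at hn1
  have hh2 : ε (D.next (D.next h)) = -1 := by
    refine (Int.units_eq_one_or _).resolve_left fun c => ?_
    have := hs.pos _ c
    rw [hn1, n3] at this
    exact t (e.injective (hn.trans this.symm))
  have t' : E.next (e h) ≠ e h := by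
    intro c
    rw [c, c] at hn
    exact t (e.injective hn)
  obtain ⟨F, f, fe, fo, fl, f1, f2, f3, f4⟩ := exists_flip w E (e h) t'
  -- Induction on the number of half-edges at reversed vertices: undo the reversal at `h`.
  set ε' : D.H → ℤˣ := fun k => if k = h ∨ k = D.next h ∨ k = D.next (D.next h) then 1 else ε k
    with hε'
  have key : SignedIso D F (e.trans f) ε' := by
    have g (k : D.H) (k1 : k ≠ h) (k2 : k ≠ D.next h) (k3 : k ≠ D.next (D.next h)) :
        e k ≠ e h ∧ e k ≠ E.next (e h) ∧ e k ≠ E.next (E.next (e h)) := by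
      rw [← hn, ← hn1]
      exact ⟨e.injective.ne k1, e.injective.ne k3, e.injective.ne k2⟩
    refine ⟨fun k => ?_, fun k => ?_, fun k hk => ?_, fun k hk => ?_⟩
    · simp [hs.opp, fo]
    · simp [hs.label, fl]
    · simp only [Equiv.trans_apply]
      by_cases k1 : k = h
      · rw [k1, f1, hn]
      by_cases k2 : k = D.next h
      · rw [k2, hn, f3, hn1]
      by_cases k3 : k = D.next (D.next h)
      · rw [k3, hn1, f2, n3]
      simp only [hε', k1, k2, k3, or_self, if_false] at hk
      obtain ⟨g1, g2, g3⟩ := g k k1 k2 k3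
      rw [f4 _ g1 g2 g3, hs.pos k hk]
    · by_cases k1 : k = h
      · simp [hε', k1] at hk
      by_cases k2 : k = D.next h
      · simp [hε', k2] at hk
      by_cases k3 : k = D.next (D.next h)
      · simp [hε', k3] at hk
      simp only [hε', k1, k2, k3, or_self, if_false] at hk
      obtain ⟨g1, g2, g3⟩ := g k k1 k2 k3
      refine ⟨(hs.neg k hk).1, ?_⟩
      simp only [Equiv.trans_apply]
      rw [f4 _ g1 g2 g3, f4 _ (fun c => g3 (by rw [← c, m3])) (fun c => g1 (E.next_injective c))
        (fun c => g2 (E.next_injective c)), (hs.neg k hk).2]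
  have hlt : (Finset.univ.filter (fun h => ε' h = -1)).card < m := by
    rw [← hm]
    apply Finset.card_lt_card
    refine ⟨fun k hk => ?_, fun c => ?_⟩
    · simp only [Finset.mem_filter, Finset.mem_univ, true_and, hε'] at hk ⊢
      split_ifs at hk
      · simp at hk
      · exact hk
    · have := c (show h ∈ _ by simpa using hh)
      simp [hε'] at this
  have hprod : ∏ k, ε k = - ∏ k, ε' k := by
    have h1 : ∀ k, ε k = (if k ∈ ({h, D.next h, D.next (D.next h)} : Finset D.H) then -1 else 1) *
        ε' k := by
      intro k
      by_cases hk : k = h ∨ k = D.next h ∨ k = D.next (D.next h)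
      · have : ε k = -1 := by rcases hk with rfl | rfl | rfl <;> assumption
        simp [hε', hk, this]
      · simp [hε', hk]
    rw [Finset.prod_congr rfl fun k _ => h1 k, Finset.prod_mul_distrib, Finset.prod_ite_mem,
      Finset.univ_inter, Finset.prod_const, Finset.card_eq_three.2
        ⟨h, D.next h, D.next (D.next h), t.symm, t3.symm, t2.symm, rfl⟩]
    simp [pow_succ]
  rw [ih _ hlt rfl key, hprod, fe]
  simp

/-- Two diagrams are similar if they are homeomorphic up to the orientations of the vertices. -/
def Similar (D E : UniDiagram M) : Prop :=
  ∃ e : D.H ≃ E.H, (∀ h, e (D.opp h) = E.opp (e h)) ∧ (∀ h, D.label h = E.label (e h)) ∧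
    ∀ h, e (D.next h) = E.next (e h) ∨ e (D.next h) = E.next (E.next (e h))

theorem Similar.val_eq_or (w : WeightSystem n A) {D E : UniDiagram (Fin n)} (h : Similar D E) :
    w.val D = w.val E ∨ w.val D = -w.val E := by
  classical
  obtain ⟨e, h1, h2, h3⟩ := h
  have := D.finite_H
  have := Fintype.ofFinite D.H
  have hs : SignedIso D E e (fun h => if e (D.next h) = E.next (e h) then 1 else -1) := by
    refine ⟨h1, h2, fun h => ?_, fun h => ?_⟩
    · split_ifs with c
      · exact fun _ => c
      · intro hc
        exact absurd hc (by decide)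
    · split_ifs with c
      · intro hc
        exact absurd hc (by decide)
      · refine fun _ => ⟨fun hh => c ?_, (h3 h).resolve_left c⟩
        have h4 := (D.isSome_label_iff h).2 hh
        rw [h2, E.isSome_label_iff] at h4
        rw [hh, h4]
  have h5 := hs.val_eq w
  rcases Int.units_eq_one_or (∏ h, if e (D.next h) = E.next (e h) then (1 : ℤˣ) else -1)
    with h6 | h6
  · left
    rw [h5, h6]
    simp
  · right
    rw [h5, h6]
    simp

end SignedIso

end UniDiagram

/-! ### Diagrams with an additional leg -/

namespace UniDiagram

section AddLeg

variable {M : Type}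

section Parts

variable {D : UniDiagram M} {x : D.H} {i : M}

/-- A half-edge of `D`, as a half-edge of the diagram with an additional leg. Together with `new`,
`addLegElim` and `addLeg_ind` this describes the half-edges of `D.addLeg x i` without unfolding it.
-/
def old (h : D.H) : (D.addLeg x i).H := Sum.inl h

/-- One of the four half-edges that arise when a leg is attached. -/
def new (p : LegPart) : (D.addLeg x i).H := Sum.inr p

/-- Functions on the half-edges of a diagram with an additional leg. -/
def addLegElim {β : Type*} (f : D.H → β) (g : LegPart → β) : (D.addLeg x i).H → β := Sum.elim f g

@[simp] theorem addLegElim_old {β : Type*} (f : D.H → β) (g : LegPart → β) (h : D.H) :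
    addLegElim (x := x) (i := i) f g (old h) = f h := rfl
@[simp] theorem addLegElim_new {β : Type*} (f : D.H → β) (g : LegPart → β) (p : LegPart) :
    addLegElim (x := x) (i := i) f g (new p) = g p := rfl

theorem addLeg_ind {P : (D.addLeg x i).H → Prop} (h : ∀ h, P (old h)) (hb : P (new .back))
    (hf : P (new .fwd)) (hs : P (new .stem)) (hl : P (new .leaf)) : ∀ k, P k := by
  rintro (k | _ | _ | _ | _)
  exacts [h k, hb, hf, hs, hl]

@[simp] theorem old_inj {h k : D.H} : (old h : (D.addLeg x i).H) = old k ↔ h = k :=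
  Sum.inl_injective.eq_iff
@[simp] theorem new_inj {p q : LegPart} : (new p : (D.addLeg x i).H) = new q ↔ p = q :=
  Sum.inr_injective.eq_iff
@[simp] theorem old_ne_new {h : D.H} {p : LegPart} : (old h : (D.addLeg x i).H) ≠ new p :=
  Sum.inl_ne_inr
@[simp] theorem new_ne_old {h : D.H} {p : LegPart} : (new p : (D.addLeg x i).H) ≠ old h :=
  Sum.inr_ne_inl

@[simp] theorem opp_back : (D.addLeg x i).opp (new .back) = old x := rfl
@[simp] theorem opp_fwd : (D.addLeg x i).opp (new .fwd) = old (D.opp x) := rfl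
@[simp] theorem opp_stem : (D.addLeg x i).opp (new .stem) = new .leaf := rfl
@[simp] theorem opp_leaf : (D.addLeg x i).opp (new .leaf) = new .stem := rfl
open Classical in
theorem opp_old (h : D.H) : (D.addLeg x i).opp (old h) =
    if h = x then new .back else if h = D.opp x then new .fwd else old (D.opp h) := rfl
@[simp] theorem opp_old_self : (D.addLeg x i).opp (old x) = new .back := by
  simp [opp_old]
@[simp] theorem opp_old_opp : (D.addLeg x i).opp (old (D.opp x)) = new .fwd := by
  simp [opp_old, D.opp_ne]
theorem opp_old_of_ne {h : D.H} (h1 : h ≠ x) (h2 : h ≠ D.opp x) :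
    (D.addLeg x i).opp (old h) = old (D.opp h) := by
  simp [opp_old, h1, h2]
@[simp] theorem next_old (h : D.H) : (D.addLeg x i).next (old h) = old (D.next h) := rfl
@[simp] theorem next_back : (D.addLeg x i).next (new .back) = new .fwd := rfl
@[simp] theorem next_fwd : (D.addLeg x i).next (new .fwd) = new .stem := rfl
@[simp] theorem next_stem : (D.addLeg x i).next (new .stem) = new .back := rfl
@[simp] theorem next_leaf : (D.addLeg x i).next (new .leaf) = new .leaf := rfl
@[simp] theorem label_old (h : D.H) : (D.addLeg x i).label (old h) = D.label h := rfl
@[simp] theorem label_back : (D.addLeg x i).label (new .back) = none := rfl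
@[simp] theorem label_fwd : (D.addLeg x i).label (new .fwd) = none := rfl
@[simp] theorem label_stem : (D.addLeg x i).label (new .stem) = none := rfl
@[simp] theorem label_leaf : (D.addLeg x i).label (new .leaf) = some i := rfl

theorem addTwoLegs_eq (D : UniDiagram M) (x : D.H) (i j : M) :
    D.addTwoLegs x i j = (D.addLeg x i).addLeg (new .fwd) j := rfl

theorem card_addLeg (D : UniDiagram M) (x : D.H) (i : M) :
    Nat.card (D.addLeg x i).H = Nat.card D.H + 4 := by
  have := D.finite_H
  have h4 : Nat.card LegPart = 4 := by
    have e : LegPart ≃ Fin 4 :=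
      { toFun := fun p => match p with
          | .back => 0
          | .fwd => 1
          | .stem => 2
          | .leaf => 3
        invFun := ![.back, .fwd, .stem, .leaf]
        left_inv := by rintro (_ | _ | _ | _) <;> rfl
        right_inv := by intro k; fin_cases k <;> rfl }
    rw [Nat.card_congr e, Nat.card_fin]
  have := LegPart.finite
  rw [← h4]
  exact Nat.card_sum

end Parts

/-- `e` is a homeomorphism up to the orientations of the vertices. -/
structure SimilarVia (D E : UniDiagram M) (e : D.H ≃ E.H) : Prop where
  opp : ∀ h, e (D.opp h) = E.opp (e h)
  label : ∀ h, D.label h = E.label (e h)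
  next : ∀ h, e (D.next h) = E.next (e h) ∨ e (D.next h) = E.next (E.next (e h))

theorem SimilarVia.similar {D E : UniDiagram M} {e : D.H ≃ E.H} (h : SimilarVia D E e) :
    Similar D E := ⟨e, h.opp, h.label, h.next⟩

theorem SimilarVia.trans {D E F : UniDiagram M} {e : D.H ≃ E.H} {f : E.H ≃ F.H}
    (h : SimilarVia D E e) (k : SimilarVia E F f) : SimilarVia D F (e.trans f) where
  opp a := by simp [h.opp, k.opp]
  label a := by simp [h.label, k.label]
  next a := by
    have e3 := F.next_next_next
    simp only [Equiv.trans_apply]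
    have hu : F.next (f (e a)) = f (e a) ↔ E.next (e a) = e a := by
      rw [← E.isSome_label_iff, k.label, F.isSome_label_iff]
    have hi : f (E.next (E.next (e a))) = f (e a) → E.next (E.next (e a)) = e a :=
      fun c => f.injective c
    have e4 := E.next_next_next (e a)
    have k1 := k.next (e a)
    have k2 := k.next (E.next (e a))
    rcases h.next a with h1 | h1 <;> rw [h1] <;> grind

theorem SimilarVia.symm {D E : UniDiagram M} {e : D.H ≃ E.H} (h : SimilarVia D E e) :
    SimilarVia E D e.symm where
  opp k := by
    rw [Equiv.symm_apply_eq, h.opp, Equiv.apply_symm_apply]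
  label k := by rw [h.label, Equiv.apply_symm_apply]
  next k := by
    obtain ⟨a, rfl⟩ := e.surjective k
    simp only [Equiv.symm_apply_eq, Equiv.symm_apply_apply]
    have hu : E.next (e a) = e a ↔ D.next a = a := by
      rw [← E.isSome_label_iff, ← h.label, D.isSome_label_iff]
    have hi : e (D.next (D.next a)) = e a → D.next (D.next a) = a := fun c => e.injective c
    have e3 := E.next_next_next (e a)
    have d3 := D.next_next_next a
    have k1 := h.next a
    have k2 := h.next (D.next a)
    grind

theorem Similar.trans {D E F : UniDiagram M} (h : Similar D E) (k : Similar E F) :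
    Similar D F := by
  obtain ⟨e, h1, h2, h3⟩ := h
  obtain ⟨f, k1, k2, k3⟩ := k
  exact (SimilarVia.trans ⟨h1, h2, h3⟩ ⟨k1, k2, k3⟩).similar

theorem Similar.symm {D E : UniDiagram M} (h : Similar D E) : Similar E D := by
  obtain ⟨e, h1, h2, h3⟩ := h
  exact (SimilarVia.symm ⟨h1, h2, h3⟩).similar

theorem Similar.of_surjective {D E : UniDiagram M} (f : D.H → E.H) (hf : Function.Surjective f)
    (hc : Nat.card D.H ≤ Nat.card E.H) (h1 : ∀ h, f (D.opp h) = E.opp (f h))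
    (h2 : ∀ h, D.label h = E.label (f h))
    (h3 : ∀ h, f (D.next h) = E.next (f h) ∨ f (D.next h) = E.next (E.next (f h))) :
    Similar D E := by
  have := D.finite_H
  have hb : Function.Bijective f := hf.bijective_of_nat_card_le hc
  exact ⟨Equiv.ofBijective f hb, h1, h2, h3⟩

/-- A bijection of half-edges, extended to the half-edges of an additional leg. -/
noncomputable def addLegEquiv {D E : UniDiagram M} (e : D.H ≃ E.H) (x : D.H) (y : E.H) (i j : M) :
    (D.addLeg x i).H ≃ (E.addLeg y j).H :=
  Equiv.sumCongr e (Equiv.refl LegPart)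

@[simp] theorem addLegEquiv_old {D E : UniDiagram M} (e : D.H ≃ E.H) (x : D.H) (y : E.H) (i j : M)
    (h : D.H) : addLegEquiv e x y i j (old h) = old (e h) := rfl
@[simp] theorem addLegEquiv_new {D E : UniDiagram M} (e : D.H ≃ E.H) (x : D.H) (y : E.H) (i j : M)
    (p : LegPart) : addLegEquiv e x y i j (new p) = new p := rfl

theorem addLeg_congr {D E : UniDiagram M} {e : D.H ≃ E.H} (h : SimilarVia D E e) (x : D.H) (i : M) :
    SimilarVia (D.addLeg x i) (E.addLeg (e x) i) (addLegEquiv e x (e x) i i) where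
  opp := by
    refine addLeg_ind (fun a => ?_) ?_ ?_ ?_ ?_
    · by_cases h1 : a = x
      · simp [h1]
      by_cases h2 : a = D.opp x
      · simp [h2, h.opp]
      have k1 : e a ≠ e x := e.injective.ne h1
      have k2 : e a ≠ E.opp (e x) := by
        rw [← h.opp]
        exact e.injective.ne h2
      simp [opp_old_of_ne h1 h2, opp_old_of_ne k1 k2, h.opp]
    all_goals simp [h.opp]
  label := addLeg_ind (by simp [h.label]) (by simp) (by simp) (by simp) (by simp)
  next := addLeg_ind (by simpa using h.next) (by simp) (by simp) (by simp) (by simp)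

/-- The bijection of half-edges that exchanges the order in which two legs are attached. -/
noncomputable def addLegComm (D : UniDiagram M) (x : D.H) (i j : M) :
    ((D.addLeg x i).addLeg (new .fwd) j).H ≃ ((D.addLeg x j).addLeg (old x) i).H where
  toFun := addLegElim (addLegElim (fun h => old (old h)) new) (fun p => old (new p))
  invFun := addLegElim (addLegElim (fun h => old (old h)) new) (fun p => old (new p))
  left_inv := by
    refine addLeg_ind (addLeg_ind (fun a => ?_) ?_ ?_ ?_ ?_) ?_ ?_ ?_ ?_ <;> simp
  right_inv := by
    refine addLeg_ind (addLeg_ind (fun a => ?_) ?_ ?_ ?_ ?_) ?_ ?_ ?_ ?_ <;> simp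

section

variable (D : UniDiagram M) (x : D.H) (i j : M)

@[simp] theorem addLegComm_old_old (h : D.H) :
    D.addLegComm x i j (old (old h)) = old (old h) := rfl
@[simp] theorem addLegComm_old_new (p : LegPart) :
    D.addLegComm x i j (old (new p)) = new p := rfl
@[simp] theorem addLegComm_new (p : LegPart) :
    D.addLegComm x i j (new p) = old (new p) := rfl

/-- Two legs on an edge may be attached in either order. -/
theorem addLeg_comm :
    SimilarVia ((D.addLeg x i).addLeg (new .fwd) j) ((D.addLeg x j).addLeg (old x) i)
      (D.addLegComm x i j) where
  opp := by
    have := D.opp_ne x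
    refine addLeg_ind (addLeg_ind (fun a => ?_) ?_ ?_ ?_ ?_) ?_ ?_ ?_ ?_
    · by_cases h1 : a = x
      · simp [opp_old, h1, this.symm]
      · by_cases h2 : a = D.opp x <;> simp [opp_old, h1, h2, this]
    all_goals simp [opp_old]
  label := by
    refine addLeg_ind (addLeg_ind (fun a => ?_) ?_ ?_ ?_ ?_) ?_ ?_ ?_ ?_ <;> simp
  next := by
    refine addLeg_ind (addLeg_ind (fun a => ?_) ?_ ?_ ?_ ?_) ?_ ?_ ?_ ?_ <;> simp

end

end AddLeg

section Membership

variable {n : ℕ} {A : Type*} [CommRing A] [Algebra (LaurentRing n) A] (w : WeightSystem n A)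
  (S : Submodule (LaurentRing n) A)

theorem smul_dVar_mem_iff (i : Fin n) (a : A) : (dVar i : LaurentRing n) • a ∈ S ↔ a ∈ S :=
  S.smul_mem_iff_of_isUnit (DiagramAlgebra.isUnit_dVar i)

theorem Similar.mem_iff {D E : UniDiagram (Fin n)} (h : Similar D E) :
    w.val D ∈ S ↔ w.val E ∈ S := by
  rcases h.val_eq_or w with h | h <;> rw [h]
  exact S.neg_mem_iff

theorem addTwoLegs_mem_iff (D : UniDiagram (Fin n)) (x : D.H) (hx : D.IsInner x) (i j : Fin n) :
    w.val (D.addTwoLegs x i j) ∈ S ↔ w.val D ∈ S := by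
  rw [w.addTwoLegs D x hx, mul_smul, smul_dVar_mem_iff, smul_dVar_mem_iff]

theorem addLeg_isInner_fwd (D : UniDiagram (Fin n)) (x : D.H) (i : Fin n)
    (hx : D.next (D.opp x) ≠ D.opp x) : (D.addLeg x i).IsInner (new .fwd) := by
  simp [IsInner, hx]

theorem addLeg_isInner_old (D : UniDiagram (Fin n)) (x : D.H) (i : Fin n)
    (hx : D.next x ≠ x) : (D.addLeg x i).IsInner (old x) := by
  simp [IsInner, hx]

/-- Up to a unit, a leg on an edge between trivalent vertices does not depend on its label: with two
more legs on the edge, (CL2B) can be used to remove either of two legs. -/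
theorem addLeg_mem_iff (D : UniDiagram (Fin n)) (x : D.H) (hx : D.next x ≠ x)
    (hy : D.next (D.opp x) ≠ D.opp x) (i k : Fin n) :
    w.val (D.addLeg x i) ∈ S ↔ w.val (D.addLeg x k) ∈ S := by
  have h1 := addTwoLegs_mem_iff w S (D.addLeg x i) (new .fwd) (D.addLeg_isInner_fwd x i hy) i k
  have h2 := addTwoLegs_mem_iff w S (D.addLeg x k) (old x) (D.addLeg_isInner_old x k hx) i i
  have h3 := addLeg_comm (D.addLeg x i) (new .fwd) i k
  have h4 := addLeg_congr (addLeg_comm D x i k) (old (new .fwd)) i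
  have h5 := (h3.similar.trans h4.similar).mem_iff w S
  exact h1.symm.trans (h5.trans h2)

end Membership

end UniDiagram

/-! ### The three terms of (IHX) -/

namespace UniDiagram

section Rewire

variable {M : Type}

/-- `F` arises from `D` by replacing two vertices: it has the vertices `(x, a, b)` and `(y, c, d)`,
all the rest of the structure is transported by the bijection `f`. -/
structure Rewired (D F : UniDiagram M) (f : D.H ≃ F.H) (x a b y c d : D.H) : Prop where
  opp : ∀ k, F.opp (f k) = f (D.opp k)
  label : ∀ k, F.label (f k) = D.label k
  next_x : F.next (f x) = f a
  next_a : F.next (f a) = f b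
  next_b : F.next (f b) = f x
  next_y : F.next (f y) = f c
  next_c : F.next (f c) = f d
  next_d : F.next (f d) = f y
  next_other : ∀ k, k ∉ [x, a, b, y, c, d] → F.next (f k) = f (D.next k)

theorem twistNext_apply (D : UniDiagram M) (π : Equiv.Perm D.H) (k : D.H) :
    D.twistNext π (π k) = π (D.next k) := by
  simp [twistNext]

/-- The six half-edges at the ends of an inner edge are closed under `next`. -/
theorem next_notMem (D : UniDiagram M) (x y : D.H) {k : D.H}
    (hk : k ∉ [x, D.next x, D.next (D.next x), y, D.next y, D.next (D.next y)]) :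
    D.next k ∉ [x, D.next x, D.next (D.next x), y, D.next y, D.next (D.next y)] := by
  have h3 := D.next_next_next
  have hi := D.next_injective
  simp only [List.mem_cons, List.not_mem_nil, or_false, not_or] at hk ⊢
  refine ⟨fun c => ?_, fun c => ?_, fun c => ?_, fun c => ?_, fun c => ?_, fun c => ?_⟩ <;> grind

theorem rewired_rot₁ (D : UniDiagram M) (x : D.H) (hx : D.IsInner x) :
    Rewired D (D.rot₁ x hx) (Equiv.refl _) x (D.next (D.next x)) (D.next (D.opp x))
      (D.opp x) (D.next x) (D.next (D.next (D.opp x))) := by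
  obtain ⟨s1, s2, s3, s4⟩ := D.cyclePerm_spec hx
  have hf := hx.facts
  simp only [List.nodup_cons, List.mem_cons, List.not_mem_nil, or_false, not_or,
    List.nodup_nil, not_false_eq_true, and_true] at hf
  have sx := s4 x (by grind) (by grind) (by grind)
  have sy := s4 (D.opp x) (by grind) (by grind) (by grind)
  have sd := s4 (D.next (D.next (D.opp x))) (by grind) (by grind) (by grind)
  have t := D.twistNext_apply (D.cyclePerm x)
  have tx := t x
  have ta := t (D.next x)
  have tb := t (D.next (D.next x))
  have ty := t (D.opp x)
  have tc := t (D.next (D.opp x))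
  have td := t (D.next (D.next (D.opp x)))
  rw [D.next_next_next] at tb td
  rw [sx, s1] at tx
  rw [s1, s2] at ta
  rw [s2, sx] at tb
  rw [sy, s3] at ty
  rw [s3, sd] at tc
  rw [sd, sy] at td
  refine ⟨fun _ => rfl, fun _ => rfl, tx, ta, tb, ty, tc, td, fun k hk => ?_⟩
  have hk' := D.next_notMem x (D.opp x) (k := k) (by grind)
  have tk := t k
  rw [s4 k (by grind) (by grind) (by grind),
    s4 (D.next k) (by grind) (by grind) (by grind)] at tk
  exact tk

theorem rewired_rot₂ (D : UniDiagram M) (x : D.H) (hx : D.IsInner x) :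
    Rewired D (D.rot₂ x hx) (Equiv.refl _) x (D.next (D.opp x)) (D.next x)
      (D.opp x) (D.next (D.next x)) (D.next (D.next (D.opp x))) := by
  obtain ⟨s1, s2, s3, s4⟩ := D.cyclePerm_spec hx
  have hf := hx.facts
  simp only [List.nodup_cons, List.mem_cons, List.not_mem_nil, or_false, not_or,
    List.nodup_nil, not_false_eq_true, and_true] at hf
  have sx := s4 x (by grind) (by grind) (by grind)
  have sy := s4 (D.opp x) (by grind) (by grind) (by grind)
  have sd := s4 (D.next (D.next (D.opp x))) (by grind) (by grind) (by grind)
  have s5 : ∀ k, k ≠ D.next x → k ≠ D.next (D.next x) → k ≠ D.next (D.opp x) →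
      (D.cyclePerm x).symm k = k := fun k k1 k2 k3 => by
    rw [Equiv.symm_apply_eq, s4 k k1 k2 k3]
  rw [eq_comm, ← Equiv.symm_apply_eq] at s1 s2 s3 sx sy sd
  have t := D.twistNext_apply (D.cyclePerm x).symm
  have tx := t x
  have ta := t (D.next x)
  have tb := t (D.next (D.next x))
  have ty := t (D.opp x)
  have tc := t (D.next (D.opp x))
  have td := t (D.next (D.next (D.opp x)))
  rw [D.next_next_next] at tb td
  rw [sx, s3] at tx
  rw [s3, s1] at ta
  rw [s1, sx] at tb
  rw [sy, s2] at ty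
  rw [s2, sd] at tc
  rw [sd, sy] at td
  refine ⟨fun _ => rfl, fun _ => rfl, tx, ta, tb, ty, tc, td, fun k hk => ?_⟩
  have hk' := D.next_notMem x (D.opp x) (k := k) (by grind)
  have tk := t k
  rw [s5 k (by grind) (by grind) (by grind),
    s5 (D.next k) (by grind) (by grind) (by grind)] at tk
  exact tk

/-- Relation (IHX), with the half-edges of the three diagrams kept apart. -/
theorem exists_ihx {n : ℕ} {A : Type*} [CommRing A] [Algebra (LaurentRing n) A]
    (w : WeightSystem n A) (D : UniDiagram (Fin n)) (x : D.H) (hx : D.IsInner x) :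
    ∃ (F₁ F₂ : UniDiagram (Fin n)) (f₁ : D.H ≃ F₁.H) (f₂ : D.H ≃ F₂.H),
      w.val D + w.val F₁ + w.val F₂ = 0 ∧
      Rewired D F₁ f₁ x (D.next (D.next x)) (D.next (D.opp x))
        (D.opp x) (D.next x) (D.next (D.next (D.opp x))) ∧
      Rewired D F₂ f₂ x (D.next (D.opp x)) (D.next x)
        (D.opp x) (D.next (D.next x)) (D.next (D.next (D.opp x))) :=
  ⟨D.rot₁ x hx, D.rot₂ x hx, Equiv.refl _, Equiv.refl _, w.ihx D x hx, D.rewired_rot₁ x hx,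
    D.rewired_rot₂ x hx⟩

open Classical in
/-- Change the label of the univalent vertex `u`. -/
noncomputable def relabel (D : UniDiagram M) (u : D.H) (hu : D.next u = u) (b : M) :
    UniDiagram M where
  H := D.H
  finite_H := D.finite_H
  opp := D.opp
  next := D.next
  label := Function.update D.label u (some b)
  opp_opp := D.opp_opp
  opp_ne := D.opp_ne
  next_next_next := D.next_next_next
  isSome_label_iff h := by
    by_cases hh : h = u
    · simp [hh, hu]
    · simp [hh, D.isSome_label_iff]
  exists_univalent := D.exists_univalent

end Rewire

end UniDiagram

/-! ### Forks -/

namespace UniDiagram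

instance LegPart.instFintype : Fintype LegPart :=
  ⟨⟨[LegPart.back, LegPart.fwd, LegPart.stem, LegPart.leaf], by simp⟩,
    by rintro (_ | _ | _ | _) <;> simp⟩

section Fork

variable {M : Type} {D : UniDiagram M} {u : D.H} {hu : D.next u = u} {b : M}

/-- A half-edge of `D`, as a half-edge of the relabeled diagram. -/
def keep (h : D.H) : (D.relabel u hu b).H := h

/-- Functions on the half-edges of a relabeled diagram. -/
def relabelElim {β : Type*} (f : D.H → β) : (D.relabel u hu b).H → β := f

@[simp] theorem relabelElim_keep {β : Type*} (f : D.H → β) (h : D.H) :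
    relabelElim (hu := hu) (b := b) f (keep h) = f h := rfl

theorem relabel_ind {P : (D.relabel u hu b).H → Prop} (h : ∀ h, P (keep h)) : ∀ k, P k := h

@[simp] theorem keep_inj {h k : D.H} : (keep h : (D.relabel u hu b).H) = keep k ↔ h = k := Iff.rfl
@[simp] theorem opp_keep (h : D.H) : (D.relabel u hu b).opp (keep h) = keep (D.opp h) := rfl
@[simp] theorem next_keep (h : D.H) : (D.relabel u hu b).next (keep h) = keep (D.next h) := rfl
open Classical in
theorem label_keep (h : D.H) :
    (D.relabel u hu b).label (keep h) = if h = u then some b else D.label h := by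
  unfold keep relabel
  classical
  exact Function.update_apply D.label u (some b) h
@[simp] theorem label_keep_self : (D.relabel u hu b).label (keep u) = some b := by
  simp [label_keep]
theorem label_keep_of_ne {h : D.H} (hh : h ≠ u) :
    (D.relabel u hu b).label (keep h) = D.label h := by
  simp [label_keep, hh]

theorem prod_addLeg {R : Type*} [CommMonoid R] [Fintype D.H] {x : D.H} {i : M}
    [Fintype (D.addLeg x i).H] (f : (D.addLeg x i).H → R) :
    ∏ k, f k = (∏ h, f (old h)) *
      (f (new .back) * f (new .fwd) * f (new .stem) * f (new .leaf)) := by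
  let e : (D.addLeg x i).H ≃ D.H ⊕ LegPart := Equiv.refl _
  rw [Fintype.prod_equiv e f (fun k => f (e.symm k)) (fun _ => rfl), Fintype.prod_sum_type]
  congr 1
  have h4 (g : LegPart → R) : ∏ p, g p = g .back * g .fwd * g .stem * g .leaf := by
    rw [Finset.prod_eq_multiset_prod]
    change g .back * (g .fwd * (g .stem * (g .leaf * 1))) = _
    simp [mul_assoc]
  rw [h4]
  rfl

/-- Replace the univalent vertex `u` by a trivalent vertex with two legs labeled `a` and `b`. -/
noncomputable abbrev fork (D : UniDiagram M) (u : D.H) (hu : D.next u = u) (a b : M) :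
    UniDiagram M :=
  (D.relabel u hu b).addLeg (keep u) a

open Classical in
/-- The exchange of the two legs at the end of a diagram. -/
noncomputable def forkSwap (D : UniDiagram M) (u : D.H) (hu : D.next u = u) (a b : M) :
    ((D.relabel u hu b).addLeg (keep u) a).H → ((D.relabel u hu a).addLeg (keep u) b).H :=
  addLegElim (relabelElim fun h => if h = u then new .leaf else old (keep h)) fun
    | .back => new .stem
    | .fwd => new .fwd
    | .stem => new .back
    | .leaf => old (keep u)

theorem forkSwap_forkSwap (D : UniDiagram M) (u : D.H) (hu : D.next u = u) (a b : M) :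
    ∀ k, D.forkSwap u hu b a (D.forkSwap u hu a b k) = k := by
  refine addLeg_ind (relabel_ind fun h => ?_) ?_ ?_ ?_ ?_
  · by_cases hh : h = u <;> simp [forkSwap, hh]
  all_goals simp [forkSwap]

/-- The exchange of the two legs at the end of a diagram, as a bijection of half-edges. -/
noncomputable def forkSwapEquiv (D : UniDiagram M) (u : D.H) (hu : D.next u = u) (a b : M) :
    (D.fork u hu a b).H ≃ (D.fork u hu b a).H :=
  ⟨D.forkSwap u hu a b, D.forkSwap u hu b a, D.forkSwap_forkSwap u hu a b,
    D.forkSwap_forkSwap u hu b a⟩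

theorem forkSwap_opp (D : UniDiagram M) (u : D.H) (hu : D.next u = u) (a b : M) :
    ∀ k, D.forkSwap u hu a b ((D.fork u hu a b).opp k) =
      (D.fork u hu b a).opp (D.forkSwap u hu a b k) := by
  have hou := D.opp_ne u
  refine addLeg_ind (relabel_ind fun h => ?_) ?_ ?_ ?_ ?_ <;> unfold fork
  · by_cases h1 : h = u
    · simp [forkSwap, h1]
    by_cases h2 : h = D.opp u
    · simp [forkSwap, h2, opp_old, hou]
    have h3 : D.opp h ≠ u := fun e => h2 (by rw [← e, D.opp_opp])
    simp [forkSwap, h1, h2, h3, opp_old]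
  all_goals simp [forkSwap, hou]

theorem forkSwap_label (D : UniDiagram M) (u : D.H) (hu : D.next u = u) (a b : M) :
    ∀ k, (D.fork u hu a b).label k = (D.fork u hu b a).label (D.forkSwap u hu a b k) := by
  refine addLeg_ind (relabel_ind fun h => ?_) ?_ ?_ ?_ ?_ <;> unfold fork
  · by_cases h1 : h = u
    · simp [forkSwap, h1]
    simp [forkSwap, h1, label_keep_of_ne]
  all_goals simp [forkSwap]

theorem next_ne_of_univalent (D : UniDiagram M) {u h : D.H} (hu : D.next u = u) (hh : h ≠ u) :
    D.next h ≠ u := fun c => hh (D.next_injective (c.trans hu.symm))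

theorem forkSwap_next (D : UniDiagram M) (u : D.H) (hu : D.next u = u) (a b : M) :
    (∀ h, D.forkSwap u hu a b ((D.fork u hu a b).next (old h)) =
      (D.fork u hu b a).next (D.forkSwap u hu a b (old h))) ∧
    ∀ p, D.forkSwap u hu a b ((D.fork u hu a b).next (new p)) =
      (D.fork u hu b a).next ((D.fork u hu b a).next (D.forkSwap u hu a b (new p))) := by
  refine ⟨relabel_ind fun h => ?_, fun p => ?_⟩ <;> unfold fork
  · by_cases h1 : h = u
    · simp [forkSwap, h1, hu]
    simp [forkSwap, h1, next_ne_of_univalent D hu h1]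
  · cases p <;> simp [forkSwap, hu]

/-- The exchange of the two legs of a fork reverses only the vertex of the fork. -/
theorem fork_comm (D : UniDiagram M) (u : D.H) (hu : D.next u = u) (a b : M) :
    Similar (D.fork u hu a b) (D.fork u hu b a) := by
  obtain ⟨h1, h2⟩ := D.forkSwap_next u hu a b
  refine ⟨D.forkSwapEquiv u hu a b, D.forkSwap_opp u hu a b, D.forkSwap_label u hu a b, ?_⟩
  exact addLeg_ind (fun h => Or.inl (h1 h)) (Or.inr (h2 .back)) (Or.inr (h2 .fwd))
    (Or.inr (h2 .stem)) (Or.inr (h2 .leaf))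

end Fork

section

variable {n : ℕ} {A : Type*} [CommRing A] [Algebra (LaurentRing n) A] (w : WeightSystem n A)

/-- A diagram that is mapped to itself with an odd number of reversed vertices is zero. -/
theorem SignedIso.val_eq_zero {D : UniDiagram (Fin n)} [Fintype D.H] {e : D.H ≃ D.H}
    {ε : D.H → ℤˣ} (h : SignedIso D D e ε) (hε : ∏ h, ε h = -1) : w.val D = 0 := by
  have h1 := h.val_eq w
  rw [hε] at h1
  have h2 : (2 : LaurentRing n) • w.val D = 0 := by
    rw [two_smul]
    nth_rewrite 1 [h1]
    simp
  have h3 : IsUnit (2 : LaurentRing n) := by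
    have := (isUnit_iff_ne_zero.2 (two_ne_zero (α := ℚ))).map (algebraMap ℚ (LaurentRing n))
    rwa [map_ofNat] at this
  exact (h3.smul_eq_zero).1 h2

theorem val_fork_self (D : UniDiagram (Fin n)) (u : D.H) (hu : D.next u = u) (a : Fin n) :
    w.val (D.fork u hu a a) = 0 := by
  have := D.finite_H
  have := (D.fork u hu a a).finite_H
  have : Fintype (D.relabel u hu a).H := @Fintype.ofFinite _ D.finite_H
  have : Fintype ((D.relabel u hu a).addLeg (keep u) a).H := Fintype.ofFinite (D.fork u hu a a).H
  obtain ⟨h1, h2⟩ := D.forkSwap_next u hu a a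
  have h3 : D.forkSwap u hu a a ((D.fork u hu a a).next (new .leaf)) =
      (D.fork u hu a a).next (D.forkSwap u hu a a (new .leaf)) := by
    simp [forkSwap, fork, hu]
  refine SignedIso.val_eq_zero w (D := (D.relabel u hu a).addLeg (keep u) a)
    (e := D.forkSwapEquiv u hu a a)
    (ε := addLegElim (fun _ => 1) (fun p => match p with | .leaf => 1 | _ => -1))
    ⟨D.forkSwap_opp u hu a a, D.forkSwap_label u hu a a, ?_, ?_⟩ ?_
  · refine addLeg_ind (fun h _ => h1 h) ?_ ?_ ?_ fun _ => h3
    all_goals simp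
  · refine addLeg_ind (fun h => ?_) ?_ ?_ ?_ ?_
    · simp
    · exact fun _ => ⟨by simp, h2 .back⟩
    · exact fun _ => ⟨by simp, h2 .fwd⟩
    · exact fun _ => ⟨by simp, h2 .stem⟩
    · simp
  · rw [prod_addLeg]
    simp

end

end UniDiagram

/-! ### The Jacobi identity for forks -/

namespace UniDiagram

section ForkRelation

variable {n : ℕ} {A : Type*} [CommRing A] [Algebra (LaurentRing n) A] (w : WeightSystem n A)
  (S : Submodule (LaurentRing n) A) (D : UniDiagram (Fin n)) (u : D.H) (hu : D.next u = u)

theorem fork_isInner (hv : D.next (D.opp u) ≠ D.opp u) (a b : Fin n) :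
    (D.fork u hu a b).IsInner (new .fwd) := by
  unfold fork
  simp [IsInner, hv]

theorem fork_addLeg_isInner (a b m : Fin n) :
    ((D.fork u hu a b).addLeg (new .fwd) m).IsInner (old (new .fwd)) := by
  unfold fork
  simp [IsInner]

open Classical in
/-- (IHX) is applied to the edge between a fork and a neighboring leg. The second term is the fork
in which `m` and `b` have changed places. -/
theorem similar_rot₁_fork (a b m : Fin n) (F : UniDiagram (Fin n))
    (f : ((D.fork u hu a b).addLeg (new .fwd) m).H ≃ F.H)
    (hF : Rewired _ F f (old (new .fwd)) (old (new .back)) (new .fwd)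
      (new .back) (old (new .stem)) (new .stem)) :
    Similar ((D.fork u hu a m).addLeg (new .fwd) b) F := by
  unfold fork at *
  have hou := D.opp_ne u
  refine Similar.of_surjective (fun k => f (addLegElim (addLegElim (relabelElim
    fun h => if h = u then new .leaf else old (old (keep h))) (fun
      | .back => new .stem
      | .fwd => new .back
      | .stem => old (new .stem)
      | .leaf => old (new .leaf))) (fun
      | .back => old (new .fwd)
      | .fwd => new .fwd
      | .stem => old (new .back)
      | .leaf => old (old (keep u))) k)) ?_ ?_ ?_ ?_ ?_
  · intro k
    obtain ⟨k, rfl⟩ := f.surjective k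
    suffices H : ∃ k', _ from H.imp fun _ h => congrArg f h
    revert k
    refine addLeg_ind (addLeg_ind (relabel_ind fun h => ?_) ?_ ?_ ?_ ?_) ?_ ?_ ?_ ?_
    · by_cases h1 : h = u
      · exact ⟨new .leaf, by simp [h1]⟩
      · exact ⟨old (old (keep h)), by simp [h1]⟩
    · exact ⟨new .stem, by simp⟩
    · exact ⟨new .back, by simp⟩
    · exact ⟨old (new .stem), by simp⟩
    · exact ⟨old (new .leaf), by simp⟩
    · exact ⟨old (new .fwd), by simp⟩
    · exact ⟨new .fwd, by simp⟩
    · exact ⟨old (new .back), by simp⟩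
    · exact ⟨old (old (keep u)), by simp⟩
  · rw [← Nat.card_congr f]
    exact le_rfl
  · refine addLeg_ind (addLeg_ind (relabel_ind fun h => ?_) ?_ ?_ ?_ ?_) ?_ ?_ ?_ ?_
    · rw [hF.opp]
      by_cases h1 : h = u
      · simp [h1, opp_old, hou.symm]
      by_cases h2 : h = D.opp u
      · simp [h2, opp_old, hou]
      have h3 : D.opp h ≠ u := fun e => h2 (by rw [← e, D.opp_opp])
      simp [h1, h2, h3, opp_old]
    all_goals
      rw [hF.opp]
      simp [opp_old, hou, hou.symm]
  · refine addLeg_ind (addLeg_ind (relabel_ind fun h => ?_) ?_ ?_ ?_ ?_) ?_ ?_ ?_ ?_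
    · rw [hF.label]
      by_cases h1 : h = u
      · simp [h1]
      simp [h1, label_keep_of_ne]
    all_goals
      rw [hF.label]
      simp
  · have eu := hF.next_other (old (old (keep u))) (by simp)
    have e1 := hF.next_other (old (new .leaf)) (by simp)
    have e2 := hF.next_other (new .leaf) (by simp)
    refine addLeg_ind (addLeg_ind (relabel_ind fun h => ?_) ?_ ?_ ?_ ?_) ?_ ?_ ?_ ?_
    · by_cases h1 : h = u
      · simp [h1, hu, e2]
      · have := hF.next_other (old (old (keep h))) (by simp)
        simp [h1, next_ne_of_univalent D hu h1, this]
    all_goals simp [hF.next_x, hF.next_a, hF.next_b, hF.next_y, hF.next_c, hF.next_d, eu, e1, hu]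

open Classical in
/-- The third term of (IHX) at the edge between a fork and a neighboring leg. -/
theorem similar_rot₂_fork (a b m : Fin n) (F : UniDiagram (Fin n))
    (f : ((D.fork u hu a b).addLeg (new .fwd) m).H ≃ F.H)
    (hF : Rewired _ F f (old (new .fwd)) (new .fwd) (old (new .stem))
      (new .back) (old (new .back)) (new .stem)) :
    Similar ((D.fork u hu b m).addLeg (new .fwd) a) F := by
  unfold fork at *
  have hou := D.opp_ne u
  refine Similar.of_surjective (fun k => f (addLegElim (addLegElim (relabelElim
    fun h => if h = u then new .leaf else old (old (keep h))) (fun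
      | .back => new .stem
      | .fwd => new .back
      | .stem => old (new .back)
      | .leaf => old (old (keep u)))) (fun
      | .back => old (new .fwd)
      | .fwd => new .fwd
      | .stem => old (new .stem)
      | .leaf => old (new .leaf)) k)) ?_ ?_ ?_ ?_ ?_
  · intro k
    obtain ⟨k, rfl⟩ := f.surjective k
    suffices H : ∃ k', _ from H.imp fun _ h => congrArg f h
    revert k
    refine addLeg_ind (addLeg_ind (relabel_ind fun h => ?_) ?_ ?_ ?_ ?_) ?_ ?_ ?_ ?_
    · by_cases h1 : h = u
      · exact ⟨old (new .leaf), by simp [h1]⟩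
      · exact ⟨old (old (keep h)), by simp [h1]⟩
    · exact ⟨old (new .stem), by simp⟩
    · exact ⟨new .back, by simp⟩
    · exact ⟨new .stem, by simp⟩
    · exact ⟨new .leaf, by simp⟩
    · exact ⟨old (new .fwd), by simp⟩
    · exact ⟨new .fwd, by simp⟩
    · exact ⟨old (new .back), by simp⟩
    · exact ⟨old (old (keep u)), by simp⟩
  · rw [← Nat.card_congr f]
    exact le_rfl
  · refine addLeg_ind (addLeg_ind (relabel_ind fun h => ?_) ?_ ?_ ?_ ?_) ?_ ?_ ?_ ?_
    · rw [hF.opp]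
      by_cases h1 : h = u
      · simp [h1, opp_old, hou.symm]
      by_cases h2 : h = D.opp u
      · simp [h2, opp_old, hou]
      have h3 : D.opp h ≠ u := fun e => h2 (by rw [← e, D.opp_opp])
      simp [h1, h2, h3, opp_old]
    all_goals
      rw [hF.opp]
      simp [opp_old, hou, hou.symm]
  · refine addLeg_ind (addLeg_ind (relabel_ind fun h => ?_) ?_ ?_ ?_ ?_) ?_ ?_ ?_ ?_
    · rw [hF.label]
      by_cases h1 : h = u
      · simp [h1]
      simp [h1, label_keep_of_ne]
    all_goals
      rw [hF.label]
      simp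
  · have eu := hF.next_other (old (old (keep u))) (by simp)
    have e1 := hF.next_other (old (new .leaf)) (by simp)
    have e2 := hF.next_other (new .leaf) (by simp)
    refine addLeg_ind (addLeg_ind (relabel_ind fun h => ?_) ?_ ?_ ?_ ?_) ?_ ?_ ?_ ?_
    · by_cases h1 : h = u
      · simp [h1, hu, e2]
      · have := hF.next_other (old (old (keep h))) (by simp)
        simp [h1, next_ne_of_univalent D hu h1, this]
    all_goals simp [hF.next_x, hF.next_a, hF.next_b, hF.next_y, hF.next_c, hF.next_d, eu, e1, hu]

theorem fork_addLeg_mem_of_ihx (a b m : Fin n)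
    (h1 : w.val ((D.fork u hu a m).addLeg (new .fwd) b) ∈ S)
    (h2 : w.val ((D.fork u hu b m).addLeg (new .fwd) a) ∈ S) :
    w.val ((D.fork u hu a b).addLeg (new .fwd) m) ∈ S := by
  obtain ⟨F₁, F₂, f₁, f₂, h, r₁, r₂⟩ := exists_ihx w ((D.fork u hu a b).addLeg (new .fwd) m)
    (old (new .fwd)) (D.fork_addLeg_isInner u hu a b m)
  simp only [next_fwd, next_stem, opp_old_self, next_old, next_back] at r₁ r₂
  have k1 := ((D.similar_rot₁_fork u hu a b m F₁ f₁ r₁).mem_iff w S).1 h1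
  have k2 := ((D.similar_rot₂_fork u hu a b m F₂ f₂ r₂).mem_iff w S).1 h2
  rw [add_assoc] at h
  rw [eq_neg_of_add_eq_zero_left h]
  exact S.neg_mem (S.add_mem k1 k2)

variable (o : Fin n)

/-- Since the label of the leg next to the fork does not matter, each of the other two terms of
(IHX) may be taken to have the label `o` in the fork and at the neighboring leg. -/
theorem fork_addLeg_mem (hv : D.next (D.opp u) ≠ D.opp u)
    (h : ∀ c, w.val ((D.fork u hu c o).addLeg (new .fwd) o) ∈ S) (a b m : Fin n) :
    w.val ((D.fork u hu a b).addLeg (new .fwd) m) ∈ S := by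
  rw [addLeg_mem_iff w S _ _ (D.fork_isInner u hu hv a b).1 (D.fork_isInner u hu hv a b).2.1 m o]
  refine fork_addLeg_mem_of_ihx w S D u hu a b o ?_ ?_
  · rw [addLeg_mem_iff w S _ _ (D.fork_isInner u hu hv a o).1 (D.fork_isInner u hu hv a o).2.1 b o]
    exact h a
  · rw [addLeg_mem_iff w S _ _ (D.fork_isInner u hu hv b o).1 (D.fork_isInner u hu hv b o).2.1
      a o]
    exact h b

theorem relabel_addLeg (x : D.H) (b m : Fin n) :
    SimilarVia ((D.relabel u hu b).addLeg (keep x) m)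
      ((D.addLeg x m).relabel (old u) (by simp [hu]) b) (Equiv.refl (D.H ⊕ LegPart)) := by
  have hn (p : LegPart) := label_keep_of_ne (D := D.addLeg x m) (u := old u) (hu := by simp [hu])
    (b := b) (h := new p) new_ne_old
  refine ⟨addLeg_ind (fun _ => rfl) rfl rfl rfl rfl, ?_, addLeg_ind (fun _ => Or.inl rfl)
    (Or.inl rfl) (Or.inl rfl) (Or.inl rfl) (Or.inl rfl)⟩
  refine addLeg_ind (relabel_ind fun h => ?_) ?_ ?_ ?_ ?_
  · by_cases h1 : h = u
    · rw [h1]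
      exact (label_keep_self).trans (label_keep_self (D := D.addLeg x m)).symm
    · exact (label_keep_of_ne h1).trans
        (label_keep_of_ne (D := D.addLeg x m) (h := old h) (by simpa using h1)).symm
  · exact (hn .back).symm
  · exact (hn .fwd).symm
  · exact (hn .stem).symm
  · exact (hn .leaf).symm

/-- A leg next to a fork may be attached before the fork is formed. -/
theorem fork_addLeg (a b m : Fin n) :
    Similar ((D.fork u hu a b).addLeg (new .fwd) m)
      ((D.addLeg u m).fork (old u) (by simp [hu]) a b) :=
  (addLeg_comm (D.relabel u hu b) (keep u) a m).similar.trans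
    (addLeg_congr (relabel_addLeg D u hu u b m) (old (keep u)) a).similar

theorem fork_addLeg_addLeg (a b m c : Fin n) :
    Similar (((D.fork u hu a b).addLeg (new .fwd) m).addLeg (old (new .fwd)) c)
      (((D.addLeg u m).fork (old u) (by simp [hu]) a b).addLeg (new .fwd) c) :=
  (addLeg_congr (addLeg_comm (D.relabel u hu b) (keep u) a m) (old (new .fwd)) c).similar.trans
    (addLeg_congr (addLeg_congr (relabel_addLeg D u hu u b m) (old (keep u)) a)
      (new .fwd) c).similar

/-- Forks are combinations of forks with one leg labeled `o`. By (CL2B), two legs labeled `o` may be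
attached next to the fork; one of them is used in (IHX). -/
theorem fork_mem (hv : D.next (D.opp u) ≠ D.opp u) (h : ∀ c, w.val (D.fork u hu c o) ∈ S)
    (a b : Fin n) : w.val (D.fork u hu a b) ∈ S := by
  have key (a b : Fin n) : w.val (D.fork u hu a b) ∈ S ↔
      w.val (((D.addLeg u o).fork (old u) (by simp [hu]) a b).addLeg (new .fwd) o) ∈ S := by
    rw [← addTwoLegs_mem_iff w S _ _ (D.fork_isInner u hu hv a b) o o, addTwoLegs_eq]
    exact ((addLeg_comm _ _ _ _).similar.trans (D.fork_addLeg_addLeg u hu a b o o)).mem_iff w S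
  rw [key]
  exact fork_addLeg_mem w S _ _ _ o (by simp) (fun c => (key c o).1 (h c)) a b o

end ForkRelation

end UniDiagram

/-! ### Small diagrams -/

namespace UniDiagram

section Models

variable {M : Type}

section

variable {a b : M}

/-- The end of a strut that carries the first label. -/
def strutL : (strut a b).H := false

/-- The end of a strut that carries the second label. -/
def strutR : (strut a b).H := true

/-- Functions on the half-edges of a strut. -/
def strutElim {β : Type*} (x y : β) : (strut a b).H → β := fun h => Bool.rec x y h

@[simp] theorem strutElim_L {β : Type*} (x y : β) :
    strutElim (a := a) (b := b) x y strutL = x := rfl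
@[simp] theorem strutElim_R {β : Type*} (x y : β) :
    strutElim (a := a) (b := b) x y strutR = y := rfl

theorem strut_ind {P : (strut a b).H → Prop} (hl : P strutL) (hr : P strutR) : ∀ k, P k := by
  rintro (_ | _)
  exacts [hl, hr]

@[simp] theorem strutL_ne : (strutL : (strut a b).H) ≠ strutR := Bool.false_ne_true
@[simp] theorem strutR_ne : (strutR : (strut a b).H) ≠ strutL := Bool.false_ne_true.symm
@[simp] theorem opp_strutL : (strut a b).opp strutL = strutR := rfl
@[simp] theorem opp_strutR : (strut a b).opp strutR = strutL := rfl
@[simp] theorem next_strutL : (strut a b).next strutL = strutL := rfl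
@[simp] theorem next_strutR : (strut a b).next strutR = strutR := rfl
@[simp] theorem label_strutL : (strut a b).label strutL = some a := rfl
@[simp] theorem label_strutR : (strut a b).label strutR = some b := rfl

/-- A half-edge of a lollipop. -/
def loop (p : LegPart) : (lollipop a).H := p

/-- Functions on the half-edges of a lollipop. -/
def loopElim {β : Type*} (f : LegPart → β) : (lollipop a).H → β := f

@[simp] theorem loopElim_loop {β : Type*} (f : LegPart → β) (p : LegPart) :
    loopElim (a := a) f (loop p) = f p := rfl

theorem loop_ind {P : (lollipop a).H → Prop} (hb : P (loop .back)) (hf : P (loop .fwd))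
    (hs : P (loop .stem)) (hl : P (loop .leaf)) : ∀ k, P k := by
  rintro (_ | _ | _ | _)
  exacts [hb, hf, hs, hl]

@[simp] theorem loop_inj {p q : LegPart} : (loop p : (lollipop a).H) = loop q ↔ p = q := Iff.rfl
@[simp] theorem opp_loop_back : (lollipop a).opp (loop .back) = loop .fwd := rfl
@[simp] theorem opp_loop_fwd : (lollipop a).opp (loop .fwd) = loop .back := rfl
@[simp] theorem opp_loop_stem : (lollipop a).opp (loop .stem) = loop .leaf := rfl
@[simp] theorem opp_loop_leaf : (lollipop a).opp (loop .leaf) = loop .stem := rfl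
@[simp] theorem next_loop_back : (lollipop a).next (loop .back) = loop .fwd := rfl
@[simp] theorem next_loop_fwd : (lollipop a).next (loop .fwd) = loop .stem := rfl
@[simp] theorem next_loop_stem : (lollipop a).next (loop .stem) = loop .back := rfl
@[simp] theorem next_loop_leaf : (lollipop a).next (loop .leaf) = loop .leaf := rfl
@[simp] theorem label_loop_back : (lollipop a).label (loop .back) = none := rfl
@[simp] theorem label_loop_fwd : (lollipop a).label (loop .fwd) = none := rfl
@[simp] theorem label_loop_stem : (lollipop a).label (loop .stem) = none := rfl
@[simp] theorem label_loop_leaf : (lollipop a).label (loop .leaf) = some a := rfl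

end

theorem tripod_eq (i j k : M) : tripod i j k = (strut j k).addLeg strutL i := rfl
theorem hTree_eq (i j k l : M) :
    hTree i j k l = ((strut k l).addLeg strutL i).addLeg (new .fwd) j := rfl
theorem comb_eq (i m j k l : M) : comb i m j k l =
    (((strut k l).addLeg strutL i).addLeg (new .fwd) m).addLeg (new .fwd) j := rfl
theorem wheel_eq (i j : M) : wheel i j = (lollipop i).addLeg (loop .fwd) j := rfl

/-- The wheel with three outward legs. -/
noncomputable def wheel₃ (i j k : M) : UniDiagram M := (wheel i j).addLeg (new .fwd) k

theorem wheel₃_eq (i j k : M) :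
    wheel₃ i j k = ((lollipop i).addLeg (loop .fwd) j).addLeg (new .fwd) k := rfl

theorem strut_comm (a b : M) : Similar (strut a b) (strut b a) := by
  refine Similar.of_surjective (strutElim strutR strutL) ?_ le_rfl ?_ ?_ ?_
  · exact strut_ind ⟨strutR, rfl⟩ ⟨strutL, rfl⟩
  all_goals exact strut_ind (by simp) (by simp)

theorem tripod_reflect (i j k : M) : Similar (tripod i j k) (tripod i k j) := by
  rw [tripod_eq, tripod_eq]
  refine Similar.of_surjective (addLegElim (strutElim (old strutR) (old strutL)) (fun
    | .back => new .fwd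
    | .fwd => new .back
    | .stem => new .stem
    | .leaf => new .leaf)) ?_ (by simp only [card_addLeg]; rfl) ?_ ?_ ?_
  · exact addLeg_ind (strut_ind ⟨old strutR, rfl⟩ ⟨old strutL, rfl⟩) ⟨new .fwd, rfl⟩
      ⟨new .back, rfl⟩ ⟨new .stem, rfl⟩ ⟨new .leaf, rfl⟩
  all_goals
    refine addLeg_ind (strut_ind ?_ ?_) ?_ ?_ ?_ ?_ <;> simp [opp_old]

theorem hTree_reflect (i j k l : M) : Similar (hTree i j k l) (hTree j i l k) := by
  rw [hTree_eq, hTree_eq]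
  refine Similar.of_surjective (addLegElim (addLegElim
    (strutElim (old (old strutR)) (old (old strutL))) (fun
    | .back => new .fwd
    | .fwd => new .back
    | .stem => new .stem
    | .leaf => new .leaf)) (fun
    | .back => old (new .fwd)
    | .fwd => old (new .back)
    | .stem => old (new .stem)
    | .leaf => old (new .leaf))) ?_ (by simp only [card_addLeg]; rfl) ?_ ?_ ?_
  · exact addLeg_ind (addLeg_ind (strut_ind ⟨old (old strutR), rfl⟩ ⟨old (old strutL), rfl⟩)
      ⟨new .fwd, rfl⟩ ⟨new .back, rfl⟩ ⟨new .stem, rfl⟩ ⟨new .leaf, rfl⟩)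
      ⟨old (new .fwd), rfl⟩ ⟨old (new .back), rfl⟩ ⟨old (new .stem), rfl⟩ ⟨old (new .leaf), rfl⟩
  all_goals
    refine addLeg_ind (addLeg_ind (strut_ind ?_ ?_) ?_ ?_ ?_ ?_) ?_ ?_ ?_ ?_ <;> simp [opp_old]

theorem comb_reflect (i m j k l : M) : Similar (comb i m j k l) (comb j m i l k) := by
  rw [comb_eq, comb_eq]
  refine Similar.of_surjective (addLegElim (addLegElim (addLegElim
    (strutElim (old (old (old strutR))) (old (old (old strutL)))) (fun
    | .back => new .fwd
    | .fwd => new .back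
    | .stem => new .stem
    | .leaf => new .leaf)) (fun
    | .back => old (new .fwd)
    | .fwd => old (new .back)
    | .stem => old (new .stem)
    | .leaf => old (new .leaf))) (fun
    | .back => old (old (new .fwd))
    | .fwd => old (old (new .back))
    | .stem => old (old (new .stem))
    | .leaf => old (old (new .leaf)))) ?_ (by simp only [card_addLeg]; rfl) ?_ ?_ ?_
  · exact addLeg_ind (addLeg_ind (addLeg_ind
      (strut_ind ⟨old (old (old strutR)), rfl⟩ ⟨old (old (old strutL)), rfl⟩)
      ⟨new .fwd, rfl⟩ ⟨new .back, rfl⟩ ⟨new .stem, rfl⟩ ⟨new .leaf, rfl⟩)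
      ⟨old (new .fwd), rfl⟩ ⟨old (new .back), rfl⟩ ⟨old (new .stem), rfl⟩ ⟨old (new .leaf), rfl⟩)
      ⟨old (old (new .fwd)), rfl⟩ ⟨old (old (new .back)), rfl⟩ ⟨old (old (new .stem)), rfl⟩
      ⟨old (old (new .leaf)), rfl⟩
  all_goals
    refine addLeg_ind (addLeg_ind (addLeg_ind (strut_ind ?_ ?_) ?_ ?_ ?_ ?_) ?_ ?_ ?_ ?_)
      ?_ ?_ ?_ ?_ <;> simp [opp_old]

theorem wheel_comm (i j : M) : Similar (wheel i j) (wheel j i) := by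
  rw [wheel_eq, wheel_eq]
  refine Similar.of_surjective (addLegElim (loopElim new) (fun p => old (loop p))) ?_
    (by simp only [card_addLeg]; rfl) ?_ ?_ ?_
  · exact addLeg_ind (loop_ind ⟨new .back, rfl⟩ ⟨new .fwd, rfl⟩ ⟨new .stem, rfl⟩ ⟨new .leaf, rfl⟩)
      ⟨old (loop .back), rfl⟩ ⟨old (loop .fwd), rfl⟩ ⟨old (loop .stem), rfl⟩
      ⟨old (loop .leaf), rfl⟩
  all_goals
    refine addLeg_ind (loop_ind ?_ ?_ ?_ ?_) ?_ ?_ ?_ ?_ <;> simp [opp_old]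

end Models

end UniDiagram

/-! ### Weights of small diagrams -/

namespace UniDiagram

section Vanishing

variable {n : ℕ} {A : Type*} [CommRing A] [Algebra (LaurentRing n) A] (w : WeightSystem n A)
  (S : Submodule (LaurentRing n) A)

/-- The reflection of a lollipop reverses its only trivalent vertex. -/
theorem val_lollipop (i : Fin n) : w.val (lollipop i) = 0 := by
  let f : (lollipop i).H → (lollipop i).H := loopElim fun
    | .back => loop .fwd
    | .fwd => loop .back
    | .stem => loop .stem
    | .leaf => loop .leaf
  have hf : Function.Involutive f := loop_ind rfl rfl rfl rfl
  let : Fintype (lollipop i).H := LegPart.instFintype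
  refine SignedIso.val_eq_zero w (D := lollipop i) (e := hf.toPerm)
    (ε := loopElim fun p => match p with | .leaf => 1 | _ => -1) ⟨?_, ?_, ?_, ?_⟩ ?_
  · exact loop_ind rfl rfl rfl rfl
  · exact loop_ind rfl rfl rfl rfl
  · refine loop_ind ?_ ?_ ?_ fun _ => rfl <;> simp
  · refine loop_ind ?_ ?_ ?_ ?_
    · exact fun _ => ⟨by simp, rfl⟩
    · exact fun _ => ⟨by simp, rfl⟩
    · exact fun _ => ⟨by simp, rfl⟩
    · simp
  · rfl

/-- The reflection of a wheel with legs `i`, `j`, `i` reverses its three trivalent vertices. -/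
theorem val_wheel₃_self (i j : Fin n) : w.val (wheel₃ i j i) = 0 := by
  rw [wheel₃_eq]
  let f : (((lollipop i).addLeg (loop .fwd) j).addLeg (new .fwd) i).H →
      (((lollipop i).addLeg (loop .fwd) j).addLeg (new .fwd) i).H :=
    addLegElim (addLegElim (loopElim fun
      | .back => new .fwd
      | .fwd => new .back
      | .stem => new .stem
      | .leaf => new .leaf) fun
      | .back => old (new .fwd)
      | .fwd => old (new .back)
      | .stem => old (new .stem)
      | .leaf => old (new .leaf)) fun
      | .back => old (old (loop .fwd))
      | .fwd => old (old (loop .back))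
      | .stem => old (old (loop .stem))
      | .leaf => old (old (loop .leaf))
  have hf : Function.Involutive f := by
    refine addLeg_ind (addLeg_ind (loop_ind ?_ ?_ ?_ ?_) ?_ ?_ ?_ ?_) ?_ ?_ ?_ ?_ <;> rfl
  let s : LegPart → ℤˣ := fun p => match p with | .leaf => 1 | _ => -1
  let h0 : Fintype (lollipop i).H := LegPart.instFintype
  have : Finite ((lollipop i).addLeg (loop .fwd) j).H := UniDiagram.finite_H _
  have : Fintype ((lollipop i).addLeg (loop .fwd) j).H := Fintype.ofFinite _
  have : Finite (((lollipop i).addLeg (loop .fwd) j).addLeg (new .fwd) i).H :=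
    UniDiagram.finite_H _
  have : Fintype (((lollipop i).addLeg (loop .fwd) j).addLeg (new .fwd) i).H := Fintype.ofFinite _
  have key : ∀ h, (((lollipop i).addLeg (loop .fwd) j).addLeg (new .fwd) i).next h ≠ h →
      f ((((lollipop i).addLeg (loop .fwd) j).addLeg (new .fwd) i).next h) =
      (((lollipop i).addLeg (loop .fwd) j).addLeg (new .fwd) i).next
        ((((lollipop i).addLeg (loop .fwd) j).addLeg (new .fwd) i).next (f h)) := by
    refine addLeg_ind (addLeg_ind (loop_ind ?_ ?_ ?_ ?_) ?_ ?_ ?_ ?_) ?_ ?_ ?_ ?_ <;> simp [f]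
  refine SignedIso.val_eq_zero w (e := hf.toPerm)
    (ε := addLegElim (addLegElim (loopElim s) s) s) ⟨?_, ?_, ?_, ?_⟩ ?_
  · refine addLeg_ind (addLeg_ind (loop_ind ?_ ?_ ?_ ?_) ?_ ?_ ?_ ?_) ?_ ?_ ?_ ?_ <;>
      simp [f, opp_old]
  · refine addLeg_ind (addLeg_ind (loop_ind ?_ ?_ ?_ ?_) ?_ ?_ ?_ ?_) ?_ ?_ ?_ ?_ <;> simp [f]
  · refine addLeg_ind (addLeg_ind (loop_ind ?_ ?_ ?_ ?_) ?_ ?_ ?_ ?_) ?_ ?_ ?_ ?_ <;> simp [f, s]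
  · have k (h) (hh : (((lollipop i).addLeg (loop .fwd) j).addLeg (new .fwd) i).next h ≠ h) :=
      And.intro hh (key h hh)
    refine addLeg_ind (addLeg_ind (loop_ind ?_ ?_ ?_ ?_) ?_ ?_ ?_ ?_) ?_ ?_ ?_ ?_
    all_goals first
      | (intro hc; simp [s] at hc; done)
      | (intro _; refine k _ ?_; simp)
  · rw [prod_addLeg, prod_addLeg]
    have h4 : ∏ h, loopElim (a := i) s h = -1 := rfl
    simp only [addLegElim_old, addLegElim_new, h4]
    simp [s]

/-- The label of the third leg does not matter, it may be taken equal to the first. -/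
theorem val_wheel₃ (i j k : Fin n) : w.val (wheel₃ i j k) = 0 := by
  have h :=
    addLeg_mem_iff w ⊥ ((lollipop i).addLeg (loop .fwd) j) (new .fwd) (by simp) (by simp) k i
  exact (Submodule.mem_bot _).1 (h.2 ((Submodule.mem_bot _).2 (val_wheel₃_self w i j)))

theorem relabel_strut (a b c : Fin n) :
    SimilarVia ((strut a c).relabel strutL rfl b) (strut b c) (Equiv.refl Bool) := by
  refine ⟨fun _ => rfl, relabel_ind (strut_ind ?_ ?_), fun _ => Or.inl rfl⟩
  · exact label_keep_self
  · exact label_keep_of_ne strutR_ne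

variable {S}

theorem mem_of_eq_zero {a : A} (h : a = 0) : a ∈ S := by
  rw [h]
  exact S.zero_mem

theorem strut_mem (h : ∀ a b : Fin n, a ≤ b → w.val (strut a b) ∈ S) (a b : Fin n) :
    w.val (strut a b) ∈ S := by
  rcases le_total a b with hab | hab
  · exact h a b hab
  · exact ((strut_comm a b).mem_iff w S).2 (h b a hab)

/-- The label of the middle leg of a comb does not matter, up to a unit. -/
theorem comb_mem_iff (i m m' j k l : Fin n) :
    w.val (comb i m j k l) ∈ S ↔ w.val (comb i m' j k l) ∈ S := by
  have e (m : Fin n) :=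
    (addLeg_comm ((strut k l).addLeg strutL i) (new .fwd) m j).similar.mem_iff w S
  rw [comb_eq, comb_eq, e m, e m']
  exact addLeg_mem_iff w S _ _ (by simp) (by simp) m m'

end Vanishing

section ModelsMem

variable {n : ℕ} [NeZero n] {A : Type*} [CommRing A] [Algebra (LaurentRing n) A]
  (w : WeightSystem n A) (S : Submodule (LaurentRing n) A)

theorem fork_strut (i j k : Fin n) : Similar ((strut 0 k).fork strutL rfl i j) (tripod i j k) :=
  (addLeg_congr (relabel_strut 0 j k) (keep strutL) i).similar

theorem tripod_comm (i j k : Fin n) : Similar (tripod i j k) (tripod j i k) :=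
  ((fork_strut i j k).symm.trans (fork_comm _ _ _ i j)).trans (fork_strut j i k)

theorem val_tripod_self (i k : Fin n) : w.val (tripod i i k) = 0 := by
  have h := ((fork_strut i i k).mem_iff w ⊥).1
    ((Submodule.mem_bot _).2 (val_fork_self w _ _ _ i))
  exact (Submodule.mem_bot _).1 h

theorem fork_hTree (i j k l : Fin n) :
    Similar (((strut 0 l).addLeg strutL j).fork (old strutL) rfl i k) (hTree i j k l) := by
  refine (fork_addLeg (strut 0 l) strutL rfl i k j).symm.trans ?_
  exact (addLeg_congr (addLeg_congr (relabel_strut 0 k l) (keep strutL) i) (new .fwd) j).similar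

theorem fork_comb (i m j k l : Fin n) :
    Similar ((((strut 0 l).addLeg strutL j).addLeg (old strutL) m).fork (old (old strutL)) rfl i k)
      (comb i m j k l) := by
  refine (fork_addLeg ((strut 0 l).addLeg strutL j) (old strutL) rfl i k m).symm.trans ?_
  refine (fork_addLeg_addLeg (strut 0 l) strutL rfl i k j m).symm.trans ?_
  refine (addLeg_comm ((strut 0 l).fork strutL rfl i k) (new .fwd) m j).symm.similar.trans ?_
  exact (addLeg_congr (addLeg_congr (addLeg_congr (relabel_strut 0 k l) (keep strutL) i)
    (new .fwd) m) (new .fwd) j).similar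

variable {S}

theorem hTree_mem_of_left (j l : Fin n) (h : ∀ c, w.val (hTree 0 j c l) ∈ S) (i k : Fin n) :
    w.val (hTree i j k l) ∈ S := by
  rw [← (fork_hTree i j k l).mem_iff w S]
  refine fork_mem w S _ _ rfl 0 (by simp) (fun c => ?_) i k
  exact (((fork_comm _ _ _ c 0).trans (fork_hTree 0 j c l)).mem_iff w S).2 (h c)

theorem comb_mem_of_left (m j l : Fin n) (h : ∀ c, w.val (comb 0 m j c l) ∈ S) (i k : Fin n) :
    w.val (comb i m j k l) ∈ S := by
  rw [← (fork_comb i m j k l).mem_iff w S]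
  refine fork_mem w S _ _ rfl 0 (by simp) (fun c => ?_) i k
  exact (((fork_comm _ _ _ c 0).trans (fork_comb 0 m j c l)).mem_iff w S).2 (h c)

theorem hTree_zero_mem (h : ∀ a b : Fin n, 0 < a → a ≤ b → w.val (hTree 0 0 a b) ∈ S)
    (a b : Fin n) : w.val (hTree 0 0 a b) ∈ S := by
  have h0 (b : Fin n) : w.val (hTree 0 0 0 b) ∈ S := by
    refine ((fork_hTree 0 0 0 b).mem_iff w S).1 ?_
    exact mem_of_eq_zero (val_fork_self w ((strut 0 b).addLeg strutL 0) (old strutL) rfl 0)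
  rcases eq_or_ne a 0 with rfl | ha
  · exact h0 b
  rcases eq_or_ne b 0 with rfl | hb
  · exact ((hTree_reflect 0 0 a 0).mem_iff w S).2 (h0 a)
  rcases le_total a b with hab | hab
  · exact h a b (Fin.pos_iff_ne_zero.2 ha) hab
  · exact ((hTree_reflect 0 0 a b).mem_iff w S).2 (h b a (Fin.pos_iff_ne_zero.2 hb) hab)

theorem hTree_mem (h : ∀ a b : Fin n, 0 < a → a ≤ b → w.val (hTree 0 0 a b) ∈ S)
    (i j k l : Fin n) : w.val (hTree i j k l) ∈ S := by
  refine hTree_mem_of_left w j l (fun c => ?_) i k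
  rw [(hTree_reflect 0 j c l).mem_iff w S]
  refine hTree_mem_of_left w 0 c (fun e => ?_) j l
  exact hTree_zero_mem w h e c

theorem tripod_zero_mem (h : ∀ a b : Fin n, 0 < a → a < b → w.val (tripod 0 a b) ∈ S)
    (a b : Fin n) : w.val (tripod 0 a b) ∈ S := by
  have h0 (a b : Fin n) : w.val (tripod a a b) ∈ S := by
    rw [val_tripod_self]
    exact S.zero_mem
  rcases eq_or_ne a 0 with rfl | ha
  · exact h0 0 b
  rcases eq_or_ne b 0 with rfl | hb
  · exact ((tripod_reflect 0 a 0).mem_iff w S).2 (h0 0 a)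
  rcases lt_trichotomy a b with hab | rfl | hab
  · exact h a b (Fin.pos_iff_ne_zero.2 ha) hab
  · exact (((tripod_comm 0 a a).trans (tripod_reflect a 0 a)).mem_iff w S).2 (h0 a 0)
  · exact ((tripod_reflect 0 a b).mem_iff w S).2 (h b a (Fin.pos_iff_ne_zero.2 hb) hab)

/-- The forks at both ends of a comb may be given a leg labeled `0`, then the middle leg as well,
and (CL1B) applies. -/
theorem comb_mem (h : ∀ a b : Fin n, 0 < a → a < b → w.val (tripod 0 a b) ∈ S)
    (i m j k l : Fin n) : w.val (comb i m j k l) ∈ S := by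
  refine comb_mem_of_left w m j l (fun c => ?_) i k
  rw [(comb_reflect 0 m j c l).mem_iff w S]
  refine comb_mem_of_left w m 0 c (fun e => ?_) j l
  rw [comb_mem_iff w 0 m 0, w.comb]
  exact S.smul_mem _ (tripod_zero_mem w h e c)

/-- By (CL1B), a tripod is a comb up to a unit. -/
theorem tripod_mem (h : ∀ a b : Fin n, 0 < a → a < b → w.val (tripod 0 a b) ∈ S)
    (i j k : Fin n) : w.val (tripod i j k) ∈ S := by
  have h1 := comb_mem w h i i i j k
  rw [w.comb, pow_two, mul_smul] at h1
  rwa [smul_dVar_mem_iff, smul_dVar_mem_iff] at h1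

theorem wheel_mem (h : w.val (wheel 0 0) ∈ S) (i j : Fin n) : w.val (wheel i j) ∈ S := by
  have h1 (i j j' : Fin n) : w.val (wheel i j) ∈ S ↔ w.val (wheel i j') ∈ S :=
    addLeg_mem_iff w S (lollipop i) (loop .fwd) (by simp) (by simp) j j'
  rw [h1 i j 0, (wheel_comm i 0).mem_iff w S, h1 0 i 0]
  exact h

end ModelsMem

end UniDiagram

/-! ### Removing a component -/

namespace UniDiagram

section Subdiagram

variable {M : Type}

/-- The diagram on a set `K` of half-edges that is closed under `next` and under a new pairing
`o`. -/
def onSet (D : UniDiagram M) (K : Set D.H) (o : D.H → D.H) (ho : ∀ h ∈ K, o h ∈ K)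
    (hoo : ∀ h ∈ K, o (o h) = h) (hone : ∀ h ∈ K, o h ≠ h) (hn : ∀ h ∈ K, D.next h ∈ K)
    (hu : ∀ h : K, ∃ u : K, HalfEdgeReach (fun k : K => (⟨o k, ho k k.2⟩ : K))
      (fun k : K => (⟨D.next k, hn k k.2⟩ : K)) h u ∧ D.next u = u) : UniDiagram M where
  H := K
  finite_H := by
    have := D.finite_H
    infer_instance
  opp k := ⟨o k, ho k k.2⟩
  next k := ⟨D.next k, hn k k.2⟩
  label k := D.label k
  opp_opp k := Subtype.ext (hoo k k.2)
  opp_ne k := fun h => hone k k.2 (congrArg Subtype.val h)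
  next_next_next k := Subtype.ext (D.next_next_next k)
  isSome_label_iff k := by
    rw [D.isSome_label_iff, Subtype.ext_iff]
  exists_univalent h := by
    obtain ⟨u, h1, h2⟩ := hu h
    exact ⟨u, h1, Subtype.ext h2⟩

/-- A map of half-edges that respects edges and labels, and the vertices up to orientation. -/
structure SignedHom (C D : UniDiagram M) (e : C.H → D.H) : Prop where
  opp : ∀ h, e (C.opp h) = D.opp (e h)
  label : ∀ h, C.label h = D.label (e h)
  next : ∀ h, e (C.next h) = D.next (e h) ∨ e (C.next h) = D.next (D.next (e h))

theorem SignedHom.next_eq_iff {C D : UniDiagram M} {e : C.H → D.H} (he : SignedHom C D e)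
    (h : C.H) : D.next (e h) = e h ↔ C.next h = h := by
  rw [← D.isSome_label_iff, ← he.label, C.isSome_label_iff]

/-- A map from a connected diagram is a covering of its image, it is injective if one of its fibers
has only one element. -/
theorem SignedHom.injective {C D : UniDiagram M} {e : C.H → D.H} (he : SignedHom C D e) (r : C.H)
    (hr : ∀ a, HalfEdgeReach C.opp C.next a r) (hf : ∀ b, e b = e r → b = r) :
    Function.Injective e := by
  suffices H : ∀ a, ∀ b, e b = e a → b = a from fun a b h => H b a h
  intro a
  refine Relation.ReflTransGen.head_induction_on (hr a) hf ?_
  rintro a a1 (rfl | rfl) - ih b hb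
  · have := ih (C.opp b) (by rw [he.opp, he.opp, hb])
    rw [← C.opp_opp b, this, C.opp_opp]
  · have d3 := D.next_next_next
    have b3 := C.next_next_next b
    have a3 := C.next_next_next a
    have ua := he.next_eq_iff a
    have ub := he.next_eq_iff b
    have ka := he.next a
    have kb := he.next b
    have kb2 := he.next (C.next b)
    have kb3 := he.next (C.next (C.next b))
    have i1 := ih (C.next b)
    have i2 := ih (C.next (C.next b))
    have i3 := ih b
    have hi := C.next_injective
    by_cases hu : D.next (e a) = e a
    · have : C.next a = a := ua.1 hu
      grind
    · have hu' : D.next (D.next (e a)) ≠ e a := D.next_next_ne hu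
      by_cases hs : e (C.next b) = e (C.next a)
      · exact hi (i1 hs)
      · rw [hb] at kb
        exfalso
        grind

theorem SignedHom.exists_next {C D : UniDiagram M} {e : C.H → D.H} (he : SignedHom C D e)
    (hi : Function.Injective e) (c : C.H) : ∃ c', D.next (e c) = e c' := by
  have d3 := D.next_next_next (e c)
  have h1 := he.next c
  have h2 := he.next (C.next c)
  have u := he.next_eq_iff c
  rcases h1 with h1 | h1
  · exact ⟨_, h1.symm⟩
  · rcases h2 with h2 | h2
    · rw [h1, d3] at h2
      have h3 := hi h2
      by_cases hc : C.next c = c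
      · exact ⟨c, u.2 hc⟩
      · exact absurd h3 (C.next_next_ne hc)
    · exact ⟨C.next (C.next c), by rw [h2, h1, d3]⟩

/-- The image of an injective map is a union of components. -/
theorem SignedHom.exists_union {C D : UniDiagram M} {e : C.H → D.H} (he : SignedHom C D e)
    (hi : Function.Injective e) :
    ∃ E : UniDiagram M, Similar D (C.union E) ∧ Nat.card C.H + Nat.card E.H = Nat.card D.H := by
  classical
  have := D.finite_H
  have := C.finite_H
  set K : Set D.H := {h | ∀ c, e c ≠ h} with hK
  have ho : ∀ h ∈ K, D.opp h ∈ K := fun h hh c hc =>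
    hh (C.opp c) (by rw [he.opp, hc, D.opp_opp])
  have hn : ∀ h ∈ K, D.next h ∈ K := fun h hh c hc => by
    obtain ⟨c1, h1⟩ := he.exists_next hi c
    obtain ⟨c2, h2⟩ := he.exists_next hi c1
    exact hh c2 (by rw [← h2, ← h1, hc, D.next_next_next])
  let E : UniDiagram M := D.onSet K D.opp ho (fun h _ => D.opp_opp h) (fun h _ => D.opp_ne h) hn (by
    rintro ⟨h, hh⟩
    obtain ⟨u, hu, hu'⟩ := D.exists_univalent h
    suffices H : ∃ hk : u ∈ K, HalfEdgeReach (fun k : K => (⟨D.opp k, ho k k.2⟩ : K))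
        (fun k : K => (⟨D.next k, hn k k.2⟩ : K)) ⟨h, hh⟩ ⟨u, hk⟩ by
      obtain ⟨hk, h1⟩ := H
      exact ⟨⟨u, hk⟩, h1, hu'⟩
    clear hu'
    induction hu with
    | refl => exact ⟨hh, .refl⟩
    | tail _ h2 ih =>
      obtain ⟨hb, ih⟩ := ih
      rcases h2 with rfl | rfl
      · exact ⟨ho _ hb, reach_opp ih rfl⟩
      · exact ⟨hn _ hb, reach_next ih rfl⟩)
  have := E.finite_H
  let f : C.H ⊕ K → D.H := Sum.elim e Subtype.val
  have hf : Function.Bijective f := by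
    constructor
    · rintro (a | a) (b | b) h
      · exact congrArg Sum.inl (hi h)
      · exact absurd h (b.2 a)
      · exact absurd h.symm (a.2 b)
      · exact congrArg Sum.inr (Subtype.ext h)
    · intro h
      by_cases hh : h ∈ K
      · exact ⟨Sum.inr ⟨h, hh⟩, rfl⟩
      · simp only [hK, Set.mem_ofPred_eq, not_forall, not_not] at hh
        obtain ⟨c, hc⟩ := hh
        exact ⟨Sum.inl c, hc⟩
  refine ⟨E, Similar.symm ⟨Equiv.ofBijective f hf, ?_, ?_, ?_⟩, ?_⟩
  · rintro (a | a)
    · exact he.opp a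
    · rfl
  · rintro (a | a)
    · exact he.label a
    · rfl
  · rintro (a | a)
    · exact he.next a
    · exact Or.inl rfl
  · rw [← Nat.card_congr (Equiv.ofBijective f hf)]
    exact Nat.card_sum.symm

/-- All half-edges belong to one component. -/
def IsConnected (D : UniDiagram M) : Prop := ∀ a b, HalfEdgeReach D.opp D.next a b

theorem isConnected_of_reach (D : UniDiagram M) (r : D.H)
    (h : ∀ a, HalfEdgeReach D.opp D.next a r) : D.IsConnected :=
  fun a b => (h a).trans (reach_symm D.opp_opp D.next_next_next (h b))

theorem IsConnected.addLeg {D : UniDiagram M} (hD : D.IsConnected) (x : D.H) (i : M) :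
    (D.addLeg x i).IsConnected := by
  have hs : HalfEdgeReach (D.addLeg x i).opp (D.addLeg x i).next (new .stem) (new .leaf) :=
    .single (Or.inl rfl)
  have hf : HalfEdgeReach (D.addLeg x i).opp (D.addLeg x i).next (new .fwd) (new .leaf) :=
    .head (Or.inr rfl) hs
  have hb : HalfEdgeReach (D.addLeg x i).opp (D.addLeg x i).next (new .back) (new .leaf) :=
    .head (Or.inr rfl) hf
  refine isConnected_of_reach _ (new .leaf) (addLeg_ind (fun h => ?_) hb hf hs .refl)
  refine Relation.ReflTransGen.head_induction_on (hD h x) ?_ ?_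
  · exact .head (Or.inl opp_old_self.symm) hb
  · rintro a b (rfl | rfl) - ih
    · by_cases h1 : a = x
      · subst h1
        exact .head (Or.inl opp_old_self.symm) hb
      by_cases h2 : a = D.opp x
      · subst h2
        exact .head (Or.inl opp_old_opp.symm) hf
      · exact .head (Or.inl (opp_old_of_ne h1 h2).symm) ih
    · exact .head (Or.inr rfl) ih

theorem isConnected_strut (a b : M) : (strut a b).IsConnected :=
  isConnected_of_reach _ strutL (strut_ind .refl (.single (Or.inl rfl)))

theorem isConnected_lollipop (a : M) : (lollipop a).IsConnected := by
  have hs : HalfEdgeReach (lollipop a).opp (lollipop a).next (loop .stem) (loop .leaf) :=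
    .single (Or.inl rfl)
  have hf : HalfEdgeReach (lollipop a).opp (lollipop a).next (loop .fwd) (loop .leaf) :=
    .head (Or.inr rfl) hs
  exact isConnected_of_reach _ (loop .leaf) (loop_ind (.head (Or.inr rfl) hf) hf hs .refl)

end Subdiagram

section Component

variable {n : ℕ} {A : Type*} [CommRing A] [Algebra (LaurentRing n) A] {w : WeightSystem n A}
  {S : Subalgebra (LaurentRing n) A} {D : UniDiagram (Fin n)}

/-- A diagram with a known component is known if all smaller diagrams are. -/
theorem SignedHom.val_mem {C : UniDiagram (Fin n)} {e : C.H → D.H} (he : SignedHom C D e)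
    (ih : ∀ E : UniDiagram (Fin n), Nat.card E.H < Nat.card D.H → w.val E ∈ S)
    (hC : w.val C ∈ S) (r : C.H) (hc : C.IsConnected) (hf : ∀ b, e b = e r → b = r) :
    w.val D ∈ S := by
  obtain ⟨E, h1, h2⟩ := he.exists_union (he.injective r (fun a => hc a r) hf)
  have := C.finite_H
  have : 0 < Nat.card C.H := Nat.card_pos_iff.2 ⟨⟨r⟩, inferInstance⟩
  rw [← Subalgebra.mem_toSubmodule, h1.mem_iff w, w.union, Subalgebra.mem_toSubmodule]
  exact S.mul_mem hC (ih E (by omega))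

end Component

end UniDiagram

/-! ### Recognizing components -/

namespace UniDiagram

section Vertex

variable {M : Type}

/-- `a`, `b`, `c` are the half-edges at a trivalent vertex, in some order. -/
def IsVertex (D : UniDiagram M) (a b c : D.H) : Prop :=
  D.next a ≠ a ∧ (D.next a = b ∧ D.next b = c ∧ D.next c = a ∨
    D.next a = c ∧ D.next c = b ∧ D.next b = a)

variable {D : UniDiagram M} {a b c : D.H}

theorem isVertex_next (h : D.next a ≠ a) : D.IsVertex a (D.next a) (D.next (D.next a)) :=
  ⟨h, Or.inl ⟨rfl, rfl, D.next_next_next a⟩⟩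

theorem IsVertex.swap (v : D.IsVertex a b c) : D.IsVertex a c b :=
  ⟨v.1, v.2.symm⟩

theorem IsVertex.rotate (v : D.IsVertex a b c) : D.IsVertex b c a := by
  obtain ⟨h, ⟨h1, h2, h3⟩ | ⟨h1, h2, h3⟩⟩ := v
  · exact ⟨fun e => h (D.next_injective (by rw [h1, e])), Or.inl ⟨h2, h3, h1⟩⟩
  · exact ⟨fun e => h (by rw [← h3, e]; exact e), Or.inr ⟨h3, h1, h2⟩⟩

theorem IsVertex.next_or (v : D.IsVertex a b c) : b = D.next a ∨ b = D.next (D.next a) := by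
  obtain ⟨h, ⟨h1, h2, h3⟩ | ⟨h1, h2, h3⟩⟩ := v
  · exact Or.inl h1.symm
  · exact Or.inr (by rw [h1, h2])

theorem IsVertex.ne (v : D.IsVertex a b c) : a ≠ b := by
  rintro rfl
  obtain ⟨h, ⟨h1, h2, h3⟩ | ⟨h1, h2, h3⟩⟩ := v
  · exact h h1
  · exact h h3

theorem IsVertex.facts (v : D.IsVertex a b c) :
    (b = D.next a ∨ b = D.next (D.next a)) ∧ (c = D.next b ∨ c = D.next (D.next b)) ∧
    (a = D.next c ∨ a = D.next (D.next c)) ∧ (a = D.next b ∨ a = D.next (D.next b)) ∧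
    (b = D.next c ∨ b = D.next (D.next c)) ∧ (c = D.next a ∨ c = D.next (D.next a)) :=
  ⟨v.next_or, v.rotate.next_or, v.rotate.rotate.next_or, v.rotate.swap.next_or,
    v.rotate.rotate.swap.next_or, v.swap.next_or⟩

theorem IsVertex.nes (v : D.IsVertex a b c) :
    D.next a ≠ a ∧ D.next b ≠ b ∧ D.next c ≠ c ∧ a ≠ b ∧ b ≠ c ∧ a ≠ c :=
  ⟨v.1, v.rotate.1, v.rotate.rotate.1, v.ne, v.rotate.ne, v.swap.ne⟩

theorem IsVertex.labels (v : D.IsVertex a b c) :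
    D.label a = none ∧ D.label b = none ∧ D.label c = none := by
  simp only [label_eq_none_iff]
  exact ⟨v.nes.1, v.nes.2.1, v.nes.2.2.1⟩

/-- Two vertices are equal or disjoint. -/
theorem IsVertex.disjoint {x y z : D.H} (v : D.IsVertex a b c) (v' : D.IsVertex x y z)
    (h : a ≠ x ∧ a ≠ y ∧ a ≠ z) :
    (b ≠ x ∧ b ≠ y ∧ b ≠ z) ∧ (c ≠ x ∧ c ≠ y ∧ c ≠ z) := by
  obtain ⟨-, ⟨h1, h2, h3⟩ | ⟨h1, h2, h3⟩⟩ := v <;>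
  obtain ⟨-, ⟨k1, k2, k3⟩ | ⟨k1, k2, k3⟩⟩ := v' <;> grind

theorem exists_label {u : D.H} (hu : D.next u = u) : ∃ i, D.label u = some i :=
  Option.isSome_iff_exists.1 ((D.isSome_label_iff u).2 hu)

@[simp] theorem opp_inj {h k : D.H} : D.opp h = D.opp k ↔ h = k :=
  ⟨fun e => by rw [← D.opp_opp h, e, D.opp_opp], congrArg _⟩

theorem opp_eq_iff {h k : D.H} : D.opp h = k ↔ h = D.opp k :=
  ⟨fun e => by rw [← e, D.opp_opp], fun e => by rw [e, D.opp_opp]⟩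

theorem ne_of_next {p u : D.H} (hp : D.next p ≠ p) (hu : D.next u = u) : p ≠ u := by
  rintro rfl
  exact hp hu

end Vertex

section Configurations

variable {n : ℕ} {A : Type*} [CommRing A] [Algebra (LaurentRing n) A] {w : WeightSystem n A}
  {S : Subalgebra (LaurentRing n) A} {D : UniDiagram (Fin n)}

theorem val_mem_of_strut
    (ih : ∀ E : UniDiagram (Fin n), Nat.card E.H < Nat.card D.H → w.val E ∈ S)
    (hC : ∀ i j, w.val (strut i j) ∈ S) {u : D.H} (hu : D.next u = u)
    (hv : D.next (D.opp u) = D.opp u) : w.val D ∈ S := by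
  obtain ⟨i, hi⟩ := exists_label hu
  obtain ⟨j, hj⟩ := exists_label hv
  refine SignedHom.val_mem (C := strut i j) (e := strutElim u (D.opp u)) ⟨?_, ?_, ?_⟩ ih
    (hC i j) strutL (isConnected_strut i j) ?_
  · exact strut_ind (by simp) (by simp [D.opp_opp])
  · exact strut_ind (by simp [hi]) (by simp [hj])
  · exact strut_ind (by simp [hu]) (by simp [hv])
  · exact strut_ind (by simp) (by simp [D.opp_ne])

theorem val_mem_of_tripod
    (ih : ∀ E : UniDiagram (Fin n), Nat.card E.H < Nat.card D.H → w.val E ∈ S)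
    (hC : ∀ i j k, w.val (tripod i j k) ∈ S) {p₀ p₁ p₂ : D.H}
    (v : D.IsVertex p₀ p₁ p₂) (l₀ : D.next (D.opp p₀) = D.opp p₀)
    (l₁ : D.next (D.opp p₁) = D.opp p₁) (l₂ : D.next (D.opp p₂) = D.opp p₂) : w.val D ∈ S := by
  obtain ⟨i, hi⟩ := exists_label l₀
  obtain ⟨j, hj⟩ := exists_label l₁
  obtain ⟨k, hk⟩ := exists_label l₂
  obtain ⟨f1, f2, f3, f4, f5, f6⟩ := v.facts
  obtain ⟨n1, n2, n3, n4, n5, n6⟩ := v.nes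
  have hl := v.labels
  have e1 := ne_of_next n1 l₀
  have e2 := ne_of_next n2 l₀
  have e3 := ne_of_next n3 l₀
  refine SignedHom.val_mem (C := (strut j k).addLeg strutL i)
    (e := addLegElim (strutElim (D.opp p₁) (D.opp p₂)) fun
      | .back => p₁
      | .fwd => p₂
      | .stem => p₀
      | .leaf => D.opp p₀) ⟨?_, ?_, ?_⟩ ih
    (hC i j k) (new .leaf) ((isConnected_strut j k).addLeg _ _) ?_
  · refine addLeg_ind (strut_ind ?_ ?_) ?_ ?_ ?_ ?_ <;> simp [opp_old, D.opp_opp]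
  · refine addLeg_ind (strut_ind ?_ ?_) ?_ ?_ ?_ ?_ <;> simp [hi, hj, hk, hl]
  · refine addLeg_ind (strut_ind ?_ ?_) ?_ ?_ ?_ ?_ <;> simp [f1, f3, f2, l₀, l₁, l₂]
  · refine addLeg_ind (strut_ind ?_ ?_) ?_ ?_ ?_ ?_ <;>
      simp [e1, e2, e3, n4.symm, n6.symm]

theorem val_mem_of_lollipop
    (ih : ∀ E : UniDiagram (Fin n), Nat.card E.H < Nat.card D.H → w.val E ∈ S)
    {s p₀ p₁ : D.H}
    (v : D.IsVertex s p₀ p₁) (l : D.next (D.opp s) = D.opp s) (h : D.opp p₀ = p₁) :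
    w.val D ∈ S := by
  obtain ⟨i, hi⟩ := exists_label l
  obtain ⟨f1, f2, f3, f4, f5, f6⟩ := v.facts
  obtain ⟨n1, n2, n3, n4, n5, n6⟩ := v.nes
  have hl := v.labels
  have e1 := ne_of_next n1 l
  have e2 := ne_of_next n2 l
  have e3 := ne_of_next n3 l
  have h' := opp_eq_iff.1 h
  refine SignedHom.val_mem (C := lollipop i) (e := loopElim fun
      | .back => p₁
      | .fwd => p₀
      | .stem => s
      | .leaf => D.opp s) ⟨?_, ?_, ?_⟩ ih
    (by rw [val_lollipop]; exact S.zero_mem) (loop .leaf) (isConnected_lollipop i) ?_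
  · refine loop_ind ?_ ?_ ?_ ?_ <;> simp [D.opp_opp, h, ← h']
  · refine loop_ind ?_ ?_ ?_ ?_ <;> simp [hi, hl]
  · refine loop_ind ?_ ?_ ?_ ?_ <;> simp [f4, f5, f6, l]
  · refine loop_ind ?_ ?_ ?_ ?_ <;> simp [e1, e2, e3]

theorem val_mem_of_hTree
    (ih : ∀ E : UniDiagram (Fin n), Nat.card E.H < Nat.card D.H → w.val E ∈ S)
    (hC : ∀ i j k l, w.val (hTree i j k l) ∈ S) {p₀ p₁ p₂ q₀ q₁ q₂ : D.H}
    (v : D.IsVertex p₀ p₁ p₂) (v' : D.IsVertex q₀ q₁ q₂) (h : D.opp p₀ = q₀)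
    (l₁ : D.next (D.opp p₁) = D.opp p₁) (l₂ : D.next (D.opp p₂) = D.opp p₂)
    (m₁ : D.next (D.opp q₁) = D.opp q₁) (m₂ : D.next (D.opp q₂) = D.opp q₂)
    (d₁ : q₁ ≠ p₁) (d₂ : q₂ ≠ p₁) : w.val D ∈ S := by
  obtain ⟨i, hi⟩ := exists_label l₁
  obtain ⟨k, hk⟩ := exists_label l₂
  obtain ⟨j, hj⟩ := exists_label m₁
  obtain ⟨l, hl⟩ := exists_label m₂
  obtain ⟨f1, f2, f3, f4, f5, f6⟩ := v.facts
  obtain ⟨n1, n2, n3, n4, n5, n6⟩ := v.nes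
  have hl1 := v.labels
  obtain ⟨f1', f2', f3', f4', f5', f6'⟩ := v'.facts
  obtain ⟨n1', n2', n3', n4', n5', n6'⟩ := v'.nes
  have hl2 := v'.labels
  have h' := opp_eq_iff.1 h
  refine SignedHom.val_mem (C := ((strut k l).addLeg strutL i).addLeg (new .fwd) j)
    (e := addLegElim (addLegElim (strutElim (D.opp p₂) (D.opp q₂)) fun
      | .back => p₂
      | .fwd => p₀
      | .stem => p₁
      | .leaf => D.opp p₁) fun
      | .back => q₀
      | .fwd => q₂
      | .stem => q₁
      | .leaf => D.opp q₁) ⟨?_, ?_, ?_⟩ ih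
    (hC i j k l) (old (new .leaf)) (((isConnected_strut k l).addLeg _ _).addLeg _ _) ?_
  · refine addLeg_ind (addLeg_ind (strut_ind ?_ ?_) ?_ ?_ ?_ ?_) ?_ ?_ ?_ ?_ <;>
      simp [opp_old, D.opp_opp, h, ← h']
  · refine addLeg_ind (addLeg_ind (strut_ind ?_ ?_) ?_ ?_ ?_ ?_) ?_ ?_ ?_ ?_ <;>
      simp [hi, hj, hk, hl, hl1, hl2]
  · refine addLeg_ind (addLeg_ind (strut_ind ?_ ?_) ?_ ?_ ?_ ?_) ?_ ?_ ?_ ?_ <;>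
      simp [f1, f2, f3, f4', f5', f6', l₁, l₂, m₁, m₂]
  · refine addLeg_ind (addLeg_ind (strut_ind ?_ ?_) ?_ ?_ ?_ ?_) ?_ ?_ ?_ ?_ <;>
      simp [ne_of_next n1 l₁, ne_of_next n2 l₁, ne_of_next n3 l₁, ne_of_next n1' l₁,
        ne_of_next n2' l₁, ne_of_next n3' l₁, n5.symm, d₁, d₂]

theorem val_mem_of_comb
    (ih : ∀ E : UniDiagram (Fin n), Nat.card E.H < Nat.card D.H → w.val E ∈ S)
    (hC : ∀ i m j k l, w.val (comb i m j k l) ∈ S)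
    {p₀ p₁ p₂ q₀ s q₁ r₀ r₁ r₂ : D.H}
    (v : D.IsVertex p₀ p₁ p₂) (v' : D.IsVertex q₀ s q₁) (v'' : D.IsVertex r₀ r₁ r₂)
    (h : D.opp p₀ = q₀) (k : D.opp q₁ = r₀)
    (l₁ : D.next (D.opp p₁) = D.opp p₁) (l₂ : D.next (D.opp p₂) = D.opp p₂)
    (ls : D.next (D.opp s) = D.opp s)
    (m₁ : D.next (D.opp r₁) = D.opp r₁) (m₂ : D.next (D.opp r₂) = D.opp r₂)
    (d₁ : p₁ ≠ s) (d₂ : p₂ ≠ s) (d₃ : r₁ ≠ s) (d₄ : r₂ ≠ s) : w.val D ∈ S := by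
  obtain ⟨a, ha⟩ := exists_label l₁
  obtain ⟨b, hb⟩ := exists_label l₂
  obtain ⟨c, hc⟩ := exists_label ls
  obtain ⟨d, hd⟩ := exists_label m₁
  obtain ⟨e, he⟩ := exists_label m₂
  obtain ⟨f1, f2, f3, f4, f5, f6⟩ := v.facts
  obtain ⟨n1, n2, n3, n4, n5, n6⟩ := v.nes
  have hl1 := v.labels
  obtain ⟨f1', f2', f3', f4', f5', f6'⟩ := v'.facts
  obtain ⟨n1', n2', n3', n4', n5', n6'⟩ := v'.nes
  have hl2 := v'.labels
  obtain ⟨g1, g2, g3, g4, g5, g6⟩ := v''.facts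
  obtain ⟨k1, k2, k3, k4, k5, k6⟩ := v''.nes
  have hl3 := v''.labels
  have h' := opp_eq_iff.1 h
  have k' := opp_eq_iff.1 k
  refine SignedHom.val_mem
    (C := (((strut b e).addLeg strutL a).addLeg (new .fwd) c).addLeg (new .fwd) d)
    (e := addLegElim (addLegElim (addLegElim (strutElim (D.opp p₂) (D.opp r₂)) fun
      | .back => p₂
      | .fwd => p₀
      | .stem => p₁
      | .leaf => D.opp p₁) fun
      | .back => q₀
      | .fwd => q₁
      | .stem => s
      | .leaf => D.opp s) fun
      | .back => r₀
      | .fwd => r₂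
      | .stem => r₁
      | .leaf => D.opp r₁) ⟨?_, ?_, ?_⟩ ih
    (hC a c d b e) (old (new .leaf))
    ((((isConnected_strut b e).addLeg _ _).addLeg _ _).addLeg _ _) ?_
  · refine addLeg_ind (addLeg_ind (addLeg_ind (strut_ind ?_ ?_) ?_ ?_ ?_ ?_) ?_ ?_ ?_ ?_)
      ?_ ?_ ?_ ?_ <;> simp [opp_old, D.opp_opp, h, ← h', k, ← k']
  · refine addLeg_ind (addLeg_ind (addLeg_ind (strut_ind ?_ ?_) ?_ ?_ ?_ ?_) ?_ ?_ ?_ ?_)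
      ?_ ?_ ?_ ?_ <;> simp [ha, hb, hc, hd, he, hl1, hl2, hl3]
  · refine addLeg_ind (addLeg_ind (addLeg_ind (strut_ind ?_ ?_) ?_ ?_ ?_ ?_) ?_ ?_ ?_ ?_)
      ?_ ?_ ?_ ?_ <;>
      simp [f1, f2, f3, f4', f5', f6', g4, g5, g6,
        l₁, l₂, ls, m₁, m₂]
  · refine addLeg_ind (addLeg_ind (addLeg_ind (strut_ind ?_ ?_) ?_ ?_ ?_ ?_) ?_ ?_ ?_ ?_)
      ?_ ?_ ?_ ?_ <;>
      simp [ne_of_next n1 ls, ne_of_next n2 ls, ne_of_next n3 ls, ne_of_next n1' ls,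
        ne_of_next n2' ls, ne_of_next n3' ls, ne_of_next k1 ls, ne_of_next k2 ls,
        ne_of_next k3 ls, d₁, d₂, d₃, d₄]

theorem val_mem_of_wheel
    (ih : ∀ E : UniDiagram (Fin n), Nat.card E.H < Nat.card D.H → w.val E ∈ S)
    (hC : ∀ i j, w.val (wheel i j) ∈ S) {s p₀ p₁ t q₀ q₁ : D.H}
    (v : D.IsVertex s p₀ p₁) (v' : D.IsVertex t q₀ q₁) (h : D.opp p₀ = q₀) (k : D.opp p₁ = q₁)
    (ls : D.next (D.opp s) = D.opp s) (lt : D.next (D.opp t) = D.opp t) (d : t ≠ s) :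
    w.val D ∈ S := by
  obtain ⟨a, ha⟩ := exists_label ls
  obtain ⟨b, hb⟩ := exists_label lt
  obtain ⟨f1, f2, f3, f4, f5, f6⟩ := v.facts
  obtain ⟨n1, n2, n3, n4, n5, n6⟩ := v.nes
  have hl1 := v.labels
  obtain ⟨f1', f2', f3', f4', f5', f6'⟩ := v'.facts
  obtain ⟨n1', n2', n3', n4', n5', n6'⟩ := v'.nes
  have hl2 := v'.labels
  have h' := opp_eq_iff.1 h
  have k' := opp_eq_iff.1 k
  refine SignedHom.val_mem (C := (lollipop a).addLeg (loop .fwd) b)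
    (e := addLegElim (loopElim fun
      | .back => p₁
      | .fwd => p₀
      | .stem => s
      | .leaf => D.opp s) fun
      | .back => q₀
      | .fwd => q₁
      | .stem => t
      | .leaf => D.opp t) ⟨?_, ?_, ?_⟩ ih
    (hC a b) (old (loop .leaf)) ((isConnected_lollipop a).addLeg _ _) ?_
  · refine addLeg_ind (loop_ind ?_ ?_ ?_ ?_) ?_ ?_ ?_ ?_ <;>
      simp [opp_old, D.opp_opp, h, ← h', k, ← k']
  · refine addLeg_ind (loop_ind ?_ ?_ ?_ ?_) ?_ ?_ ?_ ?_ <;> simp [ha, hb, hl1, hl2]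
  · refine addLeg_ind (loop_ind ?_ ?_ ?_ ?_) ?_ ?_ ?_ ?_ <;>
      simp [f4, f5, f6, f1', f2', f3', ls, lt]
  · refine addLeg_ind (loop_ind ?_ ?_ ?_ ?_) ?_ ?_ ?_ ?_ <;>
      simp [ne_of_next n1 ls, ne_of_next n2 ls, ne_of_next n3 ls, ne_of_next n1' ls,
        ne_of_next n2' ls, ne_of_next n3' ls, d]

theorem val_mem_of_wheel₃
    (ih : ∀ E : UniDiagram (Fin n), Nat.card E.H < Nat.card D.H → w.val E ∈ S)
    {s p₀ p₁ t q₀ q₁ u r₀ r₁ : D.H}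
    (v : D.IsVertex s p₀ p₁) (v' : D.IsVertex t q₀ q₁) (v'' : D.IsVertex u r₀ r₁)
    (h : D.opp p₀ = q₀) (k : D.opp q₁ = r₀) (m : D.opp r₁ = p₁)
    (ls : D.next (D.opp s) = D.opp s) (lt : D.next (D.opp t) = D.opp t)
    (lu : D.next (D.opp u) = D.opp u) (d₁ : s ≠ t) (d₂ : u ≠ t) :
    w.val D ∈ S := by
  obtain ⟨a, ha⟩ := exists_label ls
  obtain ⟨b, hb⟩ := exists_label lt
  obtain ⟨c, hc⟩ := exists_label lu
  obtain ⟨f1, f2, f3, f4, f5, f6⟩ := v.facts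
  obtain ⟨n1, n2, n3, n4, n5, n6⟩ := v.nes
  have hl1 := v.labels
  obtain ⟨f1', f2', f3', f4', f5', f6'⟩ := v'.facts
  obtain ⟨n1', n2', n3', n4', n5', n6'⟩ := v'.nes
  have hl2 := v'.labels
  obtain ⟨g1, g2, g3, g4, g5, g6⟩ := v''.facts
  obtain ⟨k1, k2, k3, k4, k5, k6⟩ := v''.nes
  have hl3 := v''.labels
  have h' := opp_eq_iff.1 h
  have k' := opp_eq_iff.1 k
  have m' := opp_eq_iff.1 m
  refine SignedHom.val_mem (C := ((lollipop a).addLeg (loop .fwd) b).addLeg (new .fwd) c)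
    (e := addLegElim (addLegElim (loopElim fun
      | .back => p₁
      | .fwd => p₀
      | .stem => s
      | .leaf => D.opp s) fun
      | .back => q₀
      | .fwd => q₁
      | .stem => t
      | .leaf => D.opp t) fun
      | .back => r₀
      | .fwd => r₁
      | .stem => u
      | .leaf => D.opp u) ⟨?_, ?_, ?_⟩ ih
    (by rw [← wheel₃_eq, val_wheel₃]; exact S.zero_mem) (old (new .leaf))
    (((isConnected_lollipop a).addLeg _ _).addLeg _ _) ?_
  · refine addLeg_ind (addLeg_ind (loop_ind ?_ ?_ ?_ ?_) ?_ ?_ ?_ ?_) ?_ ?_ ?_ ?_ <;>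
      simp [opp_old, D.opp_opp, h, ← h', k, ← k', m, ← m']
  · refine addLeg_ind (addLeg_ind (loop_ind ?_ ?_ ?_ ?_) ?_ ?_ ?_ ?_) ?_ ?_ ?_ ?_ <;>
      simp [ha, hb, hc, hl1, hl2, hl3]
  · refine addLeg_ind (addLeg_ind (loop_ind ?_ ?_ ?_ ?_) ?_ ?_ ?_ ?_) ?_ ?_ ?_ ?_ <;>
      simp [f4, f5, f6, f1', f2', f3', g1, g2, g3, 
        ls, lt, lu]
  · refine addLeg_ind (addLeg_ind (loop_ind ?_ ?_ ?_ ?_) ?_ ?_ ?_ ?_) ?_ ?_ ?_ ?_ <;>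
      simp [ne_of_next n1 lt, ne_of_next n2 lt, ne_of_next n3 lt, ne_of_next n1' lt,
        ne_of_next n2' lt, ne_of_next n3' lt, ne_of_next k1 lt, ne_of_next k2 lt,
        ne_of_next k3 lt, d₁, d₂]

end Configurations

end UniDiagram

/-! ### Removing two neighboring vertices -/

namespace UniDiagram

section Contraction

/-- The diagram `onSet`, described through the inclusion of its half-edges. -/
theorem exists_onSet {M : Type} (D : UniDiagram M) (K : Set D.H) (o : D.H → D.H)
    (ho : ∀ h ∈ K, o h ∈ K) (hoo : ∀ h ∈ K, o (o h) = h) (hone : ∀ h ∈ K, o h ≠ h)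
    (hn : ∀ h ∈ K, D.next h ∈ K)
    (hu : ∀ h ∈ K, D.next h ≠ h → ∃ k, (k = h ∨ k = D.next h ∨ k = D.next (D.next h)) ∧
      D.next (o k) = o k) :
    ∃ (E : UniDiagram M) (c : E.H → D.H), Function.Injective c ∧ (∀ h, h ∈ K ↔ ∃ k, c k = h) ∧
      (∀ k, c (E.opp k) = o (c k)) ∧ (∀ k, c (E.next k) = D.next (c k)) ∧
      ∀ k, E.label k = D.label (c k) := by
  refine ⟨D.onSet K o ho hoo hone hn ?_, Subtype.val, Subtype.val_injective,
    fun h => ⟨fun hh => ⟨⟨h, hh⟩, rfl⟩, ?_⟩, fun _ => rfl, fun _ => rfl, fun _ => rfl⟩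
  · rintro ⟨h, hh⟩
    by_cases h1 : D.next h = h
    · exact ⟨⟨h, hh⟩, .refl, h1⟩
    · obtain ⟨k, hk, hk'⟩ := hu h hh h1
      suffices H : ∃ hk : k ∈ K, HalfEdgeReach (fun k : K => (⟨o k, ho k k.2⟩ : K))
          (fun k : K => (⟨D.next k, hn k k.2⟩ : K)) ⟨h, hh⟩ ⟨k, hk⟩ by
        obtain ⟨hk, h1⟩ := H
        exact ⟨⟨o k, ho k hk⟩, reach_opp h1 rfl, hk'⟩
      rcases hk with rfl | rfl | rfl
      · exact ⟨hh, .refl⟩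
      · exact ⟨hn _ hh, .single (Or.inr rfl)⟩
      · exact ⟨hn _ (hn _ hh), reach_next (.single (Or.inr rfl)) rfl⟩
  · rintro ⟨k, rfl⟩
    exact k.2

/-- Two neighboring vertices with one leg each, on a path that joins two further trivalent
vertices, can be removed by (CL2B). In the smaller diagram `p₀` and `t₀` form an edge; they may not
belong to the same vertex, since (CL2B) needs an edge between two different vertices. -/
theorem exists_addTwoLegs {M : Type} {D : UniDiagram M}
    (hD : ∀ h, D.next h ≠ h → ∃ k, (k = h ∨ k = D.next h ∨ k = D.next (D.next h)) ∧
      D.next (D.opp k) = D.opp k)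
    {p₀ q₀ s q₁ r₀ s' r₁ t₀ : D.H} (v : D.IsVertex q₀ s q₁) (v' : D.IsVertex r₀ s' r₁)
    (hp : D.next p₀ ≠ p₀) (ht : D.next t₀ ≠ t₀)
    (h₁ : D.opp p₀ = q₀) (h₂ : D.opp q₁ = r₀) (h₃ : D.opp r₁ = t₀)
    (l : D.next (D.opp s) = D.opp s) (l' : D.next (D.opp s') = D.opp s')
    (hpq : p₀ ≠ s ∧ p₀ ≠ q₁) (hpr : p₀ ≠ r₀ ∧ p₀ ≠ s' ∧ p₀ ≠ r₁)
    (htq : t₀ ≠ q₀ ∧ t₀ ≠ s ∧ t₀ ≠ q₁) (htr : t₀ ≠ r₀ ∧ t₀ ≠ s')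
    (hqr : q₀ ≠ r₀ ∧ q₀ ≠ s' ∧ q₀ ≠ r₁)
    (hpt : t₀ ≠ p₀ ∧ t₀ ≠ D.next p₀ ∧ t₀ ≠ D.next (D.next p₀)) :
    ∃ (E : UniDiagram M) (x : E.H) (i j : M), E.IsInner x ∧ Nat.card E.H < Nat.card D.H ∧
      Similar D (E.addTwoLegs x i j) := by
  classical
  obtain ⟨i, hi⟩ := exists_label l
  obtain ⟨j, hj⟩ := exists_label l'
  have n3 := D.next_next_next
  have oo := D.opp_opp
  have one := D.opp_ne
  have inj : ∀ a b, D.opp a = D.opp b → a = b := fun a b e => by rw [← oo a, e, oo]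
  have ninj : ∀ a b, D.next a = D.next b → a = b := fun a b e => D.next_injective e
  obtain ⟨⟨b1, b2, b3⟩, ⟨b4, b5, b6⟩⟩ := v.disjoint v' hqr
  obtain ⟨n1, n2, n3', n4, n5, n6⟩ := v.nes
  obtain ⟨m1, m2, m3, m4, m5, m6⟩ := v'.nes
  have hl := v.labels
  have hl' := v'.labels
  obtain ⟨f1, f2, f3, f4, f5, f6⟩ := v.facts
  obtain ⟨g1, g2, g3, g4, g5, g6⟩ := v'.facts
  set L : List D.H := [q₀, s, q₁, D.opp s, r₀, s', r₁, D.opp s'] with hL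
  have hnd : L.Nodup := by
    simp only [hL, List.nodup_cons, List.mem_cons, List.not_mem_nil, or_false, not_or,
      List.nodup_nil, not_false_eq_true, and_true]
    have : D.opp s ≠ D.opp s' := fun e => b2 (inj _ _ e)
    have ne := fun p (h : D.next p ≠ p) => ne_of_next h l
    have ne' := fun p (h : D.next p ≠ p) => ne_of_next h l'
    have k1 := ne _ n1
    have k2 := ne _ n2
    have k3 := ne _ n3'
    have k4 := ne _ m1
    have k5 := ne _ m2
    have k6 := ne _ m3
    have j1 := ne' _ n1
    have j2 := ne' _ n2
    have j3 := ne' _ n3'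
    have j4 := ne' _ m1
    have j5 := ne' _ m2
    have j6 := ne' _ m3
    grind
  have hmem : ∀ h, h ∈ L ↔ h = q₀ ∨ h = s ∨ h = q₁ ∨ h = D.opp s ∨ h = r₀ ∨ h = s' ∨ h = r₁ ∨
      h = D.opp s' := by
    intro h
    simp [hL]
  -- The new pairing joins `p₀` and `t₀`.
  set o : D.H → D.H := fun h => if h = p₀ then t₀ else if h = t₀ then p₀ else D.opp h with ho
  have hpL : p₀ ∉ L := by
    rw [hmem]
    have k1 := ne_of_next hp l
    have k2 := ne_of_next hp l'
    have k3 := one p₀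
    grind
  have htL : t₀ ∉ L := by
    rw [hmem]
    have k1 := ne_of_next ht l
    have k2 := ne_of_next ht l'
    have k3 := one r₁
    grind
  obtain ⟨E, c, hc, hK, co, cn, cl⟩ := D.exists_onSet {h | h ∉ L} o
    (by
      intro h hh
      simp only [Set.mem_ofPred_eq, ho] at hh ⊢
      split_ifs with k1 k2
      · exact htL
      · exact hpL
      · rw [hmem] at hh ⊢
        have := oo h
        grind)
    (by
      intro h hh
      simp only [Set.mem_ofPred_eq, ho] at hh ⊢
      rw [hmem] at hh
      have := oo h
      grind)
    (by
      intro h hh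
      have := one h
      simp only [ho]
      grind)
    (by
      intro h hh
      simp only [Set.mem_ofPred_eq] at hh ⊢
      rw [hmem] at hh ⊢
      have := n3 h
      have k1 := n3 q₀
      have k2 := n3 r₀
      grind)
    (by
      intro h _ h1
      obtain ⟨k, hk, hk'⟩ := hD h h1
      refine ⟨k, hk, ?_⟩
      have k1 : k ≠ p₀ := by
        rintro rfl
        rw [h₁] at hk'
        exact n1 hk'
      have k2 : k ≠ t₀ := by
        rintro rfl
        rw [← h₃, oo] at hk'
        exact m3 hk'
      simpa [ho, k1, k2] using hk')
  simp only [Set.mem_ofPred_eq] at hK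
  obtain ⟨x, hx⟩ := (hK p₀).1 hpL
  obtain ⟨y, hy⟩ := (hK t₀).1 htL
  have hxy : E.opp x = y := hc (by rw [co, hx, hy]; simp [ho])
  have hcard : Nat.card E.H + 8 = Nat.card D.H := by
    have := D.finite_H
    have e1 : Nat.card E.H = ({h | h ∉ L} : Set D.H).ncard := by
      rw [← Set.ncard_range_of_injective hc]
      congr 1
      ext h
      exact (hK h).symm
    have e2 : (L.toFinset : Set D.H).ncard = 8 := by
      rw [Set.ncard_coe_finset, List.toFinset_card_of_nodup hnd]
      rfl
    have e3 := Set.ncard_add_ncard_compl (L.toFinset : Set D.H)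
    have e4 : ((L.toFinset : Set D.H))ᶜ = {h | h ∉ L} := by
      ext h
      simp
    rw [e2, e4, ← e1] at e3
    omega
  refine ⟨E, x, i, j, ⟨?_, ?_, ?_, ?_⟩, by omega, Similar.symm ?_⟩
  · exact fun e => hp (by rw [← hx, ← cn, e])
  · rw [hxy]
    exact fun e => ht (by rw [← hy, ← cn, e])
  · rw [hxy]
    exact fun e => hpt.2.1 (by rw [← hx, ← hy, ← cn, e])
  · rw [hxy]
    exact fun e => hpt.2.2 (by rw [← hx, ← hy, ← cn, ← cn, e])
  have h₁' := opp_eq_iff.1 h₁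
  have h₂' := opp_eq_iff.1 h₂
  have h₃' := opp_eq_iff.1 h₃
  rw [addTwoLegs_eq]
  refine Similar.of_surjective (addLegElim (addLegElim c fun
      | .back => q₀
      | .fwd => q₁
      | .stem => s
      | .leaf => D.opp s) fun
      | .back => r₀
      | .fwd => r₁
      | .stem => s'
      | .leaf => D.opp s') ?_ ?_ ?_ ?_ ?_
  · intro h
    by_cases hh : h ∈ L
    · rw [hmem] at hh
      rcases hh with rfl | rfl | rfl | rfl | rfl | rfl | rfl | rfl
      exacts [⟨old (new .back), rfl⟩, ⟨old (new .stem), rfl⟩, ⟨old (new .fwd), rfl⟩,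
        ⟨old (new .leaf), rfl⟩, ⟨new .back, rfl⟩, ⟨new .stem, rfl⟩, ⟨new .fwd, rfl⟩,
        ⟨new .leaf, rfl⟩]
    · obtain ⟨k, hk⟩ := (hK h).1 hh
      exact ⟨old (old k), hk⟩
  · rw [card_addLeg, card_addLeg]
    omega
  · refine addLeg_ind (addLeg_ind (fun k => ?_) ?_ ?_ ?_ ?_) ?_ ?_ ?_ ?_
    · by_cases k1 : k = x
      · have k3 : x ≠ y := fun e => E.opp_ne x (hxy.trans e.symm)
        simp [opp_old, k1, hxy, k3, hx, h₁]
      · by_cases k2 : k = y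
        · simp [opp_old, hxy, k2, hy, ← h₃']
        · have k3 : c k ≠ p₀ := fun e => k1 (hc (e.trans hx.symm))
          have k4 : c k ≠ t₀ := fun e => k2 (hc (e.trans hy.symm))
          simp [opp_old, hxy, k1, k2, co, ho, k3, k4]
    all_goals simp [opp_old, hxy, oo, hx, hy, ← h₁', h₂, ← h₂', h₃]
  · refine addLeg_ind (addLeg_ind (fun k => ?_) ?_ ?_ ?_ ?_) ?_ ?_ ?_ ?_ <;>
      simp [cl, hi, hj, hl, hl']
  · refine addLeg_ind (addLeg_ind (fun k => ?_) ?_ ?_ ?_ ?_) ?_ ?_ ?_ ?_ <;>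
      simp [cn, f4, f5, f6, g4, g5, g6, l, l']

end Contraction

end UniDiagram

/-! ### Generators -/

namespace UniDiagram

section Generators

variable {n : ℕ} {A : Type*} [CommRing A] [Algebra (LaurentRing n) A]

theorem IsVertex.next_cases {M : Type} {D : UniDiagram M} {a b c : D.H} (v : D.IsVertex a b c) :
    D.next a = b ∧ D.next (D.next a) = c ∨ D.next a = c ∧ D.next (D.next a) = b := by
  obtain ⟨-, ⟨h1, h2, h3⟩ | ⟨h1, h2, h3⟩⟩ := v
  · exact Or.inl ⟨h1, by rw [h1, h2]⟩
  · exact Or.inr ⟨h1, by rw [h1, h2]⟩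

/-- A vertex that is entered along an edge between trivalent vertices has its leg elsewhere. -/
theorem exists_isVertex_leg {M : Type} {D : UniDiagram M}
    (hD : ∀ h, D.next h ≠ h → ∃ k, (k = h ∨ k = D.next h ∨ k = D.next (D.next h)) ∧
      D.next (D.opp k) = D.opp k) {h : D.H} (h₁ : D.next h ≠ h)
    (h₂ : D.next (D.opp h) ≠ D.opp h) :
    ∃ s k, D.IsVertex h s k ∧ D.next (D.opp s) = D.opp s := by
  obtain ⟨k, rfl | rfl | rfl, hk⟩ := hD h h₁
  · exact absurd hk h₂
  · exact ⟨_, _, isVertex_next h₁, hk⟩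
  · exact ⟨_, _, (isVertex_next h₁).swap, hk⟩

theorem val_mem_of_reducible {w : WeightSystem n A} {S : Subalgebra (LaurentRing n) A}
    {D : UniDiagram (Fin n)}
    (ih : ∀ E : UniDiagram (Fin n), Nat.card E.H < Nat.card D.H → w.val E ∈ S)
    (h : ∃ (E : UniDiagram (Fin n)) (x : E.H) (i j : Fin n), E.IsInner x ∧
      Nat.card E.H < Nat.card D.H ∧ Similar D (E.addTwoLegs x i j)) : w.val D ∈ S := by
  obtain ⟨E, x, i, j, hx, hc, hs⟩ := h
  rw [← Subalgebra.mem_toSubmodule, hs.mem_iff w, addTwoLegs_mem_iff w _ E x hx]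
  exact ih E hc

/-- The diagrams in the generating set determine a weight system. The induction removes a component
or applies (CL2B): every trivalent vertex has a leg by (IntV), so that the component is a path or
a cycle of trivalent vertices, and two neighbors on a long path can be removed. -/
theorem _root_.WeightSystem.val_mem [NeZero n] (w : WeightSystem n A)
    (S : Subalgebra (LaurentRing n) A) (h_strut : ∀ a b, a ≤ b → w.val (strut a b) ∈ S)
    (h_tripod : ∀ a b, 0 < a → a < b → w.val (tripod 0 a b) ∈ S)
    (h_hTree : ∀ a b, 0 < a → a ≤ b → w.val (hTree 0 0 a b) ∈ S)
    (h_wheel : w.val (wheel 0 0) ∈ S) (D : UniDiagram (Fin n)) : w.val D ∈ S := by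
  have c₁ := strut_mem (S := Subalgebra.toSubmodule S) w h_strut
  have c₂ := tripod_mem (S := Subalgebra.toSubmodule S) w h_tripod
  have c₃ := hTree_mem (S := Subalgebra.toSubmodule S) w h_hTree
  have c₄ := comb_mem (S := Subalgebra.toSubmodule S) w h_tripod
  have c₅ := wheel_mem (S := Subalgebra.toSubmodule S) w h_wheel
  suffices H : ∀ m, ∀ D : UniDiagram (Fin n), Nat.card D.H = m → w.val D ∈ S from H _ D rfl
  intro m
  induction m using Nat.strong_induction_on with
  | _ m ih' =>
  rintro D rfl
  have ih : ∀ E : UniDiagram (Fin n), Nat.card E.H < Nat.card D.H → w.val E ∈ S :=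
    fun E h => ih' _ h E rfl
  clear ih'
  rcases isEmpty_or_nonempty D.H with he | ⟨⟨h⟩⟩
  · have : D.Iso (empty (Fin n)) :=
      ⟨Equiv.equivOfIsEmpty D.H Empty, fun h => he.elim h, fun h => he.elim h,
        fun h => he.elim h⟩
    rw [w.iso this, w.empty]
    exact S.one_mem
  by_cases hD : ∀ h, D.next h ≠ h → ∃ k, (k = h ∨ k = D.next h ∨ k = D.next (D.next h)) ∧
      D.next (D.opp k) = D.opp k
  swap
  · push Not at hD
    obtain ⟨h, h1, h2⟩ := hD
    rw [w.intV D h h1 (h2 _ (Or.inl rfl)) (h2 _ (Or.inr (Or.inl rfl)))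
      (h2 _ (Or.inr (Or.inr rfl)))]
    exact S.zero_mem
  by_cases hS : ∃ u, D.next u = u ∧ D.next (D.opp u) = D.opp u
  · obtain ⟨u, h1, h2⟩ := hS
    exact val_mem_of_strut ih c₁ h1 h2
  push Not at hS
  have oo := D.opp_opp
  have one := D.opp_ne
  have inj : ∀ a b, D.opp a = D.opp b → a = b := fun a b e => by rw [← oo a, e, oo]
  by_cases h2 : ∃ a b c, D.IsVertex a b c ∧ D.next (D.opp b) = D.opp b ∧
      D.next (D.opp c) = D.opp c
  -- The vertex `p` has two legs: it is the end of a path of vertices `p`, `q`, `r`, ...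
  · obtain ⟨p₀, p₁, p₂, v, l₁, l₂⟩ := h2
    by_cases l₀ : D.next (D.opp p₀) = D.opp p₀
    · exact val_mem_of_tripod ih c₂ v l₀ l₁ l₂
    obtain ⟨q₀, hq⟩ : ∃ q₀, D.opp p₀ = q₀ := ⟨_, rfl⟩
    rw [hq] at l₀
    have hq' := opp_eq_iff.1 hq
    obtain ⟨n1, n2, n3, n4, n5, n6⟩ := v.nes
    obtain ⟨s, q₁, v', ls⟩ := exists_isVertex_leg hD l₀ (by rwa [← hq'])
    have d₁ : q₀ ≠ p₀ ∧ q₀ ≠ p₁ ∧ q₀ ≠ p₂ := by grind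
    obtain ⟨⟨d₂, d₃, d₄⟩, ⟨d₅, d₆, d₇⟩⟩ := v'.disjoint v d₁
    obtain ⟨n1', n2', n3', n4', n5', n6'⟩ := v'.nes
    by_cases lq : D.next (D.opp q₁) = D.opp q₁
    · exact val_mem_of_hTree ih c₃ v v' hq l₁ l₂ ls lq d₃ d₆
    obtain ⟨r₀, hr⟩ : ∃ r₀, D.opp q₁ = r₀ := ⟨_, rfl⟩
    rw [hr] at lq
    have hr' := opp_eq_iff.1 hr
    obtain ⟨s', r₁, v'', ls'⟩ := exists_isVertex_leg hD lq (by rwa [← hr'])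
    have e₁ : r₀ ≠ q₀ ∧ r₀ ≠ s ∧ r₀ ≠ q₁ := by grind
    have e₂ : r₀ ≠ p₀ ∧ r₀ ≠ p₁ ∧ r₀ ≠ p₂ := by grind
    obtain ⟨⟨d₂', d₃', d₄'⟩, ⟨d₅', d₆', d₇'⟩⟩ := v''.disjoint v' e₁
    obtain ⟨⟨e₂', e₃', e₄'⟩, ⟨e₅', e₆', e₇'⟩⟩ := v''.disjoint v e₂
    obtain ⟨m1, m2, m3, m4, m5, m6⟩ := v''.nes
    by_cases lr : D.next (D.opp r₁) = D.opp r₁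
    · exact val_mem_of_comb ih c₄ v v' v'' hq hr l₁ l₂ ls ls' lr d₃.symm d₄.symm d₃' d₆'
    obtain ⟨t₀, ht⟩ : ∃ t₀, D.opp r₁ = t₀ := ⟨_, rfl⟩
    rw [ht] at lr
    have ht' := opp_eq_iff.1 ht
    have f₁ : t₀ ≠ p₀ ∧ t₀ ≠ p₁ ∧ t₀ ≠ p₂ := by grind
    have f₂ := v.next_cases
    exact val_mem_of_reducible ih (exists_addTwoLegs hD v' v'' n1 lr hq hr ht ls ls'
      (by grind) (by grind) (by grind) (by grind) (by grind) (by grind))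
  -- Every vertex has exactly one leg, so that the path through `p`, `q`, `r` closes up.
  · push Not at h2
    obtain ⟨s, p₀, p₁, v, ls⟩ : ∃ s p₀ p₁, D.IsVertex s p₀ p₁ ∧ D.next (D.opp s) = D.opp s := by
      obtain ⟨k, hk⟩ : ∃ k, D.next k ≠ k := by
        by_cases hh : D.next h = h
        · exact ⟨_, hS h hh⟩
        · exact ⟨_, hh⟩
      obtain ⟨k, rfl | rfl | rfl, h3⟩ := hD k hk
      · exact ⟨_, _, _, isVertex_next hk, h3⟩
      · exact ⟨_, _, _, (isVertex_next hk).rotate, h3⟩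
      · exact ⟨_, _, _, (isVertex_next hk).rotate.rotate, h3⟩
    have l₀ := h2 _ _ _ v.rotate.rotate ls
    have l₁ := h2 _ _ _ v.rotate.swap ls
    obtain ⟨n1, n2, n3, n4, n5, n6⟩ := v.nes
    by_cases hp : D.opp p₀ = p₁
    · exact val_mem_of_lollipop ih v ls hp
    obtain ⟨q₀, hq⟩ : ∃ q₀, D.opp p₀ = q₀ := ⟨_, rfl⟩
    rw [hq] at l₀ hp
    have hq' := opp_eq_iff.1 hq
    obtain ⟨s', q₁, v', ls'⟩ := exists_isVertex_leg hD l₀ (by rwa [← hq'])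
    have d₁ : q₀ ≠ s ∧ q₀ ≠ p₀ ∧ q₀ ≠ p₁ := by grind
    obtain ⟨⟨d₂, d₃, d₄⟩, ⟨d₅, d₆, d₇⟩⟩ := v'.disjoint v d₁
    obtain ⟨n1', n2', n3', n4', n5', n6'⟩ := v'.nes
    have lq := h2 _ _ _ v' ls'
    by_cases hw : D.opp p₁ = q₁
    · exact val_mem_of_wheel ih c₅ v v'.rotate.swap hq hw ls ls' d₂
    obtain ⟨r₀, hr⟩ : ∃ r₀, D.opp q₁ = r₀ := ⟨_, rfl⟩
    rw [hr] at lq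
    have hr' := opp_eq_iff.1 hr
    obtain ⟨s'', r₁, v'', ls''⟩ := exists_isVertex_leg hD lq (by rwa [← hr'])
    have e₁ : r₀ ≠ q₀ ∧ r₀ ≠ s' ∧ r₀ ≠ q₁ := by grind
    have e₂ : r₀ ≠ s ∧ r₀ ≠ p₀ ∧ r₀ ≠ p₁ := by grind
    obtain ⟨⟨d₂', d₃', d₄'⟩, ⟨d₅', d₆', d₇'⟩⟩ := v''.disjoint v' e₁
    obtain ⟨⟨e₂', e₃', e₄'⟩, ⟨e₅', e₆', e₇'⟩⟩ := v''.disjoint v e₂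
    obtain ⟨m1, m2, m3, m4, m5, m6⟩ := v''.nes
    have lr := h2 _ _ _ v'' ls''
    obtain ⟨t₀, ht⟩ : ∃ t₀, D.opp r₁ = t₀ := ⟨_, rfl⟩
    rw [ht] at lr
    have ht' := opp_eq_iff.1 ht
    by_cases hw₃ : t₀ = p₁
    · exact val_mem_of_wheel₃ ih v v'.rotate.swap v''.rotate.swap hq hr (ht.trans hw₃) ls ls' ls''
        d₂.symm d₃'
    have f₂ := v.rotate.next_cases
    exact val_mem_of_reducible ih (exists_addTwoLegs hD v' v'' n2 lr hq hr ht ls' ls''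
      (by grind) (by grind) (by grind) (by grind) (by grind) (by grind))

end Generators

end UniDiagram

/-! ### Color systems -/

/-- Data for a state sum with colors `ι`: every half-edge receives a color, and the two halves of
an edge receive colors exchanged by the involution `bar`. The colors index a basis of a metric Lie
algebra in which the basis vectors of `a` and `bar a` are dual to each other; the basis vector of
`bar root` acts on the other ones by the scalars `κ`, and the basis vector of `root` is central. -/
structure ColorSystem (ι R : Type*) [CommRing R] where
  bar : ι → ι
  root : ι
  κ : ι → R
  bar_bar : ∀ a, bar (bar a) = a
  bar_root_ne : bar root ≠ root
  κ_root : κ root = 0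
  κ_bar : ∀ a, κ (bar a) = -κ a
  κ_cases : ∀ a, κ a = 0 ∨ κ a = 1 ∨ κ a = -1

namespace ColorSystem

open Classical in
/-- The indicator of `root`. -/
noncomputable def rootInd {ι R : Type*} [CommRing R] (C : ColorSystem ι R) (a : ι) : R :=
  if a = C.root then 1 else 0

open Classical in
/-- The alternating form `⟨e_a, κ e_b⟩`, where `κ` stands for the diagonal operator. -/
noncomputable def form {ι R : Type*} [CommRing R] (C : ColorSystem ι R) (a b : ι) : R :=
  if a = C.bar b then C.κ b else 0

/-- The weight of a trivalent vertex whose half-edges have the colors `a`, `b`, `c`: the structure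
constants of the Lie algebra. It is nonzero only if `root` is one of the colors. -/
noncomputable def vertex {ι R : Type*} [CommRing R] (C : ColorSystem ι R) (a b c : ι) : R :=
  C.rootInd a * C.form b c + C.rootInd b * C.form c a + C.rootInd c * C.form a b

section

variable {ι R : Type*} [CommRing R] (C : ColorSystem ι R)

theorem bar_eq_iff {a b : ι} : C.bar a = b ↔ a = C.bar b :=
  ⟨fun h => by rw [← h, C.bar_bar], fun h => by rw [h, C.bar_bar]⟩

/-- The involution `bar` as a permutation. -/
def barEquiv : Equiv.Perm ι := ⟨C.bar, C.bar, C.bar_bar, C.bar_bar⟩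

@[simp] theorem barEquiv_apply (a : ι) : C.barEquiv a = C.bar a := rfl

theorem κ_cube (a : ι) : C.κ a * C.κ a * C.κ a = C.κ a := by
  rcases C.κ_cases a with h | h | h <;> rw [h] <;> ring

theorem κ_bar_root : C.κ (C.bar C.root) = 0 := by
  rw [C.κ_bar, C.κ_root, neg_zero]

@[simp] theorem rootInd_root : C.rootInd C.root = 1 := by simp [rootInd]

@[simp] theorem rootInd_bar_root : C.rootInd (C.bar C.root) = 0 := by
  simp [rootInd, C.bar_root_ne]

theorem rootInd_of_ne {a : ι} (h : a ≠ C.root) : C.rootInd a = 0 := by simp [rootInd, h]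

theorem form_swap (a b : ι) : C.form b a = -C.form a b := by
  by_cases h : a = C.bar b
  · simp [form, h, C.bar_bar, C.κ_bar]
  · have h' : b ≠ C.bar a := fun e => h (C.bar_eq_iff.1 e.symm)
    simp [form, h, h']

@[simp] theorem form_root_right (a : ι) : C.form a C.root = 0 := by
  simp [form, C.κ_root]

@[simp] theorem form_bar_root_right (a : ι) : C.form a (C.bar C.root) = 0 := by
  simp [form, C.κ_bar_root]

@[simp] theorem form_root_left (a : ι) : C.form C.root a = 0 := by
  rw [form_swap, form_root_right, neg_zero]

@[simp] theorem form_bar_root_left (a : ι) : C.form (C.bar C.root) a = 0 := by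
  rw [form_swap, form_bar_root_right, neg_zero]

theorem vertex_rotate (a b c : ι) : C.vertex b c a = C.vertex a b c := by
  simp only [vertex]
  ring

theorem vertex_swap (a b c : ι) : C.vertex a c b = -C.vertex a b c := by
  simp only [vertex]
  rw [C.form_swap b c, C.form_swap a b, C.form_swap c a]
  ring

@[simp] theorem vertex_bar_root (b c : ι) : C.vertex (C.bar C.root) b c = 0 := by
  simp [vertex]

theorem vertex_eq_zero {a b c : ι} (ha : a ≠ C.root) (hb : b ≠ C.root) (hc : c ≠ C.root) :
    C.vertex a b c = 0 := by
  simp [vertex, C.rootInd_of_ne ha, C.rootInd_of_ne hb, C.rootInd_of_ne hc]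

theorem vertex_eq_zero_of_κ {a : ι} (ha : a ≠ C.root) (hκ : C.κ a = 0) (b c : ι) :
    C.vertex a b c = 0 := by
  have h1 : ∀ b, C.form b a = 0 := by simp [form, hκ]
  have h2 : ∀ b, C.form a b = 0 := fun b => by rw [C.form_swap, h1, neg_zero]
  simp [vertex, C.rootInd_of_ne ha, h1, h2]

theorem form_cube (a b : ι) : C.form a b * C.form a b * C.form a b = C.form a b := by
  simp only [form]
  split_ifs
  · exact C.κ_cube b
  · simp

/-- The structure constants are `0`, `1` or `-1`. -/
theorem vertex_cube (a b c : ι) :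
    C.vertex a b c * C.vertex a b c * C.vertex a b c = C.vertex a b c := by
  by_cases ha : a = C.root
  · simp [vertex, ha, C.form_cube]
  by_cases hb : b = C.root
  · simp [vertex, hb, C.form_cube]
  by_cases hc : c = C.root
  · simp [vertex, hc, C.form_cube]
  simp [C.vertex_eq_zero ha hb hc]

variable [Fintype ι]

/-- The symmetric form `⟨κ e_a, κ e_b⟩`. -/
noncomputable def form₂ (a b : ι) : R := ∑ e, C.form a e * C.form b (C.bar e)

theorem form₂_comm (a b : ι) : C.form₂ a b = C.form₂ b a := by
  rw [form₂, ← Equiv.sum_comp C.barEquiv]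
  exact Finset.sum_congr rfl fun e _ => by rw [barEquiv_apply, C.bar_bar, mul_comm]

theorem sum_vertex_mul (a b c d : ι) :
    ∑ e, C.vertex e a b * C.vertex (C.bar e) c d =
      C.rootInd a * C.rootInd c * C.form₂ b d - C.rootInd a * C.rootInd d * C.form₂ b c -
      C.rootInd b * C.rootInd c * C.form₂ a d + C.rootInd b * C.rootInd d * C.form₂ a c := by
  simp only [form₂, Finset.mul_sum, ← Finset.sum_add_distrib, ← Finset.sum_sub_distrib]
  refine Finset.sum_congr rfl fun e _ => ?_
  by_cases h1 : e = C.root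
  · subst h1
    simp [vertex]
  by_cases h2 : C.bar e = C.root
  · rw [C.bar_eq_iff] at h2
    simp [vertex, h2, C.bar_bar]
  simp only [vertex, C.rootInd_of_ne h1, C.rootInd_of_ne h2]
  rw [C.form_swap a e, C.form_swap c (C.bar e)]
  ring

/-- The Jacobi identity for the structure constants. -/
theorem jacobi (a b c d : ι) :
    ∑ e, (C.vertex e a b * C.vertex (C.bar e) c d + C.vertex e b c * C.vertex (C.bar e) a d +
      C.vertex e c a * C.vertex (C.bar e) b d) = 0 := by
  rw [Finset.sum_add_distrib, Finset.sum_add_distrib, sum_vertex_mul, sum_vertex_mul,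
    sum_vertex_mul, C.form₂_comm c b, C.form₂_comm c a, C.form₂_comm b a]
  ring

end

end ColorSystem

namespace UniDiagram

open Classical in
/-- A sum over functions vanishes if the partial sums over their values at `x` and `y` vanish. -/
theorem sum_eq_zero_of_update {H ι R : Type*} [Fintype H] [Fintype ι] [Nonempty ι] [CommRing R]
    [IsDomain R] [CharZero R] (Φ : (H → ι) → R) (x y : H)
    (h : ∀ σ : H → ι, ∑ e, ∑ e', Φ (Function.update (Function.update σ x e) y e') = 0) :
    ∑ σ, Φ σ = 0 := by
  have key : ∀ (Ψ : (H → ι) → R) (z : H),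
      ∑ σ, ∑ e, Ψ (Function.update σ z e) = (Fintype.card ι : R) * ∑ σ, Ψ σ := by
    intro Ψ z
    -- Exchange the value at `z` with the additional value.
    let s : (H → ι) × ι → (H → ι) × ι := fun p => (Function.update p.1 z p.2, p.1 z)
    have hs : Function.Involutive s := by
      rintro ⟨σ, e⟩
      simp [s]
    rw [← Fintype.sum_prod_type' (fun σ e => Ψ (Function.update σ z e)),
      ← Equiv.sum_comp hs.toPerm]
    simp [s, Fintype.sum_prod_type, Finset.mul_sum]
  have h1 := key Φ y
  have h2 := key (fun σ => ∑ e', Φ (Function.update σ y e')) x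
  rw [h1] at h2
  simp only [h, Finset.sum_const_zero] at h2
  have hc : (Fintype.card ι : R) ≠ 0 := Nat.cast_ne_zero.2 Fintype.card_ne_zero
  exact (mul_eq_zero.1 ((mul_eq_zero.1 h2.symm).resolve_left hc)).resolve_left hc

end UniDiagram

/-! ### State sums -/

namespace UniDiagram

section StateSum

variable {ι R : Type*} [CommRing R]

noncomputable instance instFintypeH {M : Type} (D : UniDiagram M) : Fintype D.H :=
  @Fintype.ofFinite _ D.finite_H

/-- The weight at the half-edge `h`, for colors `σ`. The weight of a trivalent vertex is counted at
each of its three half-edges, which is harmless by `ColorSystem.vertex_cube`. -/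
noncomputable def weight {M : Type} (C : ColorSystem ι R) (v : M → ι → R) (D : UniDiagram M)
    (σ : D.H → ι) (h : D.H) : R :=
  (D.label h).elim (C.vertex (σ h) (σ (D.next h)) (σ (D.next (D.next h)))) (fun i => v i (σ h))

open Classical in
/-- The sum over all colorings of the product of the weights, where a univalent vertex labeled `i`
has the weight `v i`. The two halves of an edge have colors exchanged by `bar`. -/
noncomputable def stateSum {M : Type} [Fintype ι] (C : ColorSystem ι R) (v : M → ι → R)
    (D : UniDiagram M) : R :=
  ∑ σ : D.H → ι, if ∀ h, σ (D.opp h) = C.bar (σ h) then ∏ h, D.weight C v σ h else 0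

end StateSum

section Basic

variable {M : Type} {ι R : Type*} [CommRing R] {C : ColorSystem ι R} {v : M → ι → R}

theorem weight_of_next_ne {D : UniDiagram M} {σ : D.H → ι} {h : D.H} (hh : D.next h ≠ h) :
    D.weight C v σ h = C.vertex (σ h) (σ (D.next h)) (σ (D.next (D.next h))) := by
  simp [weight, (D.label_eq_none_iff h).2 hh]

/-- Each of two vertices contributes the weights at its three half-edges, but only once. -/
theorem prod_vertex {H : Type*} [DecidableEq H] (p : H → R) {σ : H → ι} {x a b y c d : H}
    (hnd : [x, a, b, y, c, d].Nodup)
    (hx : p x = C.vertex (σ x) (σ a) (σ b)) (ha : p a = C.vertex (σ a) (σ b) (σ x))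
    (hb : p b = C.vertex (σ b) (σ x) (σ a)) (hy : p y = C.vertex (σ y) (σ c) (σ d))
    (hc : p c = C.vertex (σ c) (σ d) (σ y)) (hd : p d = C.vertex (σ d) (σ y) (σ c)) :
    ∏ h ∈ [x, a, b, y, c, d].toFinset, p h =
      C.vertex (σ x) (σ a) (σ b) * C.vertex (σ y) (σ c) (σ d) := by
  rw [List.prod_toFinset _ hnd]
  simp only [List.map_cons, List.map_nil, List.prod_cons, List.prod_nil, mul_one, hx, ha, hb, hy,
    hc, hd]
  rw [C.vertex_rotate (σ x) (σ a) (σ b), ← C.vertex_rotate (σ b) (σ x) (σ a),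
    C.vertex_rotate (σ y) (σ c) (σ d), ← C.vertex_rotate (σ d) (σ y) (σ c)]
  linear_combination C.vertex (σ x) (σ a) (σ b) * C.vertex_cube (σ y) (σ c) (σ d) +
    C.vertex (σ y) (σ c) (σ d) * C.vertex (σ y) (σ c) (σ d) * C.vertex (σ y) (σ c) (σ d) *
      C.vertex_cube (σ x) (σ a) (σ b)

variable [Fintype ι]

open Classical in
theorem stateSum_of_equiv {D F : UniDiagram M} (e : D.H ≃ F.H)
    (he : ∀ k, F.opp (e k) = e (D.opp k)) :
    F.stateSum C v = ∑ σ : D.H → ι, if ∀ h, σ (D.opp h) = C.bar (σ h)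
      then ∏ h, F.weight C v (σ ∘ e.symm) (e h) else 0 := by
  rw [stateSum, ← Equiv.sum_comp (e.arrowCongr (Equiv.refl ι))]
  refine Finset.sum_congr rfl fun σ _ => ?_
  congr 1
  · rw [e.forall_congr_left]
    refine propext (forall_congr' fun h => ?_)
    obtain ⟨k, rfl⟩ := e.surjective h
    simp [Equiv.arrowCongr, he]
  · rw [← Equiv.prod_comp e]
    rfl

theorem stateSum_iso {D F : UniDiagram M} (h : D.Iso F) : D.stateSum C v = F.stateSum C v := by
  classical
  obtain ⟨e, h1, h2, h3⟩ := h
  rw [stateSum_of_equiv e (fun k => (h1 k).symm), stateSum]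
  refine Finset.sum_congr rfl fun σ _ => ?_
  congr 1
  refine Finset.prod_congr rfl fun k _ => ?_
  simp [weight, ← h2, h3]

theorem stateSum_empty : (empty M).stateSum C v = 1 := by
  classical
  have : IsEmpty (empty M).H := inferInstanceAs (IsEmpty Empty)
  rw [stateSum, Finset.sum_eq_single (fun h => isEmptyElim h)]
  · simp
  · exact fun b _ hb => absurd (Subsingleton.elim _ _) hb
  · exact fun h => (h (@Finset.mem_univ _ (_) _)).elim

theorem stateSum_union (D E : UniDiagram M) :
    (D.union E).stateSum C v = D.stateSum C v * E.stateSum C v := by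
  classical
  let e : (D.H → ι) × (E.H → ι) ≃ ((D.union E).H → ι) := (Equiv.sumArrowEquivProdArrow _ _ _).symm
  rw [stateSum, stateSum, stateSum, Finset.sum_mul_sum, ← Fintype.sum_prod_type',
    ← Equiv.sum_comp e]
  refine Finset.sum_congr rfl fun p _ => ?_
  rw [ite_zero_mul_ite_zero]
  congr 1
  · refine propext ⟨fun h => ⟨fun k => h (Sum.inl k), fun k => h (Sum.inr k)⟩, ?_⟩
    rintro ⟨h1, h2⟩ (k | k)
    exacts [h1 k, h2 k]
  · let s : D.H ⊕ E.H ≃ (D.union E).H := Equiv.refl _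
    rw [← Equiv.prod_comp s, Fintype.prod_sum_type]
    rfl

theorem stateSum_flip (D : UniDiagram M) (h : D.H) (hh : D.next h ≠ h) :
    (D.flip h hh).stateSum C v = -D.stateSum C v := by
  classical
  obtain ⟨f1, f2, f3, f4⟩ := D.flip_next h hh
  have t2 := D.next_ne hh
  have t3 := D.next_next_ne hh
  have n3 := D.next_next_next h
  have hi := D.next_injective
  let e : D.H ≃ (D.flip h hh).H := Equiv.refl _
  rw [stateSum_of_equiv e (fun _ => rfl), stateSum, ← Finset.sum_neg_distrib]
  refine Finset.sum_congr rfl fun σ _ => ?_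
  rw [apply_ite Neg.neg, neg_zero]
  congr 1
  have h1 : ∀ k, (D.flip h hh).weight C v (σ ∘ e.symm) (e k) =
      (if k ∈ ({h, D.next h, D.next (D.next h)} : Finset D.H) then -1 else 1) *
        D.weight C v σ k := by
    intro k
    have e1 : ∀ k, (e.symm (D.flip h hh |>.next (e k))) = (D.flip h hh).next k := fun _ => rfl
    have l1 : ∀ k, (D.flip h hh).label (e k) = D.label k := fun _ => rfl
    have a1 := (D.label_eq_none_iff _).2 hh
    have a2 := (D.label_eq_none_iff _).2 t2
    have a3 := (D.label_eq_none_iff _).2 (D.next_ne t2)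
    have w1 : ∀ k, (D.flip h hh).weight C v (σ ∘ e.symm) (e k) =
        (D.label k).elim (C.vertex (σ k) (σ ((D.flip h hh).next k))
          (σ ((D.flip h hh).next ((D.flip h hh).next k)))) (fun i => v i (σ k)) := fun _ => rfl
    by_cases hk : k = h ∨ k = D.next h ∨ k = D.next (D.next h)
    · rw [w1]
      rcases hk with rfl | rfl | rfl
      · rw [f1, f3]
        simpa [weight, a1] using C.vertex_swap _ _ _
      · rw [f2, f1]
        simpa [weight, a2, n3] using C.vertex_swap _ _ _
      · rw [f3, f2]
        simpa [weight, a3, n3] using C.vertex_swap _ _ _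
    · rw [w1]
      push Not at hk
      rw [f4 k hk.1 hk.2.1 hk.2.2, f4 (D.next k) (fun c => hk.2.2 (hi (c.trans n3.symm)))
        (fun c => hk.1 (hi c)) (fun c => hk.2.1 (hi c))]
      simp [weight, hk]
  rw [Finset.prod_congr rfl fun k _ => h1 k, Finset.prod_mul_distrib, Finset.prod_ite_mem,
    Finset.univ_inter, Finset.prod_const, Finset.card_eq_three.2
      ⟨h, D.next h, D.next (D.next h), hh.symm, t3.symm, t2.symm, rfl⟩]
  simp [pow_succ]

/-- If the weight of a vertex is nonzero, then one of its three half-edges has the color `root`; the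
opposite half-edge then has the color `bar root`, which cannot occur at a trivalent vertex. -/
theorem stateSum_intV (D : UniDiagram M) (h : D.H) (hh : D.next h ≠ h)
    (h0 : D.next (D.opp h) ≠ D.opp h) (h1 : D.next (D.opp (D.next h)) ≠ D.opp (D.next h))
    (h2 : D.next (D.opp (D.next (D.next h))) ≠ D.opp (D.next (D.next h))) :
    D.stateSum C v = 0 := by
  classical
  rw [stateSum]
  refine Finset.sum_eq_zero fun σ _ => ?_
  split_ifs with hσ
  swap
  · rfl
  have key : ∀ k, D.next (D.opp k) ≠ D.opp k → σ k = C.root → ∏ h, D.weight C v σ h = 0 :=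
    fun k hk hr => by
      refine Finset.prod_eq_zero (Finset.mem_univ (D.opp k)) ?_
      rw [weight_of_next_ne hk, hσ, hr, C.vertex_bar_root]
  by_cases r0 : σ h = C.root
  · exact key _ h0 r0
  by_cases r1 : σ (D.next h) = C.root
  · exact key _ h1 r1
  by_cases r2 : σ (D.next (D.next h)) = C.root
  · exact key _ h2 r2
  refine Finset.prod_eq_zero (Finset.mem_univ h) ?_
  rw [weight_of_next_ne hh, C.vertex_eq_zero r0 r1 r2]

open Classical in
/-- The state sums of the three terms of (IHX) as sums over the colorings of the same diagram. The
list `L` contains the half-edges at the two vertices in an order that does not depend on the term.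
-/
theorem stateSum_rewired {D F : UniDiagram M} {f : D.H ≃ F.H} {x a b y c d : D.H} {L : List D.H}
    (h : Rewired D F f x a b y c d) (hnd : [x, a, b, y, c, d].Nodup)
    (hL : [x, a, b, y, c, d].toFinset = L.toFinset)
    (hn : ∀ k, k ∉ L → D.next k ∉ L) :
    F.stateSum C v = ∑ σ : D.H → ι, if ∀ h, σ (D.opp h) = C.bar (σ h)
      then C.vertex (σ x) (σ a) (σ b) * C.vertex (σ y) (σ c) (σ d) *
        ∏ h ∈ L.toFinsetᶜ, D.weight C v σ h else 0 := by
  rw [stateSum_of_equiv f h.opp]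
  refine Finset.sum_congr rfl fun σ _ => ?_
  congr 1
  have hL' : ∀ k, k ∉ L ↔ k ∉ [x, a, b, y, c, d] := by
    intro k
    rw [← List.mem_toFinset, ← hL, List.mem_toFinset]
  have l : ∀ k k' : D.H, F.next (f k) = f k' → k' ≠ k → F.label (f k) = none := fun k k' e ne => by
    rw [label_eq_none_iff, e]
    exact f.injective.ne ne
  have hnd' := hnd
  simp only [List.nodup_cons, List.mem_cons, List.not_mem_nil, or_false, not_or,
    List.nodup_nil, not_false_eq_true, and_true] at hnd'
  obtain ⟨⟨xa, xb, -⟩, ⟨ab, -⟩, -, ⟨yc, yd⟩, cd⟩ := hnd'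
  have lx := l _ _ h.next_x (Ne.symm xa)
  have la := l _ _ h.next_a (Ne.symm ab)
  have lb := l _ _ h.next_b xb
  have ly := l _ _ h.next_y (Ne.symm yc)
  have lc := l _ _ h.next_c (Ne.symm cd)
  have ld := l _ _ h.next_d yd
  rw [← Finset.prod_mul_prod_compl L.toFinset]
  congr 1
  · rw [← hL]
    refine prod_vertex _ hnd ?_ ?_ ?_ ?_ ?_ ?_
    · simp [weight, lx, h.next_x, h.next_a]
    · simp [weight, la, h.next_a, h.next_b]
    · simp [weight, lb, h.next_b, h.next_x]
    · simp [weight, ly, h.next_y, h.next_c]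
    · simp [weight, lc, h.next_c, h.next_d]
    · simp [weight, ld, h.next_d, h.next_y]
  · refine Finset.prod_congr rfl fun k hk => ?_
    simp only [Finset.mem_compl, List.mem_toFinset] at hk
    have hk1 := h.next_other k ((hL' k).1 hk)
    have hk2 := h.next_other _ ((hL' _).1 (hn k hk))
    simp [weight, hk1, hk2, h.label]

theorem rewired_refl (D : UniDiagram M) (x y : D.H) :
    Rewired D D (Equiv.refl _) x (D.next x) (D.next (D.next x)) y (D.next y) (D.next (D.next y)) :=
  ⟨fun _ => rfl, fun _ => rfl, rfl, rfl, D.next_next_next x, rfl, rfl, D.next_next_next y,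
    fun _ _ => rfl⟩

/-- The sum over the colors of the inner edge is taken first: it is the Jacobi identity. -/
theorem stateSum_ihx [IsDomain R] [CharZero R] (D : UniDiagram M) (x : D.H) (hx : D.IsInner x) :
    D.stateSum C v + (D.rot₁ x hx).stateSum C v + (D.rot₂ x hx).stateSum C v = 0 := by
  classical
  have hnd := hx.facts
  have hn := fun k => D.next_notMem x (D.opp x) (k := k)
  rw [stateSum_rewired (D.rewired_refl x (D.opp x)) hnd rfl hn,
    stateSum_rewired (D.rewired_rot₁ x hx) (by grind) (by ext; simp; grind) hn,
    stateSum_rewired (D.rewired_rot₂ x hx) (by grind) (by ext; simp; grind) hn,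
    ← Finset.sum_add_distrib, ← Finset.sum_add_distrib]
  have : Nonempty ι := ⟨C.root⟩
  refine sum_eq_zero_of_update _ x (D.opp x) fun σ => ?_
  set a := D.next x with ha
  set b := D.next a with hb
  set y := D.opp x with hy
  set c := D.next y with hc
  set d := D.next c with hd
  have hxy : D.opp y = x := D.opp_opp x
  set P := ∏ h ∈ [x, a, b, y, c, d].toFinsetᶜ, D.weight C v σ h with hP
  have hnd' := hnd
  simp only [List.nodup_cons, List.mem_cons, List.not_mem_nil, or_false, not_or,
    List.nodup_nil, not_false_eq_true, and_true] at hnd'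
  have key : ∀ e e', (∀ h, Function.update (Function.update σ x e) y e' (D.opp h) =
      C.bar (Function.update (Function.update σ x e) y e' h)) ↔
      e' = C.bar e ∧ ∀ h, h ≠ x → h ≠ y → σ (D.opp h) = C.bar (σ h) := by
    intro e e'
    constructor
    · intro h
      refine ⟨by simpa [← hy, hnd'.1.2.2.1] using h x, fun k h1 h2 => ?_⟩
      have k1 : D.opp k ≠ x := fun e => h2 (by rw [hy, ← e, D.opp_opp])
      have k2 : D.opp k ≠ y := fun e => h1 (by rw [← hxy, ← e, D.opp_opp])
      simpa [h1, h2, k1, k2] using h k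
    · rintro ⟨rfl, h⟩ k
      by_cases h1 : k = x
      · simp [h1, ← hy, hnd'.1.2.2.1]
      by_cases h2 : k = y
      · simp [h2, hxy, hnd'.1.2.2.1, C.bar_bar]
      have k1 : D.opp k ≠ x := fun e => h2 (by rw [hy, ← e, D.opp_opp])
      have k2 : D.opp k ≠ y := fun e => h1 (by rw [← hxy, ← e, D.opp_opp])
      simpa [h1, h2, k1, k2] using h k h1 h2
  have hP' : ∀ e e', ∏ h ∈ [x, a, b, y, c, d].toFinsetᶜ,
      D.weight C v (Function.update (Function.update σ x e) y e') h = P := by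
    intro e e'
    refine Finset.prod_congr rfl fun k hk => ?_
    simp only [Finset.mem_compl, List.mem_toFinset] at hk
    have hk1 := hn k hk
    have hk2 := hn _ hk1
    have hσ : ∀ k, k ∉ [x, a, b, y, c, d] →
        Function.update (Function.update σ x e) y e' k = σ k := by
      intro k hk
      rw [Function.update_of_ne (by grind), Function.update_of_ne (by grind)]
    simp only [weight]
    rw [hσ _ hk, hσ _ hk1, hσ _ hk2]
  have hσ : ∀ e e' k, k ≠ x → k ≠ y →
      Function.update (Function.update σ x e) y e' k = σ k := by
    intro e e' k h1 h2
    rw [Function.update_of_ne h2, Function.update_of_ne h1]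
  have sx : ∀ e e', Function.update (Function.update σ x e) y e' x = e := by
    intro e e'
    rw [Function.update_of_ne hnd'.1.2.2.1, Function.update_self]
  have sy : ∀ e e', Function.update (Function.update σ x e) y e' y = e' := by
    intro e e'
    rw [Function.update_self]
  have sa := fun e e' => hσ e e' a (by grind) (by grind)
  have sb := fun e e' => hσ e e' b (by grind) (by grind)
  have sc := fun e e' => hσ e e' c (by grind) (by grind)
  have sd := fun e e' => hσ e e' d (by grind) (by grind)
  by_cases ho : ∀ h, h ≠ x → h ≠ y → σ (D.opp h) = C.bar (σ h)
  · have J := congrArg (fun r => r * P) (C.jacobi (σ a) (σ b) (σ c) (σ d))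
    simp only [Finset.sum_mul, zero_mul, add_mul] at J
    refine Eq.trans ?_ J
    refine Finset.sum_congr rfl fun e _ => ?_
    rw [Finset.sum_eq_single (C.bar e)]
    · rw [if_pos ((key _ _).2 ⟨rfl, ho⟩), if_pos ((key _ _).2 ⟨rfl, ho⟩),
        if_pos ((key _ _).2 ⟨rfl, ho⟩), hP', sx, sy, sa, sb, sc, sd]
    · intro e' _ he'
      rw [if_neg fun h => he' ((key _ _).1 h).1, if_neg fun h => he' ((key _ _).1 h).1,
        if_neg fun h => he' ((key _ _).1 h).1, add_zero, add_zero]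
    · exact fun h => absurd (Finset.mem_univ _) h
  · refine Finset.sum_eq_zero fun e _ => Finset.sum_eq_zero fun e' _ => ?_
    rw [if_neg fun h => ho ((key _ _).1 h).2, if_neg fun h => ho ((key _ _).1 h).2,
      if_neg fun h => ho ((key _ _).1 h).2, add_zero, add_zero]

end Basic

end UniDiagram

/-! ### State sums of diagrams cut at an edge -/

namespace UniDiagram

/-- A function on the four half-edges of a leg, by its values. -/
def legValues {ι : Type*} (b f s l : ι) : LegPart → ι
  | .back => b
  | .fwd => f
  | .stem => s
  | .leaf => l

theorem sum_legValues {ι R : Type*} [Fintype ι] [AddCommMonoid R] [Fintype (LegPart → ι)]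
    (Ψ : (LegPart → ι) → R) :
    ∑ ρ, Ψ ρ = ∑ b, ∑ f, ∑ s, ∑ l, Ψ (legValues b f s l) := by
  let e : (LegPart → ι) ≃ ι × ι × ι × ι :=
    { toFun := fun ρ => (ρ .back, ρ .fwd, ρ .stem, ρ .leaf)
      invFun := fun p => legValues p.1 p.2.1 p.2.2.1 p.2.2.2
      left_inv := fun ρ => by
        funext p
        rcases p with _ | _ | _ | _ <;> rfl
      right_inv := fun _ => rfl }
  rw [← Equiv.sum_comp e.symm]
  simp only [Fintype.sum_prod_type]
  rfl

theorem sum_addLeg {M : Type} {ι R : Type*} [Fintype ι] [AddCommMonoid R] {D : UniDiagram M}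
    {x : D.H} {i : M} [Fintype ((D.addLeg x i).H → ι)] [Fintype (D.H → ι)]
    (Ψ : ((D.addLeg x i).H → ι) → R) :
    ∑ ρ, Ψ ρ = ∑ σ : D.H → ι, ∑ b, ∑ f, ∑ s, ∑ l, Ψ (addLegElim σ (legValues b f s l)) := by
  classical
  let e : (D.H → ι) × (LegPart → ι) ≃ ((D.addLeg x i).H → ι) :=
    (Equiv.sumArrowEquivProdArrow _ _ _).symm
  rw [← Equiv.sum_comp e, Fintype.sum_prod_type]
  refine Finset.sum_congr rfl fun σ _ => ?_
  rw [sum_legValues]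
  rfl

section OpenSum

variable {M : Type} {ι R : Type*} [Fintype ι] [CommRing R]

open Classical in
/-- The state sum for a diagram that is cut at the edge of `x`, with the color `a` at `x` and the
color `b` at `opp x`. -/
noncomputable def openSum (C : ColorSystem ι R) (v : M → ι → R) (D : UniDiagram M) (x : D.H)
    (a b : ι) : R :=
  ∑ σ : D.H → ι, if σ x = a ∧ σ (D.opp x) = b ∧
    ∀ h, h ≠ x → h ≠ D.opp x → σ (D.opp h) = C.bar (σ h) then ∏ h, D.weight C v σ h else 0

variable {C : ColorSystem ι R} {v : M → ι → R}

theorem stateSum_eq_sum_openSum (D : UniDiagram M) (x : D.H) :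
    D.stateSum C v = ∑ a, D.openSum C v x a (C.bar a) := by
  classical
  simp only [openSum, stateSum]
  rw [Finset.sum_comm]
  refine Finset.sum_congr rfl fun σ _ => ?_
  rw [Finset.sum_eq_single (σ x) (fun a _ ha => if_neg fun h => ha h.1.symm)
    (fun h => absurd (Finset.mem_univ _) h)]
  congr 1
  refine propext ⟨fun h => ⟨rfl, h x, fun k _ _ => h k⟩, ?_⟩
  rintro ⟨-, h1, h2⟩ k
  by_cases k1 : k = x
  · rw [k1, h1]
  by_cases k2 : k = D.opp x
  · rw [k2, h1, D.opp_opp, C.bar_bar]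
  exact h2 k k1 k2

/-- A half-edge at a trivalent vertex cannot have a color that makes all vertices zero, such as
`bar root`. -/
theorem openSum_left_eq_zero (D : UniDiagram M) {x : D.H} (hx : D.next x ≠ x) {a : ι}
    (ha : ∀ b c, C.vertex a b c = 0) (b : ι) : D.openSum C v x a b = 0 := by
  classical
  refine Finset.sum_eq_zero fun σ _ => ?_
  split_ifs with h
  · refine Finset.prod_eq_zero (Finset.mem_univ x) ?_
    rw [weight_of_next_ne hx, h.1, ha]
  · rfl

theorem openSum_right_eq_zero (D : UniDiagram M) {x : D.H} (hx : D.next (D.opp x) ≠ D.opp x)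
    {b : ι} (hb : ∀ a c, C.vertex b a c = 0) (a : ι) : D.openSum C v x a b = 0 := by
  classical
  refine Finset.sum_eq_zero fun σ _ => ?_
  split_ifs with h
  · refine Finset.prod_eq_zero (Finset.mem_univ (D.opp x)) ?_
    rw [weight_of_next_ne hx, h.2.1, hb]
  · rfl

/-- An additional leg acts on the color at one side of the cut. -/
theorem openSum_addLeg (D : UniDiagram M) (x : D.H) (i : M) (a b : ι) :
    (D.addLeg x i).openSum C v (new .fwd) a b =
      ∑ c, ∑ s, C.vertex a s (C.bar c) * v i (C.bar s) * D.openSum C v x c b := by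
  classical
  have cond : ∀ (σ : D.H → ι) (bb f s l : ι),
      (addLegElim (x := x) (i := i) σ (legValues bb f s l) (new .fwd) = a ∧
        addLegElim (x := x) (i := i) σ (legValues bb f s l)
          ((D.addLeg x i).opp (new .fwd)) = b ∧
        ∀ h, h ≠ new .fwd → h ≠ (D.addLeg x i).opp (new .fwd) →
          addLegElim (x := x) (i := i) σ (legValues bb f s l) ((D.addLeg x i).opp h) =
            C.bar (addLegElim (x := x) (i := i) σ (legValues bb f s l) h)) ↔
      bb = C.bar (σ x) ∧ f = a ∧ l = C.bar s ∧ (σ (D.opp x) = b ∧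
        ∀ h, h ≠ x → h ≠ D.opp x → σ (D.opp h) = C.bar (σ h)) := by
    intro σ bb f s l
    constructor
    · rintro ⟨h1, h2, h3⟩
      refine ⟨?_, h1, ?_, h2, fun h k1 k2 => ?_⟩
      · simpa [legValues] using h3 (old x) (by simp) (by simp [(D.opp_ne x).symm])
      · simpa [legValues] using h3 (new .stem) (by simp) (by simp)
      · simpa [opp_old_of_ne k1 k2] using h3 (old h) (by simp) (by simp [k2])
    · rintro ⟨rfl, rfl, rfl, h2, h3⟩
      refine ⟨rfl, h2, addLeg_ind (fun h => ?_) ?_ ?_ ?_ ?_⟩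
      · intro _ k2
        by_cases k1 : h = x
        · simp [k1, legValues]
        · have k2' : h ≠ D.opp x := fun e => k2 (by simp [e])
          simpa [opp_old_of_ne k1 k2'] using h3 h k1 k2'
      all_goals simp [legValues, C.bar_bar]
  have hw : ∀ (σ : D.H → ι) (bb f s l : ι),
      ∏ h, (D.addLeg x i).weight C v (addLegElim σ (legValues bb f s l)) h =
        (C.vertex f s bb * v i l) * ∏ h, D.weight C v σ h := by
    intro σ bb f s l
    have h1 : ∀ h, (D.addLeg x i).weight C v (addLegElim σ (legValues bb f s l)) (old h) =
        D.weight C v σ h := fun h => by simp [weight]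
    rw [prod_addLeg, Finset.prod_congr rfl fun h _ => h1 h]
    generalize ∏ h, D.weight C v σ h = P
    simp only [weight, label_back, label_fwd, label_stem, label_leaf, Option.elim_none,
      Option.elim_some, next_back, next_fwd, next_stem, addLegElim_new, legValues]
    rw [C.vertex_rotate f s bb, ← C.vertex_rotate bb f s]
    linear_combination P * v i l * C.vertex_cube f s bb
  rw [openSum, sum_addLeg]
  simp only [cond, hw, openSum, Finset.mul_sum]
  have hs : ∀ σ : D.H → ι, (∑ bb, ∑ f, ∑ s, ∑ l, if bb = C.bar (σ x) ∧ f = a ∧ l = C.bar s ∧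
      σ (D.opp x) = b ∧ ∀ h, h ≠ x → h ≠ D.opp x → σ (D.opp h) = C.bar (σ h)
      then C.vertex f s bb * v i l * ∏ h, D.weight C v σ h else 0) =
      ∑ s, if σ (D.opp x) = b ∧ ∀ h, h ≠ x → h ≠ D.opp x → σ (D.opp h) = C.bar (σ h)
        then C.vertex a s (C.bar (σ x)) * v i (C.bar s) * ∏ h, D.weight C v σ h else 0 := by
    intro σ
    simp only [ite_and, Finset.sum_ite_eq', Finset.sum_ite_irrel, Finset.sum_const_zero,
      Finset.mem_univ, if_true]
  have hc : ∀ (σ : D.H → ι) (s : ι), (∑ c, C.vertex a s (C.bar c) * v i (C.bar s) *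
      if σ x = c ∧ σ (D.opp x) = b ∧ ∀ h, h ≠ x → h ≠ D.opp x → σ (D.opp h) = C.bar (σ h)
      then ∏ h, D.weight C v σ h else 0) =
      if σ (D.opp x) = b ∧ ∀ h, h ≠ x → h ≠ D.opp x → σ (D.opp h) = C.bar (σ h)
        then C.vertex a s (C.bar (σ x)) * v i (C.bar s) * ∏ h, D.weight C v σ h else 0 := by
    intro σ s
    rw [Finset.sum_eq_single (σ x) (fun c _ hc => by rw [if_neg fun h => hc h.1.symm, mul_zero])
      (fun h => absurd (Finset.mem_univ _) h)]
    simp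
  rw [Finset.sum_congr rfl fun σ _ => hs σ, Finset.sum_comm]
  conv_rhs =>
    rw [Finset.sum_comm]
  refine Finset.sum_congr rfl fun s _ => ?_
  rw [Finset.sum_comm]
  exact Finset.sum_congr rfl fun σ _ => (hc σ s).symm

theorem openSum_strut (i j : M) (a b : ι) :
    (strut i j).openSum C v strutL a b = v i a * v j b := by
  classical
  let e : ι × ι ≃ ((strut i j).H → ι) :=
    { toFun := fun p => strutElim p.1 p.2
      invFun := fun σ => (σ strutL, σ strutR)
      left_inv := fun _ => rfl
      right_inv := fun σ => funext (strut_ind rfl rfl) }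
  have hp : ∀ g : (strut i j).H → R, ∏ h, g h = g strutL * g strutR := by
    intro g
    let s : Bool ≃ (strut i j).H := Equiv.refl _
    rw [← Equiv.prod_comp s, Fintype.prod_bool, mul_comm]
    rfl
  have hc : ∀ p : ι × ι, (e p strutL = a ∧ e p ((strut i j).opp strutL) = b ∧
      ∀ h, h ≠ strutL → h ≠ (strut i j).opp strutL →
        e p ((strut i j).opp h) = C.bar (e p h)) ↔ p = (a, b) := by
    rintro ⟨p, q⟩
    constructor
    · rintro ⟨rfl, rfl, -⟩
      rfl
    · rintro ⟨rfl, rfl⟩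
      exact ⟨rfl, rfl, strut_ind (by simp) (by simp)⟩
  rw [openSum, ← Equiv.sum_comp e]
  simp only [hc, hp]
  rw [Finset.sum_ite_eq' Finset.univ (a, b)]
  have eL : e (a, b) strutL = a := rfl
  have eR : e (a, b) strutR = b := rfl
  simp [weight, eL, eR]

theorem openSum_lollipop (i : M) (a b : ι) :
    (lollipop i).openSum C v (loop .fwd) a b = ∑ s, C.vertex a s b * v i (C.bar s) := by
  classical
  let e : (LegPart → ι) ≃ ((lollipop i).H → ι) := Equiv.refl _
  have he : ∀ ρ p, e ρ (loop p) = ρ p := fun _ _ => rfl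
  have hp : ∀ g : (lollipop i).H → R, ∏ h, g h =
      g (loop .back) * g (loop .fwd) * g (loop .stem) * g (loop .leaf) := by
    intro g
    let s : LegPart ≃ (lollipop i).H := Equiv.refl _
    rw [← Equiv.prod_comp s, Finset.prod_eq_multiset_prod]
    change g (loop .back) * (g (loop .fwd) * (g (loop .stem) * (g (loop .leaf) * 1))) = _
    simp [mul_assoc]
  have hc : ∀ bb f s l, (e (legValues bb f s l) (loop .fwd) = a ∧
      e (legValues bb f s l) ((lollipop i).opp (loop .fwd)) = b ∧
      ∀ h, h ≠ loop .fwd → h ≠ (lollipop i).opp (loop .fwd) →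
        e (legValues bb f s l) ((lollipop i).opp h) = C.bar (e (legValues bb f s l) h)) ↔
      bb = b ∧ f = a ∧ l = C.bar s := by
    intro bb f s l
    constructor
    · rintro ⟨h1, h2, h3⟩
      exact ⟨h2, h1, h3 (loop .stem) (by simp) (by simp)⟩
    · rintro ⟨rfl, rfl, rfl⟩
      refine ⟨rfl, rfl, loop_ind ?_ ?_ ?_ ?_⟩ <;> simp [he, legValues, C.bar_bar]
  have hw : ∀ bb f s l, ∏ h, (lollipop i).weight C v (e (legValues bb f s l)) h =
      C.vertex f s bb * v i l := by
    intro bb f s l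
    rw [hp]
    simp only [weight, label_loop_back, label_loop_fwd, label_loop_stem, label_loop_leaf,
      Option.elim_none, Option.elim_some, next_loop_back, next_loop_fwd, next_loop_stem, he,
      legValues]
    rw [C.vertex_rotate f s bb, ← C.vertex_rotate bb f s]
    linear_combination v i l * C.vertex_cube f s bb
  rw [openSum, ← Equiv.sum_comp e, sum_legValues]
  simp only [hc, hw]
  simp only [ite_and, Finset.sum_ite_eq', Finset.sum_ite_irrel, Finset.sum_const_zero,
      Finset.mem_univ, if_true]

end OpenSum

end UniDiagram

/-! ### Brackets and the values of state sums -/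

namespace ColorSystem

section Bracket

variable {ι R : Type*} [CommRing R] (C : ColorSystem ι R)

theorem κ_mul_rootInd (a : ι) : C.κ a * C.rootInd a = 0 := by
  by_cases h : a = C.root
  · simp [h, C.κ_root]
  · simp [C.rootInd_of_ne h]

variable [Fintype ι]

/-- The Lie bracket of two vectors, in coordinates. -/
noncomputable def bracket (u w : ι → R) (a : ι) : R :=
  ∑ c, ∑ s, C.vertex a s (C.bar c) * u (C.bar s) * w c

/-- The invariant pairing after `k` applications of `κ` to the first vector. -/
noncomputable def pairing (k : ℕ) (u w : ι → R) : R := ∑ a, C.κ a ^ k * u a * w (C.bar a)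

theorem sum_rootInd_mul (g : ι → R) : ∑ a, C.rootInd a * g a = g C.root := by
  classical
  rw [Finset.sum_eq_single C.root (fun a _ h => by rw [C.rootInd_of_ne h, zero_mul])
    (fun h => absurd (Finset.mem_univ _) h), rootInd_root, one_mul]

theorem sum_rootInd_bar_mul (g : ι → R) :
    ∑ a, C.rootInd (C.bar a) * g a = g (C.bar C.root) := by
  rw [← Equiv.sum_comp C.barEquiv]
  simp only [barEquiv_apply, C.bar_bar]
  exact C.sum_rootInd_mul fun a => g (C.bar a)

theorem sum_form_right_mul (a : ι) (g : ι → R) :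
    ∑ s, C.form a s * g s = -C.κ a * g (C.bar a) := by
  classical
  rw [Finset.sum_eq_single (C.bar a) (fun s _ h => ?_) (fun h => absurd (Finset.mem_univ _) h)]
  · simp [form, C.bar_bar, C.κ_bar]
  · rw [form, if_neg fun e => h (C.bar_eq_iff.2 e).symm, zero_mul]

theorem sum_form_left_mul (b : ι) (g : ι → R) :
    ∑ s, C.form s b * g s = C.κ b * g (C.bar b) := by
  simp only [C.form_swap b, neg_mul, Finset.sum_neg_distrib, C.sum_form_right_mul, neg_neg]

theorem sum_vertex_mid_mul (u : ι → R) (a b : ι) :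
    ∑ s, C.vertex a s b * u (C.bar s) = C.rootInd a * (C.κ b * u b) +
      u (C.bar C.root) * C.form b a - C.rootInd b * (C.κ a * u a) := by
  have h : ∀ s, C.vertex a s b * u (C.bar s) = C.rootInd a * (C.form s b * u (C.bar s)) +
      C.rootInd s * (u (C.bar s) * C.form b a) + C.rootInd b * (C.form a s * u (C.bar s)) := by
    intro s
    rw [vertex]
    ring
  rw [Finset.sum_congr rfl fun s _ => h s, Finset.sum_add_distrib, Finset.sum_add_distrib,
    ← Finset.mul_sum, ← Finset.mul_sum, C.sum_form_left_mul, C.sum_form_right_mul,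
    C.sum_rootInd_mul, C.bar_bar, C.bar_bar]
  ring

theorem bracket_eq (u w : ι → R) (a : ι) : C.bracket u w a = C.rootInd a * C.pairing 1 u w +
    C.κ a * (u (C.bar C.root) * w a - w (C.bar C.root) * u a) := by
  have h : ∀ c, ∑ s, C.vertex a s (C.bar c) * u (C.bar s) * w c =
      C.rootInd a * (C.κ (C.bar c) * u (C.bar c) * w (C.bar (C.bar c))) +
        u (C.bar C.root) * (C.form a (C.bar c) * -w c) +
        -(C.rootInd (C.bar c) * (C.κ a * u a * w c)) := by
    intro c
    rw [← Finset.sum_mul, sum_vertex_mid_mul, C.form_swap a, C.bar_bar]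
    ring
  have h2 : ∑ c, C.form a (C.bar c) * -w c = C.κ a * w a := by
    rw [← Equiv.sum_comp C.barEquiv]
    simp only [barEquiv_apply, C.bar_bar]
    rw [C.sum_form_right_mul a fun c => -w (C.bar c), C.bar_bar]
    ring
  rw [bracket, Finset.sum_congr rfl fun c _ => h c, Finset.sum_add_distrib, Finset.sum_add_distrib,
    ← Finset.mul_sum, ← Finset.mul_sum, h2, Finset.sum_neg_distrib, C.sum_rootInd_bar_mul, pairing,
    ← Equiv.sum_comp C.barEquiv (fun a => C.κ a ^ 1 * u a * w (C.bar a))]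
  simp only [barEquiv_apply, pow_one]
  ring

theorem bracket_mul (u w : ι → R) (r : R) (a : ι) :
    C.bracket u (fun c => w c * r) a = C.bracket u w a * r := by
  simp only [bracket, Finset.sum_mul, mul_assoc]

@[simp] theorem bracket_bar_root (u w : ι → R) : C.bracket u w (C.bar C.root) = 0 := by
  simp [bracket_eq, C.κ_bar_root]

theorem κ_mul_bracket (u w : ι → R) (a : ι) : C.κ a * C.bracket u w a =
    C.κ a * C.κ a * (u (C.bar C.root) * w a - w (C.bar C.root) * u a) := by
  rw [bracket_eq]
  linear_combination C.pairing 1 u w * C.κ_mul_rootInd a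

theorem pairing_comm (k : ℕ) (u w : ι → R) :
    C.pairing k w u = (-1) ^ k * C.pairing k u w := by
  rw [pairing, pairing, ← Equiv.sum_comp C.barEquiv, Finset.mul_sum]
  refine Finset.sum_congr rfl fun a _ => ?_
  rw [barEquiv_apply, C.bar_bar, C.κ_bar, neg_pow]
  ring

theorem pairing_bracket (k : ℕ) (u w z : ι → R) : C.pairing k (C.bracket u w) z =
    0 ^ k * (C.pairing 1 u w * z (C.bar C.root)) + u (C.bar C.root) * C.pairing (k + 1) w z -
      w (C.bar C.root) * C.pairing (k + 1) u z := by
  have h : ∀ a, C.κ a ^ k * C.bracket u w a * z (C.bar a) =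
      C.rootInd a * (C.κ a ^ k * (C.pairing 1 u w * z (C.bar a))) +
        u (C.bar C.root) * (C.κ a ^ (k + 1) * w a * z (C.bar a)) -
        w (C.bar C.root) * (C.κ a ^ (k + 1) * u a * z (C.bar a)) := by
    intro a
    rw [bracket_eq]
    ring
  rw [pairing, Finset.sum_congr rfl fun a _ => h a, Finset.sum_sub_distrib, Finset.sum_add_distrib,
    ← Finset.mul_sum, ← Finset.mul_sum, C.sum_rootInd_mul, C.κ_root]
  rfl

theorem pairing_bracket_right (u w : ι → R) : C.pairing 1 u (C.bracket u w) =
    w (C.bar C.root) * C.pairing 2 u u - u (C.bar C.root) * C.pairing 2 u w := by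
  rw [pairing_comm, pairing_bracket, C.pairing_comm 2 w u]
  ring

theorem pairing_one_self [IsDomain R] [CharZero R] (u : ι → R) : C.pairing 1 u u = 0 := by
  have h := C.pairing_comm 1 u u
  rw [pow_one, neg_one_mul] at h
  exact self_eq_neg.1 h

/-- The cube of the operator `bracket u` is a multiple of the operator itself. This is (CL1B). -/
theorem bracket_bracket_bracket [IsDomain R] [CharZero R] (u w : ι → R) (a : ι) :
    C.bracket u (C.bracket u (C.bracket u w)) a =
      u (C.bar C.root) ^ 2 * C.bracket u w a := by
  have hp : C.pairing 1 u (C.bracket u (C.bracket u w)) =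
      u (C.bar C.root) ^ 2 * C.pairing 1 u w := by
    have h3 : ∀ w, C.pairing 3 u w = C.pairing 1 u w := fun w => by
      refine Finset.sum_congr rfl fun a _ => ?_
      linear_combination u a * w (C.bar a) * C.κ_cube a
    rw [pairing_bracket_right, bracket_bar_root, C.pairing_comm 2 (C.bracket u w), pairing_bracket,
      C.pairing_comm 3 u w, h3, h3, pairing_one_self]
    ring
  rw [C.bracket_eq u (C.bracket u (C.bracket u w)), hp, bracket_bar_root,
    C.bracket_eq u w]
  have h1 := C.κ_mul_bracket u (C.bracket u w) a
  have h2 := C.κ_mul_bracket u w a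
  rw [bracket_bar_root] at h1
  linear_combination u (C.bar C.root) * h1 + u (C.bar C.root) ^ 2 * C.κ a * h2 +
    u (C.bar C.root) ^ 2 * (u (C.bar C.root) * w a - w (C.bar C.root) * u a) * C.κ_cube a

end Bracket

end ColorSystem

namespace UniDiagram

section Values

variable {M : Type} {ι R : Type*} [Fintype ι] [CommRing R] {C : ColorSystem ι R} {v : M → ι → R}

theorem openSum_addLeg_eq_bracket (D : UniDiagram M) (x : D.H) (i : M) (a b : ι) :
    (D.addLeg x i).openSum C v (new .fwd) a b =
      C.bracket (v i) (fun c => D.openSum C v x c b) a := openSum_addLeg D x i a b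

theorem openSum_addLeg_of_eq_mul {D : UniDiagram M} {x : D.H} {p q : ι → R}
    (h : ∀ a b, D.openSum C v x a b = p a * q b) (i : M) (a b : ι) :
    (D.addLeg x i).openSum C v (new .fwd) a b = C.bracket (v i) p a * q b := by
  simp only [openSum_addLeg_eq_bracket, h, C.bracket_mul]

theorem stateSum_of_eq_mul {D : UniDiagram M} (x : D.H) {p q : ι → R}
    (h : ∀ a b, D.openSum C v x a b = p a * q b) : D.stateSum C v = C.pairing 0 p q := by
  simp only [D.stateSum_eq_sum_openSum x, h, ColorSystem.pairing, pow_zero, one_mul]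

theorem stateSum_strut (i j : M) : (strut i j).stateSum C v = C.pairing 0 (v i) (v j) :=
  stateSum_of_eq_mul strutL (openSum_strut i j)

theorem stateSum_tripod (i j k : M) :
    (tripod i j k).stateSum C v = C.pairing 0 (C.bracket (v i) (v j)) (v k) :=
  stateSum_of_eq_mul (D := (strut j k).addLeg strutL i) (new .fwd)
    (openSum_addLeg_of_eq_mul (openSum_strut j k) i)

theorem stateSum_hTree (i j k l : M) : (hTree i j k l).stateSum C v =
    C.pairing 0 (C.bracket (v j) (C.bracket (v i) (v k))) (v l) :=
  stateSum_of_eq_mul (D := ((strut k l).addLeg strutL i).addLeg (new .fwd) j) (new .fwd)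
    (openSum_addLeg_of_eq_mul (openSum_addLeg_of_eq_mul (openSum_strut k l) i) j)

theorem stateSum_comb (i m j k l : M) : (comb i m j k l).stateSum C v =
    C.pairing 0 (C.bracket (v j) (C.bracket (v m) (C.bracket (v i) (v k)))) (v l) :=
  stateSum_of_eq_mul
    (D := (((strut k l).addLeg strutL i).addLeg (new .fwd) m).addLeg (new .fwd) j) (new .fwd)
    (openSum_addLeg_of_eq_mul
      (openSum_addLeg_of_eq_mul (openSum_addLeg_of_eq_mul (openSum_strut k l) i) m) j)

theorem stateSum_comb_self [IsDomain R] [CharZero R] (i j k : M) :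
    (comb i i i j k).stateSum C v =
      v i (C.bar C.root) ^ 2 * (tripod i j k).stateSum C v := by
  rw [stateSum_comb, stateSum_tripod, ColorSystem.pairing, ColorSystem.pairing, Finset.mul_sum]
  refine Finset.sum_congr rfl fun a _ => ?_
  rw [C.bracket_bracket_bracket]
  ring

/-- Up to the factor, two legs on an inner edge act as `κ ^ 2`, hence as the identity on all colors
that can occur at the edge. -/
theorem stateSum_addTwoLegs (D : UniDiagram M) (x : D.H) (hx : D.IsInner x) (i j : M) :
    (D.addTwoLegs x i j).stateSum C v =
      v i (C.bar C.root) * v j (C.bar C.root) * D.stateSum C v := by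
  rw [addTwoLegs_eq, stateSum_eq_sum_openSum _ (new .fwd), D.stateSum_eq_sum_openSum x,
    Finset.mul_sum]
  refine Finset.sum_congr rfl fun a _ => ?_
  have h0 := fun b => D.openSum_left_eq_zero (C := C) (v := v) hx.1 C.vertex_bar_root b
  have h1 := fun b => D.openSum_right_eq_zero (C := C) (v := v) hx.2.1 C.vertex_bar_root b
  simp only [openSum_addLeg_eq_bracket]
  by_cases ha : a = C.root
  · simp [ha, h1, ColorSystem.bracket]
  rw [C.bracket_eq (v j), C.rootInd_of_ne ha, C.bracket_bar_root]
  have h2 := C.κ_mul_bracket (v i) (fun c => D.openSum C v x c (C.bar a)) a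
  rw [h0] at h2
  have h3 : C.κ a * C.κ a * D.openSum C v x a (C.bar a) = D.openSum C v x a (C.bar a) := by
    rcases C.κ_cases a with h | h | h
    · rw [D.openSum_left_eq_zero hx.1 (C.vertex_eq_zero_of_κ ha h), mul_zero]
    · rw [h]
      ring
    · rw [h]
      ring
  linear_combination v j (C.bar C.root) * h2 + v i (C.bar C.root) * v j (C.bar C.root) * h3

/-- A wheel is the trace of a product of two operators `bracket (v i)`. -/
theorem stateSum_wheel (i j : M) : (wheel i j).stateSum C v =
    v i (C.bar C.root) * v j (C.bar C.root) * ∑ a, C.κ a ^ 2 := by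
  rw [wheel_eq, stateSum_eq_sum_openSum _ (new .fwd), Finset.mul_sum]
  refine Finset.sum_congr rfl fun a _ => ?_
  simp only [openSum_addLeg_eq_bracket, openSum_lollipop, C.sum_vertex_mid_mul]
  by_cases ha : a = C.root
  · simp [ha, C.κ_bar_root, ColorSystem.bracket, C.κ_root]
  have h1 := C.κ_mul_rootInd (C.bar a)
  rw [C.κ_bar] at h1
  have h2 : C.form (C.bar a) a = C.κ a := by simp [ColorSystem.form]
  rw [C.bracket_eq, C.rootInd_of_ne ha, h2]
  simp only [C.rootInd_bar_root, C.form_bar_root_right, C.κ_bar_root]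
  linear_combination v i a * C.κ a * v j (C.bar C.root) * h1

end Values

end UniDiagram

/-! ### Weight systems with prescribed values -/

instance LaurentRing.instCharZero (n : ℕ) : CharZero (LaurentRing n) :=
  algebraRat.charZero (LaurentRing n)

namespace ColorSystem

/-- Colors in dual pairs: `root` with `bar root`, the pairs indexed by `K`, on which the basis
vector of `bar root` acts by `±1`, and the pairs indexed by `L`, which are central. -/
def standard (K L R : Type*) [CommRing R] : ColorSystem (Option (K ⊕ L) × Bool) R where
  bar a := (a.1, !a.2)
  root := (none, false)
  κ a := match a with
    | (some (Sum.inl _), true) => -1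
    | (some (Sum.inl _), false) => 1
    | _ => 0
  bar_bar a := by simp
  bar_root_ne := by simp
  κ_root := rfl
  κ_bar := by rintro ⟨_ | _ | _, _ | _⟩ <;> simp
  κ_cases := by rintro ⟨_ | _ | _, _ | _⟩ <;> simp

section

variable {K L R : Type*} [CommRing R]

theorem standard_bar (j : Option (K ⊕ L)) (e : Bool) :
    (standard K L R).bar (j, e) = (j, !e) := rfl
theorem standard_root : (standard K L R).root = (none, false) := rfl
@[simp] theorem standard_κ_none (e : Bool) : (standard K L R).κ (none, e) = 0 := by
  cases e <;> rfl
@[simp] theorem standard_κ_inr (l : L) (e : Bool) :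
    (standard K L R).κ (some (Sum.inr l), e) = 0 := by
  cases e <;> rfl
@[simp] theorem standard_κ_true (k : K) : (standard K L R).κ (some (Sum.inl k), true) = -1 := rfl
@[simp] theorem standard_κ_false (k : K) : (standard K L R).κ (some (Sum.inl k), false) = 1 := rfl

theorem standard_pairing [Fintype K] [Fintype L] (k : ℕ) (u w : Option (K ⊕ L) × Bool → R) :
    (standard K L R).pairing k u w =
      0 ^ k * (u (none, true) * w (none, false) + u (none, false) * w (none, true)) +
      (∑ a, ((-1) ^ k * u (some (Sum.inl a), true) * w (some (Sum.inl a), false) +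
        u (some (Sum.inl a), false) * w (some (Sum.inl a), true)) +
      0 ^ k * ∑ a, (u (some (Sum.inr a), true) * w (some (Sum.inr a), false) +
        u (some (Sum.inr a), false) * w (some (Sum.inr a), true))) := by
  rw [pairing, Fintype.sum_prod_type]
  simp only [Fintype.sum_option, Fintype.sum_sum_type, Fintype.sum_bool, standard_bar,
    standard_κ_none, standard_κ_inr, standard_κ_true, standard_κ_false, one_pow, one_mul,
    Bool.not_true, Bool.not_false, Finset.mul_sum]
  rw [mul_add]
  simp only [mul_add, mul_assoc]

theorem standard_sum_κ_sq [Fintype K] [Fintype L] :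
    ∑ a, (standard K L R).κ a ^ 2 = 2 * Fintype.card K := by
  rw [Fintype.sum_prod_type]
  simp only [Fintype.sum_option, Fintype.sum_sum_type, Fintype.sum_bool, standard_κ_none,
    standard_κ_inr, standard_κ_true, standard_κ_false]
  simp
  ring

end

end ColorSystem

namespace WeightSystem

variable {n : ℕ} {A : Type*} [CommRing A] [Algebra (LaurentRing n) A]

/-- A weight system as a homomorphism of monoids. -/
def toMonoidHom (w : WeightSystem n A) : DiagramClass (Fin n) →* A where
  toFun := Quotient.lift w.val fun _ _ h => w.iso h
  map_one' := w.empty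
  map_mul' := by
    rintro ⟨D⟩ ⟨E⟩
    exact w.union D E

/-- A weight system as a homomorphism of algebras on formal linear combinations of diagrams. -/
noncomputable def freeLift (w : WeightSystem n A) :
    FreeDiagramAlgebra n →ₐ[LaurentRing n] A :=
  MonoidAlgebra.lift (LaurentRing n) A (DiagramClass (Fin n)) w.toMonoidHom

theorem freeLift_toFree (w : WeightSystem n A) (D : UniDiagram (Fin n)) :
    w.freeLift D.toFree = w.val D :=
  MonoidAlgebra.lift_of w.toMonoidHom D.cls

theorem freeLift_rel (w : WeightSystem n A) {r : FreeDiagramAlgebra n} (h : DiagramRel n r) :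
    w.freeLift r = 0 := by
  cases h with
  | as D h hh => rw [map_add, freeLift_toFree, freeLift_toFree, w.flip, add_neg_cancel]
  | ihx D x hx =>
    rw [map_add, map_add, freeLift_toFree, freeLift_toFree, freeLift_toFree, w.ihx]
  | intV D h hh h0 h1 h2 => rw [freeLift_toFree, w.intV D h hh h0 h1 h2]
  | cl1b i j k E =>
    rw [map_sub, map_smul, freeLift_toFree, freeLift_toFree, w.union, w.union, w.comb,
      smul_mul_assoc, sub_self]
  | cl2b D x hx i j =>
    rw [map_sub, map_smul, freeLift_toFree, freeLift_toFree, w.addTwoLegs D x hx, sub_self]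

/-- A weight system as a homomorphism of algebras on `𝒟(n)`. -/
noncomputable def lift (w : WeightSystem n A) : DiagramAlgebra n →ₐ[LaurentRing n] A :=
  Ideal.Quotient.liftₐ _ w.freeLift fun a ha => by
    have h : Ideal.span {r : FreeDiagramAlgebra n | DiagramRel n r} ≤ RingHom.ker w.freeLift :=
      Ideal.span_le.2 fun r hr => w.freeLift_rel hr
    exact h ha

theorem lift_diagramElt (w : WeightSystem n A) (D : UniDiagram (Fin n)) :
    w.lift (diagramElt D.cls) = w.val D := w.freeLift_toFree D

/-- The weight system of a state sum. -/
noncomputable def ofColors {ι : Type*} [Fintype ι] (C : ColorSystem ι (LaurentRing n))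
    (v : Fin n → ι → LaurentRing n) (hv : ∀ i, v i (C.bar C.root) = dVar i) :
    WeightSystem n (LaurentRing n) where
  val D := D.stateSum C v
  iso h := UniDiagram.stateSum_iso h
  union := UniDiagram.stateSum_union
  empty := UniDiagram.stateSum_empty
  flip := UniDiagram.stateSum_flip
  ihx := UniDiagram.stateSum_ihx
  intV := UniDiagram.stateSum_intV
  comb i j k := by rw [UniDiagram.stateSum_comb_self, hv, smul_eq_mul]
  addTwoLegs D x hx i j := by rw [UniDiagram.stateSum_addTwoLegs D x hx, hv, hv, smul_eq_mul]

end WeightSystem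

section Parameters

variable {n : ℕ} {N : ℕ}

/-- The vector of a label `i`. The matrices `r` and `m` are parameters: `r` determines the tripods
and the trees with two trivalent vertices, `m` only the struts. The number `N` of further dual
pairs, in which the vectors have no components, only affects the wheels. -/
noncomputable def labelVector (N : ℕ) (r m : Fin n → Fin n → LaurentRing n) (i : Fin n) :
    Option ((Fin n ⊕ Fin N) ⊕ Fin n) × Bool → LaurentRing n
  | (none, true) => dVar i
  | (none, false) => 0
  | (some (Sum.inl (Sum.inl a)), true) => if a = i then dVar i else 0
  | (some (Sum.inl (Sum.inl a)), false) => dVar i * r i a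
  | (some (Sum.inl (Sum.inr _)), _) => 0
  | (some (Sum.inr a), true) => if a = i then 1 else 0
  | (some (Sum.inr a), false) => m i a

variable (N) in
/-- The state sum with the vectors `labelVector`. -/
noncomputable def paramWeight (r m : Fin n → Fin n → LaurentRing n) :
    WeightSystem n (LaurentRing n) :=
  WeightSystem.ofColors (ColorSystem.standard (Fin n ⊕ Fin N) (Fin n) (LaurentRing n))
    (labelVector N r m) fun _ => rfl

variable (r m : Fin n → Fin n → LaurentRing n)

theorem pairing_labelVector (k : ℕ) (i j : Fin n) :
    (ColorSystem.standard (Fin n ⊕ Fin N) (Fin n) (LaurentRing n)).pairing k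
      (labelVector N r m i) (labelVector N r m j) =
    dVar i * dVar j * (r i j + (-1) ^ k * r j i) + 0 ^ k * (m i j + m j i) := by
  rw [ColorSystem.standard_pairing]
  simp [labelVector, Fintype.sum_sum_type, Finset.sum_add_distrib]
  ring

theorem paramWeight_strut (i j : Fin n) : (paramWeight N r m).val (UniDiagram.strut i j) =
    dVar i * dVar j * (r i j + r j i) + (m i j + m j i) := by
  refine UniDiagram.stateSum_strut i j |>.trans ?_
  rw [pairing_labelVector]
  simp

theorem paramWeight_tripod [NeZero n] (hr : ∀ a, r 0 a = 0) (hr' : ∀ a, r a 0 = 0) (i j : Fin n) :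
    (paramWeight N r m).val (UniDiagram.tripod 0 i j) =
      dVar 0 * dVar i * dVar j * (r i j - r j i) := by
  refine UniDiagram.stateSum_tripod 0 i j |>.trans ?_
  rw [ColorSystem.pairing_bracket]
  simp only [pairing_labelVector, hr, hr', ColorSystem.standard_root, ColorSystem.standard_bar,
    labelVector, Bool.not_false]
  ring

theorem paramWeight_hTree [NeZero n] (hr : ∀ a, r 0 a = 0) (hr' : ∀ a, r a 0 = 0) (i j : Fin n) :
    (paramWeight N r m).val (UniDiagram.hTree 0 0 i j) =
      dVar 0 ^ 2 * dVar i * dVar j * (r i j + r j i) := by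
  refine UniDiagram.stateSum_hTree 0 0 i j |>.trans ?_
  rw [ColorSystem.pairing_bracket, ColorSystem.pairing_bracket_right, ColorSystem.pairing_bracket,
    ColorSystem.bracket_bar_root]
  simp only [pairing_labelVector, hr, hr', ColorSystem.standard_root, ColorSystem.standard_bar,
    labelVector, Bool.not_false]
  ring

theorem paramWeight_wheel (i j : Fin n) : (paramWeight N r m).val (UniDiagram.wheel i j) =
    dVar i * dVar j * (2 * ((n + N : ℕ) : LaurentRing n)) := by
  refine UniDiagram.stateSum_wheel i j |>.trans ?_
  rw [ColorSystem.standard_sum_κ_sq]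
  simp only [ColorSystem.standard_root, ColorSystem.standard_bar, labelVector, Bool.not_false,
    Fintype.card_sum, Fintype.card_fin]

end Parameters

/-! ### Freeness -/

section Freeness

variable {n : ℕ} [NeZero n]

theorem exists_half (n : ℕ) : ∃ c : LaurentRing n, c + c = 1 :=
  ⟨algebraMap ℚ (LaurentRing n) (1 / 2), by
    rw [← map_add, ← map_one (algebraMap ℚ (LaurentRing n))]
    norm_num⟩

/-- The parameters can be chosen such that the struts, the tripods and the trees with two trivalent
vertices in the generating set have arbitrary values. -/
theorem exists_parameters (s t h : Fin n → Fin n → LaurentRing n) :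
    ∃ r m : Fin n → Fin n → LaurentRing n, (∀ a, r 0 a = 0) ∧ (∀ a, r a 0 = 0) ∧
      (∀ a b, a ≤ b → dVar a * dVar b * (r a b + r b a) + (m a b + m b a) = s a b) ∧
      (∀ a b, 0 < a → a < b → dVar 0 * dVar a * dVar b * (r a b - r b a) = t a b) ∧
      ∀ a b, 0 < a → a ≤ b → dVar 0 ^ 2 * dVar a * dVar b * (r a b + r b a) = h a b := by
  obtain ⟨c, hc⟩ := exists_half n
  choose e he using fun i : Fin n => (DiagramAlgebra.isUnit_dVar i).exists_right_inv
  -- The solution of the equations for `r a b + r b a` and `r a b - r b a`.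
  let r : Fin n → Fin n → LaurentRing n := fun a b =>
    if a = 0 ∨ b = 0 then 0
    else if a = b then c * (e 0 * e 0 * e a * e b * h a b)
    else if a < b then c * (e 0 * e 0 * e a * e b * h a b + e 0 * e a * e b * t a b)
    else c * (e 0 * e 0 * e b * e a * h b a - e 0 * e b * e a * t b a)
  let q : Fin n → Fin n → LaurentRing n := fun a b => s a b - dVar a * dVar b * (r a b + r b a)
  let m : Fin n → Fin n → LaurentRing n := fun a b =>
    if a = b then c * q a b else if a < b then q a b else 0
  have one₂ : ∀ a b, (dVar a * e a) * (dVar b * e b) = 1 := fun a b => by rw [he, he, one_mul]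
  have hsum : ∀ a b, 0 < a → a ≤ b → r a b + r b a = e 0 * e 0 * e a * e b * h a b := by
    intro a b ha hab
    have hb := ha.trans_le hab
    rcases hab.eq_or_lt with rfl | hlt
    · simp only [r, ha.ne', or_self, if_false, if_true]
      linear_combination (e 0 * e 0 * e a * e a * h a a) * hc
    · simp only [r, ha.ne', hb.ne', hlt.ne, hlt.ne', hlt, hlt.not_gt, or_self, if_false, if_true]
      linear_combination (e 0 * e 0 * e a * e b * h a b) * hc
  refine ⟨r, m, fun a => by simp [r], fun a => by simp [r], fun a b hab => ?_,
    fun a b ha hab => ?_, fun a b ha hab => ?_⟩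
  · have hm : m a b + m b a = q a b := by
      rcases hab.eq_or_lt with rfl | hlt
      · simp only [m, if_true]
        linear_combination q a a * hc
      · simp only [m, hlt.ne, hlt.ne', hlt, hlt.not_gt, if_false, if_true, add_zero]
    rw [hm]
    simp only [q]
    ring
  · have hb := ha.trans hab
    have h1 : r a b - r b a = e 0 * e a * e b * t a b := by
      simp only [r, ha.ne', hb.ne', hab.ne, hab.ne', hab, hab.not_gt, or_self, if_false, if_true]
      linear_combination (e 0 * e a * e b * t a b) * hc
    rw [h1]
    linear_combination t a b * (dVar 0 * e 0) * one₂ a b + t a b * he 0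
  · rw [hsum a b ha hab]
    linear_combination h a b * (dVar 0 * e 0) * (dVar 0 * e 0) * one₂ a b + h a b * one₂ 0 0

/-- The values of the state sums `paramWeight N` on the wheel. -/
theorem infinite_wheel_values (n : ℕ) [NeZero n] :
    (Set.range fun N : ℕ => (dVar 0 * dVar 0 * (2 * ((n + N : ℕ) : LaurentRing n)) :
      LaurentRing n)).Infinite := by
  refine Set.infinite_range_of_injective fun N N' h => ?_
  have h0 : (dVar 0 : LaurentRing n) ≠ 0 := (DiagramAlgebra.isUnit_dVar 0).ne_zero
  have h1 := mul_left_cancel₀ two_ne_zero (mul_left_cancel₀ (mul_ne_zero h0 h0) h)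
  have h2 : n + N = n + N' := Nat.cast_injective h1
  omega

theorem finite_generatorSet (n : ℕ) [NeZero n] : (generatorSet n).Finite := by
  refine Set.Finite.union (Set.Finite.union (Set.Finite.union ?_ ?_) ?_) (Set.finite_singleton _)
  · refine (Set.finite_range fun p : Fin n × Fin n => (UniDiagram.strut p.1 p.2).cls).subset ?_
    rintro _ ⟨a, b, -, rfl⟩
    exact ⟨(a, b), rfl⟩
  · refine (Set.finite_range fun p : Fin n × Fin n => (UniDiagram.tripod 0 p.1 p.2).cls).subset ?_
    rintro _ ⟨a, b, -, -, rfl⟩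
    exact ⟨(a, b), rfl⟩
  · refine (Set.finite_range fun p : Fin n × Fin n =>
      (UniDiagram.hTree 0 0 p.1 p.2).cls).subset ?_
    rintro _ ⟨a, b, -, -, rfl⟩
    exact ⟨(a, b), rfl⟩

variable (n) in
/-- The homomorphism from the polynomial ring on the generating set to `𝒟(n)`. -/
noncomputable abbrev generatorHom :
    MvPolynomial (generatorSet n) (LaurentRing n) →ₐ[LaurentRing n] DiagramAlgebra n :=
  MvPolynomial.aeval (R := LaurentRing n)
    (fun g : generatorSet n => diagramElt (g : DiagramClass (Fin n)))

theorem generatorHom_surjective : Function.Surjective (generatorHom n) := by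
  have hg : ∀ x : DiagramClass (Fin n), x ∈ generatorSet n →
      diagramElt x ∈ (generatorHom n).range := fun x hx =>
    ⟨MvPolynomial.X ⟨x, hx⟩, MvPolynomial.aeval_X _ _⟩
  have hD : ∀ D : UniDiagram (Fin n), diagramElt D.cls ∈ (generatorHom n).range :=
    (DiagramAlgebra.universalWeight n).val_mem (generatorHom n).range
      (fun a b h => hg _ (Or.inl (Or.inl (Or.inl ⟨a, b, h, rfl⟩))))
      (fun a b h h' => hg _ (Or.inl (Or.inl (Or.inr ⟨a, b, h, h', rfl⟩))))
      (fun a b h h' => hg _ (Or.inl (Or.inr ⟨a, b, h, h', rfl⟩))) (hg _ (Or.inr rfl))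
  intro x
  obtain ⟨y, rfl⟩ := Ideal.Quotient.mk_surjective x
  change _ ∈ (generatorHom n).range
  induction y using MonoidAlgebra.induction_on with
  | of g =>
    obtain ⟨D, rfl⟩ := Quotient.exists_rep g
    exact hD D
  | add a b ha hb =>
    rw [map_add]
    exact Subalgebra.add_mem _ ha hb
  | smul c a ha =>
    rw [DiagramAlgebra.mk_smul]
    exact Subalgebra.smul_mem _ ha c

/-- The state sums give homomorphisms to `Λ(n)` with arbitrary values on the generators other than
the wheel and infinitely many values on the wheel; a polynomial in the kernel vanishes at all these
points. -/
theorem generatorHom_injective : Function.Injective (generatorHom n) := by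
  rw [injective_iff_map_eq_zero]
  intro p hp
  refine MvPolynomial.funext_set (fun _ => _) (fun _ => infinite_wheel_values n) fun c hc => ?_
  rw [map_zero]
  obtain ⟨N, hN⟩ := hc ⟨(UniDiagram.wheel 0 0).cls, Or.inr rfl⟩ trivial
  set c' : DiagramClass (Fin n) → LaurentRing n := Function.extend Subtype.val c 0
  have hc' : ∀ g : generatorSet n, c' g = c g := fun g =>
    Subtype.val_injective.extend_apply c 0 g
  obtain ⟨r, m, hr, hr', hs, ht, hh⟩ := exists_parameters
    (fun a b => c' (UniDiagram.strut a b).cls) (fun a b => c' (UniDiagram.tripod 0 a b).cls)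
    (fun a b => c' (UniDiagram.hTree 0 0 a b).cls)
  have key : ∀ g : generatorSet n,
      (paramWeight N r m).lift (diagramElt (g : DiagramClass (Fin n))) = c g := by
    rintro ⟨g, hg⟩
    rw [← hc']
    rcases id hg with ((⟨a, b, hab, rfl⟩ | ⟨a, b, ha, hab, rfl⟩) | ⟨a, b, ha, hab, rfl⟩) | rfl
    · rw [WeightSystem.lift_diagramElt, paramWeight_strut, hs a b hab]
    · rw [WeightSystem.lift_diagramElt, paramWeight_tripod r m hr hr', ht a b ha hab]
    · rw [WeightSystem.lift_diagramElt, paramWeight_hTree r m hr hr', hh a b ha hab]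
    · rw [WeightSystem.lift_diagramElt, paramWeight_wheel, hc' ⟨_, hg⟩]
      exact hN
  have h : (paramWeight N r m).lift.comp (generatorHom n) = MvPolynomial.aeval c :=
    MvPolynomial.algHom_ext fun g => by
      rw [MvPolynomial.aeval_X, ← key g]
      exact congrArg _ (MvPolynomial.aeval_X _ g)
  have h' := DFunLike.congr_fun h p
  rw [MvPolynomial.aeval_eq_eval] at h'
  exact h'.symm.trans ((congrArg _ hp).trans (map_zero _))

end Freeness

theorem theorem8 (n : ℕ) [NeZero n] :
    (generatorSet n).Finite ∧
      Function.Bijective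
        (MvPolynomial.aeval (R := LaurentRing n)
          (fun g : generatorSet n => diagramElt (g : DiagramClass (Fin n))) :
          MvPolynomial (generatorSet n) (LaurentRing n) →ₐ[LaurentRing n] DiagramAlgebra n) :=
  ⟨finite_generatorSet n, generatorHom_injective, generatorHom_surjective⟩
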